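/- Let $\mathbb F$ be an algebraically closed field. **Symplectic blob algebras.** For $\Pi=(\delta,\delta_L,\delta_R,\kappa_L,\kappa_R,\kappa)\in\mathbb F^6$ and $n\ge 1$, let $b'_n(\Pi)$ be the unital associative $\mathbb F$-algebra generated by $e,U_1,\dots,U_{n-1},f$ subject to $U_i^2=\delta U_i$; $U_iU_jU_i=U_i$ if $|i-j|=1$; $U_iU_j=U_jU_i$ if $|i-j|\neq1$; $e^2=\delta_Le$; $U_1eU_1=\kappa_LU_1$; $eU_i=U_ie$ if $i\ne1$; $f^2=\delta_Rf$; $U_{n-1}fU_{n-1}=\kappa_RU_{n-1}$; $fU_i=U_if$ if $i\neq n-1$; $ef=fe$ if $n>1$; $IJI=\kappa I$; $JIJ=\kappa J$ (a relation is imposed whenever the generators in it exist). Here $I=U_1U_3\cdots U_{n-1}$ and $J=eU_2U_4\cdots U_{n-2}f$ if $n$ is even, and $I=U_1U_3\cdots U_{n-2}f$ and $J=eU_2U_4\cdots U_{n-1}$ if $n$ is odd (so $I=f$ and $J=e$ for $n=1$). Put $b'_0(\Pi)=\mathbb F$. Put $$\Pi_L=(\delta,\kappa_L,\delta_R,\delta_L,\kappa_R,\kappa),\qquad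 \Pi_R=(\delta,\delta_L,\kappa_R,\kappa_L,\delta_R,\kappa).$$ **Tensor space modules.** Let $\Sigma=(a,b,c,d,x,y,z,w)\in(\mathbb F^\times)^8$ and $[2]_q=q+q^{-1}$. Say that $(\Sigma,\Pi)$ is *compatible for $n$* if $$\delta=[2]_a[2]_b[2]_c[2]_d,\quad \delta_L=[2]_x[2]_y,\quad \delta_R=[2]_z[2]_w,\quad \kappa_L=[2]_{ab/x}[2]_{cd/y},\quad \kappa_R=[2]_{ad/w}[2]_{bc/z},$$ and $\kappa=\frac{xy}{zw}+2+\frac{zw}{xy}$ if $n$ is odd, $\kappa=\frac{abcd}{xyzw}+2+\frac{xyzw}{abcd}$ if $n$ is even. Let $V$ have basis $v_1,v_2$. The $4n$ factors of $V^{\otimes 4n}$ are labelled $-2n+1,\dots,2n$, cyclically (the successor of $2n$ is $-2n+1$). A word $\alpha$ in the letters $1,2$ of length $4n$ stands for the corresponding basis tensor. For $q\in\mathbb F^\times$ and a position $i$, the operator $R^q_i$ kills every word with $\alpha_i=\alpha_{i+1}$ and replaces the letters at positions $i,i+1$ of a word by $12\mapsto q\cdot12+21$ and by $21\mapsto 12+q^{-1}\cdot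 21$. If $(\Sigma,\Pi)$ is compatible for $n$, then $$U_i\mapsto R^a_{-n-i}R^b_{-n+i}R^c_{n-i}R^d_{n+i},\qquad e\mapsto R^x_{-n}R^y_n,\qquad f\mapsto R^z_0R^w_{2n}$$ makes $V^{\otimes 4n}$ a $b'_n(\Pi)$-module, denoted $\mathcal V(n;\Sigma)$. (For $n=0$ it is the $\mathbb F$-space $\mathbb F$, with basis the empty word.) **Localisation.** Let $n\ge1$ and let $M$ be a $b'_n(\Pi)$-module. If $\delta_L\ne0$, put $\bar e=\delta_L^{-1}e$ and $F_eM=\bar eM$; this is a $b'_{n-1}(\Pi_L)$-module through the algebra homomorphism $b'_{n-1}(\Pi_L)\to\bar e\,b'_n(\Pi)\,\bar e$ with $$e\mapsto \delta_L^{-1}eU_1e,\qquad U_i\mapsto \bar eU_{i+1}\bar e,\qquad f\mapsto\bar ef\bar e .$$ If $\delta_R\ne0$, put $\bar f=\delta_R^{-1}f$ and $F_fM=\bar fM$; this is a $b'_{n-1}(\Pi_R)$-module through the algebra homomorphism $b'_{n-1}(\Pi_R)\to\bar f\,b'_n(\Pi)\,\bar f$ with $$e\mapsto\bar fe\bar f,\qquad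 U_i\mapsto\bar fU_i\bar f,\qquad f\mapsto\delta_R^{-1}fU_{n-1}f .$$ **Proposition.** Let $n\ge1$, let $(\Sigma,\Pi)$ be compatible for $n$, and put $$\Sigma_L=(a,b,c,d,\tfrac{ab}{x},\tfrac{cd}{y},z,w),\qquad \Sigma_R=(a,b,c,d,x,y,\tfrac{bc}{z},\tfrac{ad}{w}).$$ Then $(\Sigma_L,\Pi_L)$ and $(\Sigma_R,\Pi_R)$ are compatible for $n-1$, so that $\mathcal V(n-1;\Sigma_L)$ is a $b'_{n-1}(\Pi_L)$-module and $\mathcal V(n-1;\Sigma_R)$ is a $b'_{n-1}(\Pi_R)$-module. Moreover: 1. If $\delta_L\neq0$, then $F_e\mathcal V(n;\Sigma)\cong\mathcal V(n-1;\Sigma_L)$ as $b'_{n-1}(\Pi_L)$-modules. An isomorphism $\mathcal V(n-1;\Sigma_L)\to F_e\mathcal V(n;\Sigma)$ is the linear map that sends a word $\alpha_{-2n+3}\cdots\alpha_{2n-2}$ to $$\alpha_{-2n+3}\cdots\alpha_{-n+1}\otimes(x\cdot12+21)\otimes\alpha_{-n+2}\cdots\alpha_{n-1}\otimes(y\cdot12+21)\otimes\alpha_n\cdots\alpha_{2n-2},$$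 so that the inserted vectors stand at the positions $-n,-n+1$ and $n,n+1$. 2. If $\delta_R\neq0$, then $F_f\mathcal V(n;\Sigma)\cong\mathcal V(n-1;\Sigma_R)$ as $b'_{n-1}(\Pi_R)$-modules. An isomorphism $\mathcal V(n-1;\Sigma_R)\to F_f\mathcal V(n;\Sigma)$ is the linear map that inserts into a word $\alpha_{-2n+3}\cdots\alpha_{2n-2}$ the vector $z\cdot12+21$ at the positions $0,1$, between $\alpha_0$ and $\alpha_1$, and the vector $w\cdot12+21$ at the cyclically adjacent positions $2n,-2n+1$ (first letter at $2n$, second letter at $-2n+1$). (For $n=1$ the word is empty.) -/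

import Mathlib

open scoped TensorProduct

namespace SympBlob

/-- The six parameters `(δ, δ_L, δ_R, κ_L, κ_R, κ)` of a symplectic blob algebra. -/
structure BlobParams (F : Type*) where
  δ : F
  δL : F
  δR : F
  κL : F
  κR : F
  κ : F

/-- `Π_L = (δ, κ_L, δ_R, δ_L, κ_R, κ)`. -/
def BlobParams.left {F : Type*} (P : BlobParams F) : BlobParams F :=
  ⟨P.δ, P.κL, P.δR, P.δL, P.κR, P.κ⟩

/-- `Π_R = (δ, δ_L, κ_R, κ_L, δ_R, κ)`. -/
def BlobParams.right {F : Type*} (P : BlobParams F) : BlobParams F :=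
  ⟨P.δ, P.δL, P.κR, P.κL, P.δR, P.κ⟩

/-- The generators `e, U_1, …, U_{n-1}, f`. There are none for `n = 0`, so that the algebra
with index `0` is the ground field. -/
inductive Gen (n : ℕ) : Type
  | e (h : 1 ≤ n) : Gen n
  | f (h : 1 ≤ n) : Gen n
  | U (i : ℕ) (h : 1 ≤ i ∧ i < n) : Gen n

/-- The value of the generator `U_i` under an assignment `g` (used only for `1 ≤ i < n`). -/
def uOf {n : ℕ} {A : Type*} [One A] (g : Gen n → A) (i : ℕ) : A :=
  if h : 1 ≤ i ∧ i < n then g (.U i h) else 1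

/-- `I = U_1 U_3 ⋯ U_{n-2} f` for odd `n`, and `I = U_1 U_3 ⋯ U_{n-1}` for even `n`. -/
def wordI {n : ℕ} {A : Type*} [Monoid A] (g : Gen n → A) : A :=
  ((List.range (n / 2)).map fun k => uOf g (2 * k + 1)).prod *
    if h : Odd n then g (.f h.pos) else 1

/-- `J = e U_2 U_4 ⋯ U_{n-1}` for odd `n`, and `J = e U_2 U_4 ⋯ U_{n-2} f` for even `n`. -/
def wordJ {n : ℕ} {A : Type*} [Monoid A] (hn : 1 ≤ n) (g : Gen n → A) : A :=
  g (.e hn) * ((List.range ((n - 1) / 2)).map fun k => uOf g (2 * k + 2)).prod *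
    if Even n then g (.f hn) else 1

/-- The generators, seen in the free algebra. -/
def fg {F : Type*} [Field F] {n : ℕ} : Gen n → FreeAlgebra F (Gen n) := FreeAlgebra.ι F

/-- The defining relations of the symplectic blob algebra. -/
inductive Rel {F : Type*} [Field F] (n : ℕ) (P : BlobParams F) :
    FreeAlgebra F (Gen n) → FreeAlgebra F (Gen n) → Prop
  | U_sq (i : ℕ) (h : 1 ≤ i ∧ i < n) : Rel n P (fg (.U i h) * fg (.U i h)) (P.δ • fg (.U i h))
  | UUU (i j : ℕ) (hi : 1 ≤ i ∧ i < n) (hj : 1 ≤ j ∧ j < n) (hij : i = j + 1 ∨ j = i + 1) :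
      Rel n P (fg (.U i hi) * fg (.U j hj) * fg (.U i hi)) (fg (.U i hi))
  | UU (i j : ℕ) (hi : 1 ≤ i ∧ i < n) (hj : 1 ≤ j ∧ j < n) (hij : ¬ (i = j + 1 ∨ j = i + 1)) :
      Rel n P (fg (.U i hi) * fg (.U j hj)) (fg (.U j hj) * fg (.U i hi))
  | e_sq (h : 1 ≤ n) : Rel n P (fg (.e h) * fg (.e h)) (P.δL • fg (.e h))
  | f_sq (h : 1 ≤ n) : Rel n P (fg (.f h) * fg (.f h)) (P.δR • fg (.f h))
  | UeU (h : 1 ≤ n) (h1 : 1 ≤ 1 ∧ 1 < n) :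
      Rel n P (fg (.U 1 h1) * fg (.e h) * fg (.U 1 h1)) (P.κL • fg (.U 1 h1))
  | UfU (h : 1 ≤ n) (h1 : 1 ≤ n - 1 ∧ n - 1 < n) :
      Rel n P (fg (.U (n - 1) h1) * fg (.f h) * fg (.U (n - 1) h1)) (P.κR • fg (.U (n - 1) h1))
  | eU (h : 1 ≤ n) (i : ℕ) (hi : 1 ≤ i ∧ i < n) (hne : i ≠ 1) :
      Rel n P (fg (.e h) * fg (.U i hi)) (fg (.U i hi) * fg (.e h))
  | fU (h : 1 ≤ n) (i : ℕ) (hi : 1 ≤ i ∧ i < n) (hne : i ≠ n - 1) :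
      Rel n P (fg (.f h) * fg (.U i hi)) (fg (.U i hi) * fg (.f h))
  | ef (h : 1 ≤ n) (h1 : 1 < n) : Rel n P (fg (.e h) * fg (.f h)) (fg (.f h) * fg (.e h))
  | IJI (h : 1 ≤ n) : Rel n P (wordI fg * wordJ h fg * wordI fg) (P.κ • wordI fg)
  | JIJ (h : 1 ≤ n) : Rel n P (wordJ h fg * wordI fg * wordJ h fg) (P.κ • wordJ h fg)

/-- The symplectic blob algebra `b'_n(Π)`. -/
abbrev Blob (F : Type*) [Field F] (n : ℕ) (P : BlobParams F) : Type _ := RingQuot (Rel n P)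

/-- The generators of `b'_n(Π)`. -/
noncomputable def Blob.gen {F : Type*} [Field F] {n : ℕ} {P : BlobParams F} (x : Gen n) :
    Blob F n P :=
  RingQuot.mkAlgHom F (Rel n P) (fg x)

/-- The defining relations, for an arbitrary assignment of the generators. -/
structure Relations {F : Type*} [Field F] {n : ℕ} (P : BlobParams F) {A : Type*} [Ring A]
    [Algebra F A] (g : Gen n → A) : Prop where
  U_sq : ∀ i h, g (.U i h) * g (.U i h) = P.δ • g (.U i h)
  UUU : ∀ i j hi hj, (i = j + 1 ∨ j = i + 1) →
    g (.U i hi) * g (.U j hj) * g (.U i hi) = g (.U i hi)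
  UU : ∀ i j hi hj, ¬ (i = j + 1 ∨ j = i + 1) →
    g (.U i hi) * g (.U j hj) = g (.U j hj) * g (.U i hi)
  e_sq : ∀ h, g (.e h) * g (.e h) = P.δL • g (.e h)
  f_sq : ∀ h, g (.f h) * g (.f h) = P.δR • g (.f h)
  UeU : ∀ h h1, g (.U 1 h1) * g (.e h) * g (.U 1 h1) = P.κL • g (.U 1 h1)
  UfU : ∀ h h1, g (.U (n - 1) h1) * g (.f h) * g (.U (n - 1) h1) = P.κR • g (.U (n - 1) h1)
  eU : ∀ h i hi, i ≠ 1 → g (.e h) * g (.U i hi) = g (.U i hi) * g (.e h)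
  fU : ∀ h i hi, i ≠ n - 1 → g (.f h) * g (.U i hi) = g (.U i hi) * g (.f h)
  ef : ∀ h, 1 < n → g (.e h) * g (.f h) = g (.f h) * g (.e h)
  IJI : ∀ h, wordI g * wordJ h g * wordI g = P.κ • wordI g
  JIJ : ∀ h, wordJ h g * wordI g * wordJ h g = P.κ • wordJ h g

theorem map_uOf {n : ℕ} {A B : Type*} [Monoid A] [Monoid B] (φ : A →* B) (g : Gen n → A) (i : ℕ) :
    φ (uOf g i) = uOf (fun x => φ (g x)) i := by
  unfold uOf; split_ifs <;> simp

theorem map_wordI {n : ℕ} {A B : Type*} [Monoid A] [Monoid B] (φ : A →* B) (g : Gen n → A) :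
    φ (wordI g) = wordI (fun x => φ (g x)) := by
  unfold wordI
  rw [map_mul, map_list_prod, List.map_map]
  congr 1
  · congr 1; apply List.map_congr_left; intro k _; exact map_uOf φ g _
  · split_ifs <;> simp

theorem map_wordJ {n : ℕ} {A B : Type*} [Monoid A] [Monoid B] (h : 1 ≤ n) (φ : A →* B)
    (g : Gen n → A) : φ (wordJ h g) = wordJ h (fun x => φ (g x)) := by
  unfold wordJ
  rw [map_mul, map_mul, map_list_prod, List.map_map]
  congr 1
  · congr 2; apply List.map_congr_left; intro k _; exact map_uOf φ g _
  · split_ifs <;> simp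

/-- An assignment of the generators that satisfies the relations extends to `b'_n(Π)`. -/
noncomputable def Blob.lift {F : Type*} [Field F] {n : ℕ} {P : BlobParams F} {A : Type*} [Ring A]
    [Algebra F A] (g : Gen n → A) (hg : Relations P g) : Blob F n P →ₐ[F] A :=
  RingQuot.liftAlgHom F ⟨FreeAlgebra.lift F g, by
    have hl : ∀ x, FreeAlgebra.lift F g (fg x) = g x := fun x => FreeAlgebra.lift_ι_apply g x
    have hI : FreeAlgebra.lift F g (wordI fg) = wordI g := by
      have := map_wordI (FreeAlgebra.lift F g : FreeAlgebra F (Gen n) →* A) fg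
      simpa [hl] using this
    have hJ : ∀ h, FreeAlgebra.lift F g (wordJ h fg) = wordJ h g := by
      intro h
      have := map_wordJ h (FreeAlgebra.lift F g : FreeAlgebra F (Gen n) →* A) fg
      simpa [hl] using this
    intro x y hxy
    cases hxy <;> simp only [map_mul, map_smul, hl, hI, hJ]
    · exact hg.U_sq _ _
    · exact hg.UUU _ _ _ _ ‹_›
    · exact hg.UU _ _ _ _ ‹_›
    · exact hg.e_sq _
    · exact hg.f_sq _
    · exact hg.UeU _ _
    · exact hg.UfU _ _
    · exact hg.eU _ _ _ ‹_›
    · exact hg.fU _ _ _ ‹_›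
    · exact hg.ef _ ‹_›
    · exact hg.IJI _
    · exact hg.JIJ _⟩

theorem Blob.lift_gen {F : Type*} [Field F] {n : ℕ} {P : BlobParams F} {A : Type*} [Ring A]
    [Algebra F A] (g : Gen n → A) (hg : Relations P g) (x : Gen n) :
    Blob.lift g hg (Blob.gen x) = g x := by
  simp [Blob.lift, Blob.gen, fg]

theorem Blob.relations {F : Type*} [Field F] {n : ℕ} (P : BlobParams F) :
    Relations P (Blob.gen (F := F) (n := n) (P := P)) := by
  have key : ∀ {x y}, Rel n P x y → RingQuot.mkAlgHom F (Rel n P) x = RingQuot.mkAlgHom F _ y :=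
    fun h => RingQuot.mkAlgHom_rel F h
  have hI : RingQuot.mkAlgHom F (Rel n P) (wordI fg) = wordI Blob.gen :=
    map_wordI (RingQuot.mkAlgHom F (Rel n P) : FreeAlgebra F (Gen n) →* Blob F n P) fg
  have hJ : ∀ h, RingQuot.mkAlgHom F (Rel n P) (wordJ h fg) = wordJ h Blob.gen := fun h =>
    map_wordJ h (RingQuot.mkAlgHom F (Rel n P) : FreeAlgebra F (Gen n) →* Blob F n P) fg
  constructor
  · intro i h; have := key (.U_sq i h); simp only [map_mul, map_smul] at this; exact this
  · intro i j h h1 h2; have := key (.UUU i j h h1 h2); simp only [map_mul] at this; exact this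
  · intro i j h h1 h2; have := key (.UU i j h h1 h2); simp only [map_mul] at this; exact this
  · intro h; have := key (.e_sq h); simp only [map_mul, map_smul] at this; exact this
  · intro h; have := key (.f_sq h); simp only [map_mul, map_smul] at this; exact this
  · intro h h1; have := key (.UeU h h1); simp only [map_mul, map_smul] at this; exact this
  · intro h h1; have := key (.UfU h h1); simp only [map_mul, map_smul] at this; exact this
  · intro h i h1 h2; have := key (.eU h i h1 h2); simp only [map_mul] at this; exact this
  · intro h i h1 h2; have := key (.fU h i h1 h2); simp only [map_mul] at this; exact this
  · intro h h1; have := key (.ef h h1); simp only [map_mul] at this; exact this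
  · intro h; have := key (.IJI h); rw [map_mul, map_mul, map_smul, hI, hJ] at this; exact this
  · intro h; have := key (.JIJ h); rw [map_mul, map_mul, map_smul, hI, hJ] at this; exact this

/-- A corner ring `p A p` of an `F`-algebra is an `F`-algebra. -/
noncomputable instance {F A : Type*} [Field F] [Ring A] [Algebra F A] {p : A}
    (hp : IsIdempotentElem p) : Algebra F hp.Corner where
  smul c x := ⟨c • x.1, c • x.1, by
    have := (Subsemigroup.mem_corner_iff hp).1 x.2
    simp [this.1, this.2]⟩
  algebraMap :=
    { toFun := fun c => ⟨c • p, c • p, by simp [hp.eq]⟩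
      map_one' := Subtype.ext (one_smul F p)
      map_mul' := fun a b => Subtype.ext (by
        change (a * b) • p = (a • p) * (b • p)
        rw [smul_mul_smul_comm, hp.eq])
      map_zero' := Subtype.ext (zero_smul F p)
      map_add' := fun a b => Subtype.ext (add_smul a b p) }
  commutes' c x := Subtype.ext (by
    have := (Subsemigroup.mem_corner_iff hp).1 x.2
    change (c • p) * x.1 = x.1 * (c • p)
    simp [this.1, this.2])
  smul_def' c x := Subtype.ext (by
    have := (Subsemigroup.mem_corner_iff hp).1 x.2
    change c • x.1 = (c • p) * x.1
    simp [this.1])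

/-- The element `p a p` of the corner ring. -/
def toCorner {A : Type*} [Ring A] {p : A} (hp : IsIdempotentElem p) (a : A) : hp.Corner :=
  ⟨p * a * p, a, rfl⟩

/-- The additive group `p M` of an `A`-module `M`. -/
def cut {A : Type*} [Ring A] (p : A) (M : Type*) [AddCommGroup M] [Module A M] : AddSubgroup M :=
  (DistribSMul.toAddMonoidHom M p).range

theorem smul_of_mem_cut {A : Type*} [Ring A] {p : A} (hp : IsIdempotentElem p) {M : Type*}
    [AddCommGroup M] [Module A M] {m : M} (hm : m ∈ cut p M) : p • m = m := by
  obtain ⟨m, rfl⟩ := hm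
  change p • p • m = p • m
  rw [smul_smul, hp.eq]

/-- `p M` is a module over the corner ring `p A p`, which acts by restriction. -/
instance {A : Type*} [Ring A] {p : A} (hp : IsIdempotentElem p) (M : Type*)
    [AddCommGroup M] [Module A M] : Module hp.Corner (cut p M) where
  smul c m := ⟨c.1 • m.1, c.1 • m.1, by
    change p • c.1 • m.1 = c.1 • m.1
    rw [smul_smul, ((Subsemigroup.mem_corner_iff hp).1 c.2).1]⟩
  one_smul m := Subtype.ext (smul_of_mem_cut hp m.2)
  mul_smul a b m := Subtype.ext (mul_smul a.1 b.1 m.1)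
  smul_zero a := Subtype.ext (smul_zero a.1)
  smul_add a m m' := Subtype.ext (smul_add a.1 m.1 m'.1)
  add_smul a b m := Subtype.ext (add_smul a.1 b.1 m.1)
  zero_smul m := Subtype.ext (zero_smul _ m.1)


/-- The idempotent `ē = e / δ_L`. -/
noncomputable def eBar {F : Type*} [Field F] {n : ℕ} (P : BlobParams F) : Blob F (n + 1) P :=
  P.δL⁻¹ • Blob.gen (.e n.succ_pos)

/-- The idempotent `f̄ = f / δ_R`. -/
noncomputable def fBar {F : Type*} [Field F] {n : ℕ} (P : BlobParams F) : Blob F (n + 1) P :=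
  P.δR⁻¹ • Blob.gen (.f n.succ_pos)

theorem bar_idem {F A : Type*} [Field F] [Ring A] [Algebra F A] {c : F} (hc : c ≠ 0) {x : A}
    (hx : x * x = c • x) : IsIdempotentElem (c⁻¹ • x) := by
  unfold IsIdempotentElem
  rw [smul_mul_smul_comm, hx, smul_smul, mul_assoc, inv_mul_cancel₀ hc, mul_one]

theorem eBar_idem {F : Type*} [Field F] {n : ℕ} {P : BlobParams F} (h : P.δL ≠ 0) :
    IsIdempotentElem (eBar (n := n) P) :=
  bar_idem h ((Blob.relations P).e_sq _)

theorem fBar_idem {F : Type*} [Field F] {n : ℕ} {P : BlobParams F} (h : P.δR ≠ 0) :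
    IsIdempotentElem (fBar (n := n) P) :=
  bar_idem h ((Blob.relations P).f_sq _)

/-- The images in `ē b'_{n+1} ē` of the generators of `b'_n(Π_L)`: `e ↦ e U_1 e / δ_L`
(which is `ē (δ_L U_1) ē`), `f ↦ ē f ē`, `U_i ↦ ē U_{i+1} ē`. -/
noncomputable def genL {F : Type*} [Field F] {n : ℕ} {P : BlobParams F} (h : P.δL ≠ 0) :
    Gen n → (eBar_idem (n := n) h).Corner
  | .e hn => toCorner _ (P.δL • Blob.gen (.U 1 ⟨le_rfl, Nat.lt_succ_of_le hn⟩))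
  | .f _ => toCorner _ (Blob.gen (.f n.succ_pos))
  | .U i hi => toCorner _ (Blob.gen (.U (i + 1) ⟨Nat.le_add_left 1 i, Nat.succ_lt_succ hi.2⟩))

/-- The images in `f̄ b'_{n+1} f̄` of the generators of `b'_n(Π_R)`: `e ↦ f̄ e f̄`,
`f ↦ f U_n f / δ_R` (which is `f̄ (δ_R U_n) f̄`), `U_i ↦ f̄ U_i f̄`. -/
noncomputable def genR {F : Type*} [Field F] {n : ℕ} {P : BlobParams F} (h : P.δR ≠ 0) :
    Gen n → (fBar_idem (n := n) h).Corner
  | .e _ => toCorner _ (Blob.gen (.e n.succ_pos))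
  | .f hn => toCorner _ (P.δR • Blob.gen (.U n ⟨hn, n.lt_succ_self⟩))
  | .U i hi => toCorner _ (Blob.gen (.U i ⟨hi.1, Nat.lt_succ_of_lt hi.2⟩))

section corner

theorem corner_val_mul {A : Type*} [Ring A] {p : A} {hp : IsIdempotentElem p} (x y : hp.Corner) :
    (x * y).1 = x.1 * y.1 := rfl

theorem corner_val_smul {F A : Type*} [Field F] [Ring A] [Algebra F A] {p : A}
    {hp : IsIdempotentElem p} (c : F) (x : hp.Corner) : (c • x).1 = c • x.1 := rfl

theorem corner_val_one {A : Type*} [Ring A] {p : A} {hp : IsIdempotentElem p} :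
    (1 : hp.Corner).1 = p := rfl

theorem toCorner_val {A : Type*} [Ring A] {p : A} (hp : IsIdempotentElem p) (a : A) :
    (toCorner hp a).1 = p * a * p := rfl

theorem toCorner_val_comm {A : Type*} [Ring A] {p : A} (hp : IsIdempotentElem p) {a : A}
    (h : Commute p a) : (toCorner hp a).1 = a * p := by
  rw [toCorner_val, h.eq, mul_assoc, hp.eq]

theorem corner_list {A : Type*} [Ring A] {p : A} {hp : IsIdempotentElem p} {l : List ℕ}
    (c : ℕ → hp.Corner) (u : ℕ → A) (hcomm : ∀ i ∈ l, Commute p (u i))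
    (h : ∀ i ∈ l, (c i).1 = u i * p) : ((l.map c).prod).1 = (l.map u).prod * p := by
  induction l with
  | nil => simp [corner_val_one]
  | cons i l ih =>
    rw [List.map_cons, List.map_cons, List.prod_cons, List.prod_cons, corner_val_mul,
      ih (fun j hj => hcomm j (List.mem_cons_of_mem _ hj))
        (fun j hj => h j (List.mem_cons_of_mem _ hj)), h i List.mem_cons_self]
    have hl : Commute p ((l.map u).prod) := by
      apply Commute.list_prod_right
      intro x hx
      obtain ⟨j, hj, rfl⟩ := List.mem_map.1 hx
      exact hcomm j (List.mem_cons_of_mem _ hj)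
    rw [mul_assoc, ← mul_assoc p, hl.eq, mul_assoc, hp.eq, mul_assoc]

theorem commute_list {A : Type*} [Monoid A] {p : A} {l : List ℕ} (u : ℕ → A)
    (hcomm : ∀ i ∈ l, Commute p (u i)) : Commute p ((l.map u).prod) := by
  apply Commute.list_prod_right
  intro x hx
  obtain ⟨j, hj, rfl⟩ := List.mem_map.1 hx
  exact hcomm j hj

/-- The two long words of the corner satisfy the long relations. -/
theorem corner_long {F A : Type*} [Field F] [Ring A] [Algebra F A] {c k : F} (hc : c ≠ 0)
    {s X Y : A} (hsY : s * Y = c • Y) (hYs : Y * s = c • Y)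
    (hXYX : X * Y * X = k • X) (hYXY : Y * X * Y = k • Y) :
    (c⁻¹ • (s * X * s)) * (c⁻¹ • Y) * (c⁻¹ • (s * X * s)) = k • c⁻¹ • (s * X * s) ∧
    (c⁻¹ • Y) * (c⁻¹ • (s * X * s)) * (c⁻¹ • Y) = k • c⁻¹ • Y := by
  constructor
  · have h1 : s * X * s * Y * (s * X * s) = (c * c * k) • (s * X * s) := by
      calc s * X * s * Y * (s * X * s) = s * X * (s * Y * s) * X * s := by noncomm_ring
        _ = (c * c) • (s * (X * Y * X) * s) := by
            rw [hsY, smul_mul_assoc, hYs]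
            simp only [smul_mul_assoc, mul_smul_comm, smul_smul, mul_assoc]
        _ = _ := by
            rw [hXYX]
            simp only [smul_mul_assoc, mul_smul_comm, smul_smul]
    simp only [smul_mul_assoc, mul_smul_comm, smul_smul, h1]
    congr 1; field_simp
  · have h1 : Y * (s * X * s) * Y = (c * c * k) • Y := by
      calc Y * (s * X * s) * Y = (Y * s) * X * (s * Y) := by noncomm_ring
        _ = (c * c) • (Y * X * Y) := by
            rw [hsY, hYs]
            simp only [smul_mul_assoc, mul_smul_comm, smul_smul, mul_assoc]
        _ = _ := by rw [hYXY, smul_smul]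
    simp only [smul_mul_assoc, mul_smul_comm, smul_smul, h1]
    congr 1; field_simp

end corner


theorem comm_mul {A : Type*} [Ring A] {p : A} (hp : IsIdempotentElem p) {a b : A}
    (hb : Commute p b) : (a * p) * (b * p) = a * b * p := by
  rw [mul_assoc, ← mul_assoc p, hb.eq, mul_assoc, hp.eq, mul_assoc]

theorem genL_relations {F : Type*} [Field F] {n : ℕ} {P : BlobParams F} (h : P.δL ≠ 0) :
    Relations P.left (genL (n := n) h) := by
  have R := Blob.relations (F := F) (n := n + 1) P
  have hp := eBar_idem (n := n) h
  set g := Blob.gen (F := F) (n := n + 1) (P := P) with hg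
  set s := g (.e n.succ_pos) with hs
  have hss : s * s = P.δL • s := R.e_sq _
  have hpdef : eBar P = P.δL⁻¹ • s := rfl
  set p := eBar (n := n) P with hpd
  have hsp : s = P.δL • p := by rw [hpdef, smul_smul, mul_inv_cancel₀ h, one_smul]
  have hcU : ∀ i hi, i ≠ 1 → Commute p (g (.U i hi)) := fun i hi h1 =>
    Commute.smul_left (R.eU _ i hi h1) _
  have hcf : 1 ≤ n → Commute p (g (.f n.succ_pos)) := fun h1 =>
    Commute.smul_left (R.ef _ (by omega)) _
  have vU : ∀ i hi, (genL h (.U i hi)).1 = g (.U (i + 1) ⟨Nat.le_add_left 1 i,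
      Nat.succ_lt_succ hi.2⟩) * p := fun i hi => toCorner_val_comm hp (hcU _ _ (by omega))
  have vf : ∀ hn, (genL (n := n) h (.f hn)).1 = g (.f n.succ_pos) * p := fun hn =>
    toCorner_val_comm hp (hcf hn)
  have ve : ∀ hn : 1 ≤ n, (genL h (.e hn)).1 =
      P.δL • (p * g (.U 1 ⟨le_rfl, Nat.lt_succ_of_le hn⟩) * p) := fun hn => by
    change p * (P.δL • _) * p = _
    rw [mul_smul_comm, smul_mul_assoc]
  have ve' : ∀ hn : 1 ≤ n, (genL h (.e hn)).1 =
      P.δL⁻¹ • (s * g (.U 1 ⟨le_rfl, Nat.lt_succ_of_le hn⟩) * s) := fun hn => by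
    rw [ve, hsp]
    simp only [mul_smul_comm, smul_mul_assoc, smul_smul]
    congr 1; field_simp
  have long : ∀ hn : 1 ≤ n, (wordI (genL (n := n) h)).1 = P.δL⁻¹ • wordJ n.succ_pos g ∧
      (wordJ hn (genL (n := n) h)).1 = P.δL⁻¹ • (s * wordI g * s) ∧
      s * wordJ n.succ_pos g = P.δL • wordJ n.succ_pos g ∧
      wordJ n.succ_pos g * s = P.δL • wordJ n.succ_pos g := by
    intro hn
    have hcu : ∀ i, i ≠ 1 → Commute p (uOf g i) := by
      intro i hi; unfold uOf; split_ifs with h1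
      · exact hcU _ _ hi
      · exact Commute.one_right _
    have huv : ∀ i, 1 ≤ i ∧ i < n → (uOf (genL (n := n) h) i).1 = uOf g (i + 1) * p := by
      intro i hi
      rw [uOf, uOf, dif_pos hi, dif_pos (by omega), vU]
    have hcf2 : ∀ {q : Prop} [Decidable q], Commute p (if q then g (.f n.succ_pos) else 1) := by
      intro q _; split_ifs
      · exact hcf hn
      · exact Commute.one_right _
    have tI : (if h' : Odd n then genL (n := n) h (.f h'.pos) else 1).1 =
        (if Odd n then g (.f n.succ_pos) else 1) * p := by
      split_ifs with h'
      · exact vf _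
      · rw [one_mul]; rfl
    have tJ : (if Even n then genL (n := n) h (.f hn) else 1).1 =
        (if Even n then g (.f n.succ_pos) else 1) * p := by
      split_ifs with h'
      · exact vf _
      · rw [one_mul]; rfl
    set L2 := ((List.range (n / 2)).map fun k => uOf g (2 * k + 2)).prod with hL2
    set L3 := ((List.range ((n - 1) / 2)).map fun k => uOf g (2 * k + 3)).prod with hL3
    have cL2 : Commute p L2 := commute_list _ fun k _ => hcu _ (by omega)
    have hJ : wordJ n.succ_pos g = s * L2 * (if Odd n then g (.f n.succ_pos) else 1) := by
      unfold wordJ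
      congr 1
      simp [Nat.even_add_one]
    have hI : wordI g = g (.U 1 ⟨le_rfl, Nat.lt_succ_of_le hn⟩) * L3 *
        (if Even n then g (.f n.succ_pos) else 1) := by
      unfold wordI
      have e1 : (n + 1) / 2 = (n - 1) / 2 + 1 := by omega
      rw [e1, List.range_succ_eq_map, List.map_cons, List.prod_cons, List.map_map]
      congr 1
      · congr 1
        rw [uOf, dif_pos (by omega)]
      · simp only [Nat.odd_add_one, Nat.not_odd_iff_even]
        split_ifs <;> rfl
    have scomm : ∀ {a : Blob F (n + 1) P}, Commute p a → Commute s a := fun ha => by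
      rw [hsp]; exact ha.smul_left _
    refine ⟨?_, ?_, ?_, ?_⟩
    · rw [hJ, wordI, corner_val_mul, tI, corner_list _ (fun k => uOf g (2 * k + 2))
        (fun k _ => hcu _ (by omega))
        (fun k hk => huv _ (by have := List.mem_range.1 hk; omega)), comm_mul hp hcf2,
        ← (cL2.mul_right hcf2).eq, hpdef, smul_mul_assoc, mul_assoc]
    · rw [wordJ, corner_val_mul, corner_val_mul, tJ, ve', corner_list _ (fun k => uOf g (2 * k + 3))
        (fun k _ => hcu _ (by omega))
        (fun k hk => huv _ (by have := List.mem_range.1 hk; omega)), hI, mul_assoc,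
        comm_mul hp hcf2, smul_mul_assoc]
      have cL3 : Commute p L3 := commute_list _ fun k _ => hcu _ (by omega)
      have hs1 : s * p = s := by rw [hsp, smul_mul_assoc, hp.eq]
      rw [← (cL3.mul_right hcf2).eq]
      congr 1
      calc _ = s * g (.U 1 ⟨le_rfl, Nat.lt_succ_of_le hn⟩) * (s * p) *
            (L3 * (if Even n then g (.f n.succ_pos) else 1)) := by noncomm_ring
        _ = s * g (.U 1 ⟨le_rfl, Nat.lt_succ_of_le hn⟩) *
            (s * (L3 * (if Even n then g (.f n.succ_pos) else 1))) := by
            rw [hs1]; noncomm_ring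
        _ = _ := by rw [(scomm (cL3.mul_right hcf2)).eq]; noncomm_ring
    · rw [hJ, ← mul_assoc, ← mul_assoc, hss]; simp only [smul_mul_assoc]
    · rw [hJ, mul_assoc, mul_assoc, ← (mul_assoc L2), ← (scomm (cL2.mul_right hcf2)).eq, ← mul_assoc,
        hss, smul_mul_assoc, mul_assoc]
  constructor
  · intro i hi
    apply Subtype.ext
    rw [corner_val_mul, corner_val_smul, vU, comm_mul hp (hcU _ _ (by omega)), R.U_sq,
      smul_mul_assoc]; rfl
  · intro i j hi hj hij
    apply Subtype.ext
    rw [corner_val_mul, corner_val_mul, vU, vU, comm_mul hp (hcU _ _ (by omega)),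
      comm_mul hp (hcU _ _ (by omega)), R.UUU _ _ _ _ (by omega)]
  · intro i j hi hj hij
    apply Subtype.ext
    rw [corner_val_mul, corner_val_mul, vU, vU, comm_mul hp (hcU _ _ (by omega)),
      comm_mul hp (hcU _ _ (by omega)), R.UU _ _ _ _ (by omega)]
  · intro hn
    apply Subtype.ext
    rw [corner_val_mul, corner_val_smul, ve']
    have := R.UeU n.succ_pos ⟨le_rfl, Nat.lt_succ_of_le hn⟩
    set u := g (.U 1 ⟨le_rfl, Nat.lt_succ_of_le hn⟩)
    have h1 : s * u * s * (s * u * s) = (P.δL * P.κL) • (s * u * s) := by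
      calc s * u * s * (s * u * s) = s * u * (s * s) * u * s := by noncomm_ring
        _ = P.δL • (s * (u * s * u) * s) := by
          rw [hss]; simp only [mul_smul_comm, smul_mul_assoc, mul_assoc]
        _ = _ := by rw [this]; simp only [mul_smul_comm, smul_mul_assoc, smul_smul]
    simp only [mul_smul_comm, smul_mul_assoc, smul_smul, h1, BlobParams.left]
    congr 1; field_simp
  · intro hn
    apply Subtype.ext
    rw [corner_val_mul, corner_val_smul, vf, comm_mul hp (hcf hn), R.f_sq, smul_mul_assoc]; rfl
  · intro hn h1
    apply Subtype.ext
    rw [corner_val_mul, corner_val_mul, corner_val_smul, vU, ve]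
    have c2 := hcU (1 + 1) ⟨Nat.le_add_left 1 1, Nat.succ_lt_succ h1.2⟩ (by omega)
    have := R.UUU 2 1 ⟨by omega, by omega⟩ ⟨le_rfl, Nat.lt_succ_of_le hn⟩ (by omega)
    change Commute p (g (.U 2 _)) at c2
    set u := g (.U 1 ⟨le_rfl, Nat.lt_succ_of_le hn⟩)
    set v := g (.U 2 ⟨by omega, by omega⟩)
    change v * p * (P.δL • (p * u * p)) * (v * p) = P.δL • (v * p)
    rw [mul_smul_comm, smul_mul_assoc]
    congr 1
    calc v * p * (p * u * p) * (v * p) = v * (p * p) * u * (p * v) * p := by noncomm_ring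
      _ = (v * p) * u * (v * p) * p := by rw [hp.eq, c2.eq]
      _ = (p * v) * u * (v * (p * p)) := by rw [c2.eq]; noncomm_ring
      _ = p * (v * u * v) * p := by rw [hp.eq]; noncomm_ring
      _ = v * p := by rw [this, c2.eq, mul_assoc, hp.eq]
  · intro hn h1
    apply Subtype.ext
    rw [corner_val_mul, corner_val_mul, corner_val_smul, vU, vf, comm_mul hp (hcf hn),
      comm_mul hp (hcU _ _ (by omega))]
    have := R.UfU n.succ_pos ⟨by omega, by omega⟩
    have e1 : n - 1 + 1 = n + 1 - 1 := by omega
    simp only [e1]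
    rw [this, smul_mul_assoc]; rfl
  · intro hn i hi h1
    apply Subtype.ext
    rw [corner_val_mul, corner_val_mul, vU, ve]
    have := R.UU (i + 1) 1 ⟨by omega, by omega⟩ ⟨le_rfl, Nat.lt_succ_of_le hn⟩ (by omega)
    have c2 := hcU (i + 1) ⟨by omega, by omega⟩ (by omega)
    rw [mul_smul_comm, smul_mul_assoc]
    congr 1
    set u := g (.U 1 ⟨le_rfl, Nat.lt_succ_of_le hn⟩)
    set v := g (.U (i + 1) ⟨by omega, by omega⟩)
    calc p * u * p * (v * p) = p * u * (p * v) * p := by noncomm_ring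
      _ = p * (u * v) * (p * p) := by rw [c2.eq]; noncomm_ring
      _ = p * v * u * p := by rw [← this, hp.eq]; noncomm_ring
      _ = v * (p * p) * u * p := by rw [hp.eq, c2.eq]
      _ = _ := by noncomm_ring
  · intro hn i hi h1
    apply Subtype.ext
    rw [corner_val_mul, corner_val_mul, vU, vf, comm_mul hp (hcf hn),
      comm_mul hp (hcU _ _ (by omega)), R.fU _ _ _ (by omega)]
  · intro hn h1
    apply Subtype.ext
    rw [corner_val_mul, corner_val_mul, vf, ve]
    have := R.fU n.succ_pos 1 ⟨le_rfl, Nat.lt_succ_of_le hn⟩ (by omega)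
    have c2 := hcf hn
    rw [mul_smul_comm, smul_mul_assoc]
    congr 1
    set u := g (.U 1 ⟨le_rfl, Nat.lt_succ_of_le hn⟩)
    set v := g (.f n.succ_pos)
    calc p * u * p * (v * p) = p * u * (p * v) * p := by noncomm_ring
      _ = p * (u * v) * (p * p) := by rw [c2.eq]; noncomm_ring
      _ = p * v * u * p := by rw [← this, hp.eq]; noncomm_ring
      _ = v * (p * p) * u * p := by rw [hp.eq, c2.eq]
      _ = _ := by noncomm_ring
  · intro hn
    apply Subtype.ext
    obtain ⟨h1, h2, h3, h4⟩ := long hn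
    rw [corner_val_mul, corner_val_mul, corner_val_smul, h1, h2]
    exact (corner_long h h3 h4 (R.IJI _) (R.JIJ _)).2
  · intro hn
    apply Subtype.ext
    obtain ⟨h1, h2, h3, h4⟩ := long hn
    rw [corner_val_mul, corner_val_mul, corner_val_smul, h1, h2]
    exact (corner_long h h3 h4 (R.IJI _) (R.JIJ _)).1


theorem genR_relations {F : Type*} [Field F] {n : ℕ} {P : BlobParams F} (h : P.δR ≠ 0) :
    Relations P.right (genR (n := n) h) := by
  have R := Blob.relations (F := F) (n := n + 1) P
  have hp := fBar_idem (n := n) h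
  set g := Blob.gen (F := F) (n := n + 1) (P := P) with hg
  set s := g (.f n.succ_pos) with hs
  have hss : s * s = P.δR • s := R.f_sq _
  have hpdef : fBar P = P.δR⁻¹ • s := rfl
  set p := fBar (n := n) P with hpd
  have hsp : s = P.δR • p := by rw [hpdef, smul_smul, mul_inv_cancel₀ h, one_smul]
  have hcU : ∀ i hi, i ≠ n → Commute p (g (.U i hi)) := fun i hi h1 =>
    Commute.smul_left (R.fU _ i hi (by omega)) _
  have hce : 1 ≤ n → Commute p (g (.e n.succ_pos)) := fun h1 =>
    Commute.smul_left (R.ef _ (by omega)).symm _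
  have vU : ∀ i hi, (genR h (.U i hi)).1 = g (.U i ⟨hi.1, Nat.lt_succ_of_lt hi.2⟩) * p :=
    fun i hi => toCorner_val_comm hp (hcU _ _ (by omega))
  have ve : ∀ hn, (genR (n := n) h (.e hn)).1 = g (.e n.succ_pos) * p := fun hn =>
    toCorner_val_comm hp (hce hn)
  have vf : ∀ hn : 1 ≤ n, (genR h (.f hn)).1 =
      P.δR • (p * g (.U n ⟨hn, n.lt_succ_self⟩) * p) := fun hn => by
    change p * (P.δR • _) * p = _
    rw [mul_smul_comm, smul_mul_assoc]
  have vf' : ∀ hn : 1 ≤ n, (genR h (.f hn)).1 =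
      P.δR⁻¹ • (s * g (.U n ⟨hn, n.lt_succ_self⟩) * s) := fun hn => by
    rw [vf, hsp]
    simp only [mul_smul_comm, smul_mul_assoc, smul_smul]
    congr 1; field_simp
  have hcu : ∀ i, i ≠ n → Commute p (uOf g i) := by
    intro i hi; unfold uOf; split_ifs with h1
    · exact hcU _ _ hi
    · exact Commute.one_right _
  have huv : ∀ i, 1 ≤ i ∧ i < n → (uOf (genR (n := n) h) i).1 = uOf g i * p := by
    intro i hi
    rw [uOf, uOf, dif_pos hi, dif_pos (by omega), vU]
  have scomm : ∀ {a : Blob F (n + 1) P}, Commute p a → Commute s a := fun ha => by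
    rw [hsp]; exact ha.smul_left _
  have ps : p * s = s := by rw [hsp, mul_smul_comm, hp.eq]
  have aux : ∀ {a b : Blob F (n + 1) P}, Commute s a →
      s * (a * s) = P.δR • (a * s) ∧ a * s * s = P.δR • (a * s) := by
    intro a b ha
    constructor
    · rw [← mul_assoc, ha.eq, mul_assoc, hss, mul_smul_comm]
    · rw [mul_assoc, hss, mul_smul_comm]
  have long : ∀ hn : 1 ≤ n, Odd n → (wordJ hn (genR (n := n) h)).1 = P.δR⁻¹ • wordJ n.succ_pos g ∧
      (wordI (genR (n := n) h)).1 = P.δR⁻¹ • (s * wordI g * s) ∧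
      s * wordJ n.succ_pos g = P.δR • wordJ n.succ_pos g ∧
      wordJ n.succ_pos g * s = P.δR • wordJ n.succ_pos g := by
    intro hn hodd
    have hev : ¬ Even n := by simpa using hodd
    set L1 := ((List.range (n / 2)).map fun k => uOf g (2 * k + 1)).prod with hL1
    set L2 := ((List.range (n / 2)).map fun k => uOf g (2 * k + 2)).prod with hL2
    have e2 : (n - 1) / 2 = n / 2 := by obtain ⟨k, rfl⟩ := hodd; omega
    have e3 : 2 * (n / 2) + 1 = n := by obtain ⟨k, rfl⟩ := hodd; omega
    have cL1 : Commute p L1 := commute_list _ fun k hk => hcu _ (by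
      have := List.mem_range.1 hk; omega)
    have cL2 : Commute p L2 := commute_list _ fun k hk => hcu _ (by
      have := List.mem_range.1 hk; omega)
    have hJ : wordJ n.succ_pos g = g (.e n.succ_pos) * L2 * s := by
      rw [wordJ, if_pos (Nat.even_add_one.2 hev)]; rfl
    have hI : wordI g = L1 * g (.U n ⟨hn, n.lt_succ_self⟩) := by
      unfold wordI
      have e1 : (n + 1) / 2 = n / 2 + 1 := by obtain ⟨k, rfl⟩ := hodd; omega
      rw [e1, List.range_succ, List.map_append, List.prod_append, dif_neg, mul_one,
        List.map_singleton, List.prod_singleton, e3, uOf, dif_pos (by omega)]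
      simpa [Nat.odd_add_one] using hodd
    have hc := scomm ((hce hn).mul_right cL2)
    refine ⟨?_, ?_, ?_, ?_⟩
    · rw [hJ, wordJ, corner_val_mul, if_neg hev, corner_val_one, corner_val_mul, ve, e2,
        corner_list _ (fun k => uOf g (2 * k + 2))
        (fun k hk => hcu _ (by have := List.mem_range.1 hk; omega))
        (fun k hk => huv _ (by have := List.mem_range.1 hk; omega)), comm_mul hp cL2, mul_assoc,
        hp.eq, hpdef, mul_smul_comm]
    · rw [wordI, dif_pos hodd, corner_val_mul, vf', corner_list _ (fun k => uOf g (2 * k + 1))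
        (fun k hk => hcu _ (by have := List.mem_range.1 hk; omega))
        (fun k hk => huv _ (by have := List.mem_range.1 hk; omega)), hI, mul_smul_comm]
      congr 1
      calc _ = L1 * (p * s) * g (.U n ⟨hn, n.lt_succ_self⟩) * s := by noncomm_ring
        _ = _ := by rw [ps, ← (scomm cL1).eq]; noncomm_ring
    · rw [hJ]; exact (aux (b := 0) hc).1
    · rw [hJ]; exact (aux (b := 0) hc).2
  have long' : ∀ hn : 1 ≤ n, Even n → (wordI (genR (n := n) h)).1 = P.δR⁻¹ • wordI g ∧
      (wordJ hn (genR (n := n) h)).1 = P.δR⁻¹ • (s * wordJ n.succ_pos g * s) ∧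
      s * wordI g = P.δR • wordI g ∧ wordI g * s = P.δR • wordI g := by
    intro hn hev
    have hodd : ¬ Odd n := by simpa using hev
    set L1 := ((List.range (n / 2)).map fun k => uOf g (2 * k + 1)).prod with hL1
    set L2 := ((List.range ((n - 1) / 2)).map fun k => uOf g (2 * k + 2)).prod with hL2
    have e2 : (n + 1) / 2 = n / 2 := by obtain ⟨k, rfl⟩ := hev; omega
    have e3 : 2 * ((n - 1) / 2) + 2 = n := by obtain ⟨k, rfl⟩ := hev; omega
    have cL1 : Commute p L1 := commute_list _ fun k hk => hcu _ (by
      have := List.mem_range.1 hk; obtain ⟨k, rfl⟩ := hev; omega)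
    have cL2 : Commute p L2 := commute_list _ fun k hk => hcu _ (by
      have := List.mem_range.1 hk; omega)
    have hI : wordI g = L1 * s := by
      rw [wordI, dif_pos (Nat.odd_add_one.2 hodd), e2]
    have hJ : wordJ n.succ_pos g = g (.e n.succ_pos) * L2 * g (.U n ⟨hn, n.lt_succ_self⟩) := by
      unfold wordJ
      have e1 : (n + 1 - 1) / 2 = (n - 1) / 2 + 1 := by omega
      rw [e1, List.range_succ, List.map_append, List.prod_append, if_neg, mul_one,
        List.map_singleton, List.prod_singleton, e3, uOf, dif_pos (by omega), mul_assoc]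
      simpa [Nat.even_add_one] using hev
    have hc := scomm ((hce hn).mul_right cL2)
    refine ⟨?_, ?_, ?_, ?_⟩
    · rw [hI, wordI, corner_val_mul, dif_neg hodd, corner_val_one,
        corner_list _ (fun k => uOf g (2 * k + 1))
        (fun k hk => hcu _ (by have := List.mem_range.1 hk; obtain ⟨k, rfl⟩ := hev; omega))
        (fun k hk => huv _ (by have := List.mem_range.1 hk; obtain ⟨k, rfl⟩ := hev; omega)),
        mul_assoc, hp.eq, hpdef, mul_smul_comm]
    · rw [wordJ, if_pos hev, corner_val_mul, corner_val_mul, ve, vf',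
        corner_list _ (fun k => uOf g (2 * k + 2))
        (fun k hk => hcu _ (by have := List.mem_range.1 hk; omega))
        (fun k hk => huv _ (by have := List.mem_range.1 hk; omega)), comm_mul hp cL2, hJ,
        mul_smul_comm]
      congr 1
      calc _ = (g (.e n.succ_pos) * L2) * (p * s) * g (.U n ⟨hn, n.lt_succ_self⟩) * s := by
            noncomm_ring
        _ = _ := by rw [ps, ← hc.eq]; noncomm_ring
    · rw [hI]; exact (aux (b := 0) (scomm cL1)).1
    · rw [hI]; exact (aux (b := 0) (scomm cL1)).2
  constructor
  · intro i hi
    apply Subtype.ext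
    rw [corner_val_mul, corner_val_smul, vU, comm_mul hp (hcU _ _ (by omega)), R.U_sq,
      smul_mul_assoc]; rfl
  · intro i j hi hj hij
    apply Subtype.ext
    rw [corner_val_mul, corner_val_mul, vU, vU, comm_mul hp (hcU _ _ (by omega)),
      comm_mul hp (hcU _ _ (by omega)), R.UUU _ _ _ _ (by omega)]
  · intro i j hi hj hij
    apply Subtype.ext
    rw [corner_val_mul, corner_val_mul, vU, vU, comm_mul hp (hcU _ _ (by omega)),
      comm_mul hp (hcU _ _ (by omega)), R.UU _ _ _ _ (by omega)]
  · intro hn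
    apply Subtype.ext
    rw [corner_val_mul, corner_val_smul, ve, comm_mul hp (hce hn), R.e_sq, smul_mul_assoc]; rfl
  · intro hn
    apply Subtype.ext
    rw [corner_val_mul, corner_val_smul, vf']
    have := R.UfU n.succ_pos ⟨hn, n.lt_succ_self⟩
    change g (.U n _) * s * g (.U n _) = P.κR • g (.U n _) at this
    set u := g (.U n ⟨hn, n.lt_succ_self⟩)
    have h1 : s * u * s * (s * u * s) = (P.δR * P.κR) • (s * u * s) := by
      calc s * u * s * (s * u * s) = s * u * (s * s) * u * s := by noncomm_ring
        _ = P.δR • (s * (u * s * u) * s) := by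
          rw [hss]; simp only [mul_smul_comm, smul_mul_assoc, mul_assoc]
        _ = _ := by rw [this]; simp only [mul_smul_comm, smul_mul_assoc, smul_smul]
    simp only [mul_smul_comm, smul_mul_assoc, smul_smul, h1, BlobParams.right]
    congr 1; field_simp
  · intro hn h1
    apply Subtype.ext
    rw [corner_val_mul, corner_val_mul, corner_val_smul, vU, ve, comm_mul hp (hce hn),
      comm_mul hp (hcU _ _ (by omega)), R.UeU n.succ_pos ⟨by omega, by omega⟩, smul_mul_assoc]; rfl
  · intro hn h1
    apply Subtype.ext
    rw [corner_val_mul, corner_val_mul, corner_val_smul, vU, vf]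
    have c2 := hcU (n - 1) ⟨h1.1, Nat.lt_succ_of_lt h1.2⟩ (by omega)
    have := R.UUU (n - 1) n ⟨by omega, by omega⟩ ⟨hn, n.lt_succ_self⟩ (by omega)
    set u := g (.U n ⟨hn, n.lt_succ_self⟩)
    set v := g (.U (n - 1) ⟨by omega, by omega⟩)
    change v * p * (P.δR • (p * u * p)) * (v * p) = P.δR • (v * p)
    rw [mul_smul_comm, smul_mul_assoc]
    congr 1
    calc v * p * (p * u * p) * (v * p) = v * (p * p) * u * (p * v) * p := by noncomm_ring
      _ = (v * p) * u * (v * p) * p := by rw [hp.eq, c2.eq]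
      _ = (p * v) * u * (v * (p * p)) := by rw [c2.eq]; noncomm_ring
      _ = p * (v * u * v) * p := by rw [hp.eq]; noncomm_ring
      _ = v * p := by rw [this, c2.eq, mul_assoc, hp.eq]
  · intro hn i hi h1
    apply Subtype.ext
    rw [corner_val_mul, corner_val_mul, vU, ve, comm_mul hp (hce hn),
      comm_mul hp (hcU _ _ (by omega)), R.eU _ _ _ (by omega)]
  · intro hn i hi h1
    apply Subtype.ext
    rw [corner_val_mul, corner_val_mul, vU, vf]
    have := R.UU i n ⟨by omega, by omega⟩ ⟨hn, n.lt_succ_self⟩ (by omega)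
    have c2 := hcU i ⟨by omega, by omega⟩ (by omega)
    rw [mul_smul_comm, smul_mul_assoc]
    congr 1
    set u := g (.U n ⟨hn, n.lt_succ_self⟩)
    set v := g (.U i ⟨by omega, by omega⟩)
    calc p * u * p * (v * p) = p * u * (p * v) * p := by noncomm_ring
      _ = p * (u * v) * (p * p) := by rw [c2.eq]; noncomm_ring
      _ = p * v * u * p := by rw [← this, hp.eq]; noncomm_ring
      _ = v * (p * p) * u * p := by rw [hp.eq, c2.eq]
      _ = _ := by noncomm_ring
  · intro hn h1
    apply Subtype.ext
    rw [corner_val_mul, corner_val_mul, vf, ve]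
    have := R.eU n.succ_pos n ⟨hn, n.lt_succ_self⟩ (by omega)
    have c2 := hce hn
    rw [mul_smul_comm, smul_mul_assoc]
    congr 1
    set u := g (.U n ⟨hn, n.lt_succ_self⟩)
    set v := g (.e n.succ_pos)
    symm
    calc p * u * p * (v * p) = p * u * (p * v) * p := by noncomm_ring
      _ = p * (u * v) * (p * p) := by rw [c2.eq]; noncomm_ring
      _ = p * v * u * p := by rw [← this, hp.eq]; noncomm_ring
      _ = v * (p * p) * u * p := by rw [hp.eq, c2.eq]
      _ = _ := by noncomm_ring
  · intro hn
    apply Subtype.ext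
    rcases Nat.even_or_odd n with ho | ho
    · obtain ⟨h1, h2, h3, h4⟩ := long' hn ho
      rw [corner_val_mul, corner_val_mul, corner_val_smul, h1, h2]
      exact (corner_long h h3 h4 (R.JIJ _) (R.IJI _)).2
    · obtain ⟨h1, h2, h3, h4⟩ := long hn ho
      rw [corner_val_mul, corner_val_mul, corner_val_smul, h1, h2]
      exact (corner_long h h3 h4 (R.IJI _) (R.JIJ _)).1
  · intro hn
    apply Subtype.ext
    rcases Nat.even_or_odd n with ho | ho
    · obtain ⟨h1, h2, h3, h4⟩ := long' hn ho
      rw [corner_val_mul, corner_val_mul, corner_val_smul, h1, h2]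
      exact (corner_long h h3 h4 (R.JIJ _) (R.IJI _)).1
    · obtain ⟨h1, h2, h3, h4⟩ := long hn ho
      rw [corner_val_mul, corner_val_mul, corner_val_smul, h1, h2]
      exact (corner_long h h3 h4 (R.IJI _) (R.JIJ _)).2

/-- The homomorphism `b'_n(Π_L) → ē b'_{n+1}(Π) ē`, inverse to the standard identification of
`ē b'_{n+1}(Π) ē` with `b'_n(Π_L)`. -/
noncomputable def cornerL {F : Type*} [Field F] {n : ℕ} {P : BlobParams F} (h : P.δL ≠ 0) :
    Blob F n P.left →ₐ[F] (eBar_idem (n := n) h).Corner :=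
  Blob.lift (genL h) (genL_relations h)

/-- The homomorphism `b'_n(Π_R) → f̄ b'_{n+1}(Π) f̄`, inverse to the standard identification of
`f̄ b'_{n+1}(Π) f̄` with `b'_n(Π_R)`. -/
noncomputable def cornerR {F : Type*} [Field F] {n : ℕ} {P : BlobParams F} (h : P.δR ≠ 0) :
    Blob F n P.right →ₐ[F] (fBar_idem (n := n) h).Corner :=
  Blob.lift (genR h) (genR_relations h)

/-- The localisation `F_e M = ē M` of a `b'_{n+1}(Π)`-module `M`. -/
def LocE {F : Type*} [Field F] (n : ℕ) {P : BlobParams F} (_h : P.δL ≠ 0) (M : Type*)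
    [AddCommGroup M] [Module (Blob F (n + 1) P) M] : Type _ :=
  cut (eBar (n := n) P) M

/-- The localisation `F_f M = f̄ M` of a `b'_{n+1}(Π)`-module `M`. -/
def LocF {F : Type*} [Field F] (n : ℕ) {P : BlobParams F} (_h : P.δR ≠ 0) (M : Type*)
    [AddCommGroup M] [Module (Blob F (n + 1) P) M] : Type _ :=
  cut (fBar (n := n) P) M

noncomputable instance LocE.addCommGroup {F : Type*} [Field F] (n : ℕ) {P : BlobParams F} (h : P.δL ≠ 0)
    (M : Type*) [AddCommGroup M] [Module (Blob F (n + 1) P) M] : AddCommGroup (LocE n h M) :=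
  inferInstanceAs (AddCommGroup (cut (eBar (n := n) P) M))

noncomputable instance LocF.addCommGroup {F : Type*} [Field F] (n : ℕ) {P : BlobParams F} (h : P.δR ≠ 0)
    (M : Type*) [AddCommGroup M] [Module (Blob F (n + 1) P) M] : AddCommGroup (LocF n h M) :=
  inferInstanceAs (AddCommGroup (cut (fBar (n := n) P) M))

/-- `F_e M` is a `b'_n(Π_L)`-module. -/
noncomputable instance LocE.module {F : Type*} [Field F] (n : ℕ) {P : BlobParams F}
    (h : P.δL ≠ 0) (M : Type*) [AddCommGroup M] [Module (Blob F (n + 1) P) M] :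
    Module (Blob F n P.left) (LocE n h M) :=
  letI : Module (eBar_idem (n := n) h).Corner (LocE n h M) :=
    inferInstanceAs (Module (eBar_idem (n := n) h).Corner (cut (eBar (n := n) P) M))
  Module.compHom (LocE n h M) (cornerL h).toRingHom

/-- `F_f M` is a `b'_n(Π_R)`-module. -/
noncomputable instance LocF.module {F : Type*} [Field F] (n : ℕ) {P : BlobParams F}
    (h : P.δR ≠ 0) (M : Type*) [AddCommGroup M] [Module (Blob F (n + 1) P) M] :
    Module (Blob F n P.right) (LocF n h M) :=
  letI : Module (fBar_idem (n := n) h).Corner (LocF n h M) :=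
    inferInstanceAs (Module (fBar_idem (n := n) h).Corner (cut (fBar (n := n) P) M))
  Module.compHom (LocF n h M) (cornerR h).toRingHom

/-- An element of `F_e M`, seen in `M`. -/
def LocE.val {F : Type*} [Field F] {n : ℕ} {P : BlobParams F} {h : P.δL ≠ 0} {M : Type*}
    [AddCommGroup M] [Module (Blob F (n + 1) P) M] (m : LocE n h M) : M := Subtype.val m

/-- An element of `F_f M`, seen in `M`. -/
def LocF.val {F : Type*} [Field F] {n : ℕ} {P : BlobParams F} {h : P.δR ≠ 0} {M : Type*}
    [AddCommGroup M] [Module (Blob F (n + 1) P) M] (m : LocF n h M) : M := Subtype.val m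


/-- The positions `-2n+1, -2n+2, …, 2n` of the `4n` tensor factors. -/
abbrev Pos (n : ℕ) : Type := Finset.Icc (-2 * (n : ℤ) + 1) (2 * (n : ℤ))

/-- The cyclic successor of a position: `i ↦ i + 1` for `i < 2n`, and `2n ↦ -2n+1`. -/
def Pos.next {n : ℕ} (i : Pos n) : Pos n :=
  if h : i.1 = 2 * (n : ℤ) then
    ⟨-2 * (n : ℤ) + 1, Finset.mem_Icc.2 (by have := Finset.mem_Icc.1 i.2; omega)⟩
  else ⟨i.1 + 1, Finset.mem_Icc.2 (by have := Finset.mem_Icc.1 i.2; omega)⟩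

/-- The tensor space `V^{⊗4n}`, where `V` has basis `v_1, v_2` (indexed by `0, 1 : Fin 2`). -/
abbrev TensorSpace (F : Type*) [Field F] (n : ℕ) : Type _ := ⨂[F] _ : Pos n, (Fin 2 → F)

/-- The pure tensor of basis vectors that belongs to a word in the letters `1, 2`;
the letter `1` is written `0 : Fin 2`, the letter `2` is written `1 : Fin 2`. -/
noncomputable def word (F : Type*) [Field F] {n : ℕ} (α : Pos n → Fin 2) : TensorSpace F n :=
  PiTensorProduct.tprod F fun i => (Pi.single (α i) 1 : Fin 2 → F)

/-- The words form a basis. -/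
noncomputable def wordBasis (F : Type*) [Field F] (n : ℕ) :
    Module.Basis (Pos n → Fin 2) F (TensorSpace F n) :=
  Basis.piTensorProduct fun _ => Pi.basisFun F (Fin 2)

theorem wordBasis_apply {F : Type*} [Field F] {n : ℕ} (α : Pos n → Fin 2) :
    wordBasis F n α = word F α := by
  simp [wordBasis, word, Basis.piTensorProduct_apply]

/-- The word `α` with the letters at the positions `i` and `i + 1` (cyclically) replaced by
`s` and `t`. -/
def put {n : ℕ} (α : Pos n → Fin 2) (i : Pos n) (s t : Fin 2) : Pos n → Fin 2 :=
  Function.update (Function.update α i s) i.next t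

/-- The operator `R^q_i`. With the letters numbered `1, 2`, the exponents are `2 - α_i` and
`1 - α_i`. -/
noncomputable def R {F : Type*} [Field F] {n : ℕ} (q : Fˣ) (i : Pos n) :
    Module.End F (TensorSpace F n) :=
  (wordBasis F n).constr F fun α =>
    if α i = α i.next then 0
    else (q : F) ^ (1 - ((α i).val : ℤ)) • word F (put α i 0 1) +
      (q : F) ^ (-((α i).val : ℤ)) • word F (put α i 1 0)

/-- The eight parameters `(a, b, c, d, x, y, z, w)` of a tensor space module. -/
structure TensorParams (F : Type*) [Field F] where
  a : Fˣ
  b : Fˣ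
  c : Fˣ
  d : Fˣ
  x : Fˣ
  y : Fˣ
  z : Fˣ
  w : Fˣ

/-- `Σ_L = (a, b, c, d, ab/x, cd/y, z, w)`. -/
def TensorParams.left {F : Type*} [Field F] (S : TensorParams F) : TensorParams F :=
  ⟨S.a, S.b, S.c, S.d, S.a * S.b / S.x, S.c * S.d / S.y, S.z, S.w⟩

/-- `Σ_R = (a, b, c, d, x, y, bc/z, ad/w)`. -/
def TensorParams.right {F : Type*} [Field F] (S : TensorParams F) : TensorParams F :=
  ⟨S.a, S.b, S.c, S.d, S.x, S.y, S.b * S.c / S.z, S.a * S.d / S.w⟩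

/-- `[2]_q = q + 1/q`. -/
def two {F : Type*} [Field F] (q : Fˣ) : F := q + (q⁻¹ : Fˣ)

/-- The conditions on `Π` and `Σ` under which the tensor space is a `b'_n(Π)`-module. -/
structure Compatible {F : Type*} [Field F] (n : ℕ) (S : TensorParams F) (P : BlobParams F) :
    Prop where
  δ : P.δ = two S.a * two S.b * two S.c * two S.d
  δL : P.δL = two S.x * two S.y
  δR : P.δR = two S.z * two S.w
  κL : P.κL = two (S.a * S.b / S.x) * two (S.c * S.d / S.y)
  κR : P.κR = two (S.a * S.d / S.w) * two (S.b * S.c / S.z)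
  κ : P.κ = if Odd n then
      S.x * S.y / (S.z * S.w) + 2 + S.z * S.w / (S.x * S.y : F)
    else S.a * S.b * S.c * S.d / (S.x * S.y * S.z * S.w) + 2 +
      S.x * S.y * S.z * S.w / (S.a * S.b * S.c * S.d : F)

/-- The operators by which the generators act: `U_i ↦ R^a_{-n-i} R^b_{-n+i} R^c_{n-i} R^d_{n+i}`,
`e ↦ R^x_{-n} R^y_n`, `f ↦ R^z_0 R^w_{2n}`. -/
noncomputable def genOp {F : Type*} [Field F] {n : ℕ} (S : TensorParams F) :
    Gen n → Module.End F (TensorSpace F n)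
  | .e h => R S.x ⟨-n, Finset.mem_Icc.2 (by omega)⟩ * R S.y ⟨n, Finset.mem_Icc.2 (by omega)⟩
  | .f h => R S.z ⟨0, Finset.mem_Icc.2 (by omega)⟩ * R S.w ⟨2 * n, Finset.mem_Icc.2 (by omega)⟩
  | .U i h => R S.a ⟨-n - i, Finset.mem_Icc.2 (by omega)⟩ *
      R S.b ⟨-n + i, Finset.mem_Icc.2 (by omega)⟩ *
      R S.c ⟨n - i, Finset.mem_Icc.2 (by omega)⟩ * R S.d ⟨n + i, Finset.mem_Icc.2 (by omega)⟩

section operators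

/-- The entry of the covector `R` at the letters `s, t`. -/
def capc {F : Type*} [Field F] (q : Fˣ) (s t : Fin 2) : F :=
  if s = t then 0 else if s = 0 then 1 else (q⁻¹ : Fˣ)

/-- The entry of the vector `q·12 + 21` at the letters `s, t`. -/
def cupw {F : Type*} [Field F] (q : Fˣ) (s t : Fin 2) : F :=
  if s = t then 0 else if s = 0 then q else 1

/-- `R^q_i` in coordinates. -/
def r {F : Type*} [Field F] {n : ℕ} (q : Fˣ) (i : Pos n) : Module.End F ((Pos n → Fin 2) → F) where
  toFun ψ β := cupw q (β i) (β i.next) * (ψ (put β i 0 1) + (q⁻¹ : Fˣ) * ψ (put β i 1 0))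
  map_add' ψ φ := by ext β; simp; ring
  map_smul' c ψ := by ext β; simp; ring

theorem next_ne {n : ℕ} (i : Pos n) : i.next ≠ i := by
  have := Finset.mem_Icc.1 i.2
  intro h
  have h2 := congrArg Subtype.val h
  unfold Pos.next at h2
  split_ifs at h2 <;> simp at h2
  omega

theorem put_left {n : ℕ} (α : Pos n → Fin 2) (i : Pos n) (s t : Fin 2) : put α i s t i = s := by
  simp [put, (next_ne i).symm]

theorem put_right {n : ℕ} (α : Pos n → Fin 2) (i : Pos n) (s t : Fin 2) :
    put α i s t i.next = t := by
  simp [put]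

theorem put_other {n : ℕ} (α : Pos n → Fin 2) {i j : Pos n} (s t : Fin 2) (h : j ≠ i)
    (h' : j ≠ i.next) : put α i s t j = α j := by
  simp [put, h, h']

theorem put_put {n : ℕ} (α : Pos n → Fin 2) (i : Pos n) (s t s' t' : Fin 2) :
    put (put α i s t) i s' t' = put α i s' t' := by
  funext k
  by_cases h1 : k = i
  · subst h1; rw [put_left, put_left]
  · by_cases h2 : k = i.next
    · subst h2; rw [put_right, put_right]
    · rw [put_other _ _ _ h1 h2, put_other _ _ _ h1 h2, put_other _ _ _ h1 h2]

theorem put_self {n : ℕ} (α : Pos n → Fin 2) (i : Pos n) {s t : Fin 2} (h1 : α i = s)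
    (h2 : α i.next = t) : put α i s t = α := by
  subst h1 h2; simp [put]

theorem repr_R {F : Type*} [Field F] {n : ℕ} (q : Fˣ) (i : Pos n) (v : TensorSpace F n) :
    (wordBasis F n).equivFun (R q i v) = r q i ((wordBasis F n).equivFun v) := by
  suffices h : (wordBasis F n).equivFun.toLinearMap ∘ₗ R q i =
      r q i ∘ₗ (wordBasis F n).equivFun.toLinearMap from LinearMap.congr_fun h v
  refine (wordBasis F n).ext fun α => ?_
  ext β
  simp only [LinearMap.comp_apply, R, Module.Basis.constr_basis, LinearEquiv.coe_coe]
  simp only [r, LinearMap.coe_mk, AddHom.coe_mk, Module.Basis.equivFun_apply,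
    Module.Basis.repr_self]
  have key : ∀ γ : Pos n → Fin 2, (wordBasis F n).repr (word F γ) = Finsupp.single γ 1 := by
    intro γ; rw [← wordBasis_apply, Module.Basis.repr_self]
  have h2 : ∀ s : Fin 2, s = 0 ∨ s = 1 := by decide
  have e1 : ∀ s t s' t' , α i = s' → α i.next = t' →
      (put α i s t = β ↔ (put β i s' t' = α ∧ β i = s ∧ β i.next = t)) := by
    intro s t s' t' ha hb
    constructor
    · rintro rfl; rw [put_put, put_left, put_right]; exact ⟨put_self _ _ ha hb, rfl, rfl⟩
    · rintro ⟨hα, h1, h2⟩; rw [← hα, put_put]; exact put_self _ _ h1 h2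
  have e2 : ∀ s t, α = put β i s t → α i = s ∧ α i.next = t := by
    rintro s t rfl; exact ⟨put_left _ _ _ _, put_right _ _ _ _⟩
  have n01 : ∀ s t, (α i ≠ s ∨ α i.next ≠ t) → α ≠ put β i s t := by
    intro s t h hh; obtain ⟨h3, h4⟩ := e2 s t hh; tauto
  have c0 : (0 : Fin 2) ≠ 1 := by decide
  rcases h2 (α i) with ha | ha <;> rcases h2 (α i.next) with hb | hb
  · rw [if_pos (ha.trans hb.symm), Finsupp.single_eq_of_ne (n01 0 1 (by simp [hb])).symm,
      Finsupp.single_eq_of_ne (n01 1 0 (by simp [ha])).symm]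
    simp
  · rw [if_neg (by simp [ha, hb]), Finsupp.single_eq_of_ne (n01 1 0 (by simp [ha])).symm]
    simp only [map_add, map_smul, key, Finsupp.add_apply, Finsupp.smul_apply, Finsupp.single_apply,
      e1 _ _ _ _ ha hb, eq_comm (a := α)]
    rcases h2 (β i) with hc | hc <;> rcases h2 (β i.next) with hd | hd <;>
    simp [hc, hd, cupw, ha]
  · rw [if_neg (by simp [ha, hb]), Finsupp.single_eq_of_ne (n01 0 1 (by simp [ha])).symm]
    simp only [map_add, map_smul, key, Finsupp.add_apply, Finsupp.smul_apply, Finsupp.single_apply,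
      e1 _ _ _ _ ha hb, eq_comm (a := α)]
    rcases h2 (β i) with hc | hc <;> rcases h2 (β i.next) with hd | hd <;>
    simp [hc, hd, cupw, ha]
  · rw [if_pos (ha.trans hb.symm), Finsupp.single_eq_of_ne (n01 0 1 (by simp [ha])).symm,
      Finsupp.single_eq_of_ne (n01 1 0 (by simp [hb])).symm]
    simp

end operators

section operators

theorem next_val {n : ℕ} (i : Pos n) : (i.next).1 = if i.1 = 2 * (n : ℤ) then -2 * (n : ℤ) + 1
    else i.1 + 1 := by
  unfold Pos.next; split_ifs <;> rfl

theorem next_inj {n : ℕ} {i j : Pos n} (h : i.next = j.next) : i = j := by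
  have h1 := Finset.mem_Icc.1 i.2
  have h2 := Finset.mem_Icc.1 j.2
  have h3 := congrArg Subtype.val h
  rw [next_val, next_val] at h3
  apply Subtype.ext
  split_ifs at h3 <;> omega

theorem next_next_ne {n : ℕ} (i : Pos n) : i.next.next ≠ i := by
  have h1 := Finset.mem_Icc.1 i.2
  intro h
  have h3 := congrArg Subtype.val h
  rw [next_val, next_val] at h3
  split_ifs at h3 <;> omega

theorem next_next_next_ne {n : ℕ} (i : Pos n) : i.next.next.next ≠ i := by
  have h1 := Finset.mem_Icc.1 i.2
  intro h
  have h3 := congrArg Subtype.val h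
  rw [next_val, next_val, next_val] at h3
  split_ifs at h3 <;> omega

theorem fin2 (s : Fin 2) : s = 0 ∨ s = 1 := by revert s; decide

theorem r_apply {F : Type*} [Field F] {n : ℕ} (q : Fˣ) (i : Pos n) (ψ : (Pos n → Fin 2) → F)
    (β : Pos n → Fin 2) : r q i ψ β =
      cupw q (β i) (β i.next) * (ψ (put β i 0 1) + (q⁻¹ : Fˣ) * ψ (put β i 1 0)) := rfl

theorem r_sq {F : Type*} [Field F] {n : ℕ} (q : Fˣ) (i : Pos n) :
    r q i * r q i = two q • r q i := by
  refine LinearMap.ext fun ψ => funext fun β => ?_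
  simp only [Module.End.mul_apply, LinearMap.smul_apply, Pi.smul_apply, r_apply, put_put, put_left,
    put_right, smul_eq_mul, two]
  simp [cupw]
  ring_nf

theorem r_comm {F : Type*} [Field F] {n : ℕ} (q p : Fˣ) {i j : Pos n} (h1 : j ≠ i)
    (h2 : j ≠ i.next) (h3 : i ≠ j.next) : Commute (r q i) (r p j) := by
  have h4 : i.next ≠ j.next := fun h => h1 (next_inj h).symm
  have hp : ∀ (β : Pos n → Fin 2) s t s' t',
      put (put β i s t) j s' t' = put (put β j s' t') i s t := by
    intro β s t s' t'
    unfold put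
    rw [Function.update_comm h2.symm, Function.update_comm h1.symm, Function.update_comm h4,
      Function.update_comm h3]
  refine LinearMap.ext fun ψ => funext fun β => ?_
  simp only [Module.End.mul_apply, r_apply, hp, put_other _ _ _ h1 h2,
    put_other _ _ _ h3.symm h4.symm, put_other _ _ _ h1.symm h3, put_other _ _ _ h2.symm h4]
  ring_nf

/-- The word `β` with four consecutive letters replaced. -/
def ow {n : ℕ} (β : Pos n → Fin 2) (i : Pos n) (s t u v : Fin 2) : Pos n → Fin 2 :=
  put (put β i s t) i.next.next u v

theorem ow_self {n : ℕ} (β : Pos n → Fin 2) (i : Pos n) :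
    β = ow β i (β i) (β i.next) (β i.next.next) (β i.next.next.next) := by
  unfold ow
  rw [put_self β i rfl rfl, put_self β _ rfl rfl]

section
variable {F : Type*} [Field F] {n : ℕ} (β : Pos n → Fin 2) (i : Pos n) (s t u v : Fin 2)

theorem ow_0 : ow β i s t u v i = s := by
  rw [ow, put_other _ _ _ (next_next_ne i).symm (next_next_next_ne i).symm, put_left]

theorem ow_1 : ow β i s t u v i.next = t := by
  rw [ow, put_other _ _ _ (next_ne _).symm (next_next_ne _).symm, put_right]

theorem ow_2 : ow β i s t u v i.next.next = u := by rw [ow, put_left]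

theorem ow_3 : ow β i s t u v i.next.next.next = v := by rw [ow, put_right]

theorem ow_other {k : Pos n} (h0 : k ≠ i) (h1 : k ≠ i.next) (h2 : k ≠ i.next.next)
    (h3 : k ≠ i.next.next.next) : ow β i s t u v k = β k := by
  rw [ow, put_other _ _ _ h2 h3, put_other _ _ _ h0 h1]

theorem ow_ext {γ δ : Pos n → Fin 2} (h0 : γ i = δ i) (h1 : γ i.next = δ i.next)
    (h2 : γ i.next.next = δ i.next.next) (h3 : γ i.next.next.next = δ i.next.next.next)
    (h : ∀ k, k ≠ i → k ≠ i.next → k ≠ i.next.next → k ≠ i.next.next.next → γ k = δ k) :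
    γ = δ := by
  funext k
  by_cases k0 : k = i
  · rw [k0, h0]
  by_cases k1 : k = i.next
  · rw [k1, h1]
  by_cases k2 : k = i.next.next
  · rw [k2, h2]
  by_cases k3 : k = i.next.next.next
  · rw [k3, h3]
  exact h k k0 k1 k2 k3

theorem put_ow_0 (s' t' : Fin 2) : put (ow β i s t u v) i s' t' = ow β i s' t' u v := by
  apply ow_ext i
  · rw [put_left, ow_0]
  · rw [put_right, ow_1]
  · rw [put_other _ _ _ (next_next_ne _) (next_ne _), ow_2, ow_2]
  · rw [put_other _ _ _ (next_next_next_ne _) (next_next_ne _), ow_3, ow_3]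
  · intro k h0 h1 h2 h3
    rw [put_other _ _ _ h0 h1, ow_other _ _ _ _ _ _ h0 h1 h2 h3, ow_other _ _ _ _ _ _ h0 h1 h2 h3]

theorem put_ow_1 (s' t' : Fin 2) : put (ow β i s t u v) i.next s' t' = ow β i s s' t' v := by
  apply ow_ext i
  · rw [put_other _ _ _ (next_ne _).symm (next_next_ne _).symm, ow_0, ow_0]
  · rw [put_left, ow_1]
  · rw [put_right, ow_2]
  · rw [put_other _ _ _ (next_next_ne _) (next_ne _), ow_3, ow_3]
  · intro k h0 h1 h2 h3
    rw [put_other _ _ _ h1 h2, ow_other _ _ _ _ _ _ h0 h1 h2 h3, ow_other _ _ _ _ _ _ h0 h1 h2 h3]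

theorem put_ow_2 (s' t' : Fin 2) : put (ow β i s t u v) i.next.next s' t' = ow β i s t s' t' := by
  rw [ow, put_put]; rfl

theorem r_ow_0 (q : Fˣ) (ψ : (Pos n → Fin 2) → F) : r q i ψ (ow β i s t u v) =
    cupw q s t * (ψ (ow β i 0 1 u v) + (q⁻¹ : Fˣ) * ψ (ow β i 1 0 u v)) := by
  rw [r_apply, ow_0, ow_1, put_ow_0, put_ow_0]

theorem r_ow_1 (q : Fˣ) (ψ : (Pos n → Fin 2) → F) : r q i.next ψ (ow β i s t u v) =
    cupw q t u * (ψ (ow β i s 0 1 v) + (q⁻¹ : Fˣ) * ψ (ow β i s 1 0 v)) := by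
  rw [r_apply, ow_1, ow_2, put_ow_1, put_ow_1]

theorem r_ow_2 (q : Fˣ) (ψ : (Pos n → Fin 2) → F) : r q i.next.next ψ (ow β i s t u v) =
    cupw q u v * (ψ (ow β i s t 0 1) + (q⁻¹ : Fˣ) * ψ (ow β i s t 1 0)) := by
  rw [r_apply, ow_2, ow_3, put_ow_2, put_ow_2]

end

theorem r_tl {F : Type*} [Field F] {n : ℕ} (q : Fˣ) (i : Pos n) :
    r q i * r q i.next * r q i = r q i := by
  refine LinearMap.ext fun ψ => funext fun β => ?_
  rw [ow_self β i]
  generalize β i = s, β i.next = t, β i.next.next = u, β i.next.next.next = v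
  simp only [Module.End.mul_apply, r_ow_0, r_ow_1]
  rcases fin2 s with rfl | rfl <;> rcases fin2 t with rfl | rfl <;> rcases fin2 u with rfl | rfl <;>
  simp [cupw]

theorem r_tl' {F : Type*} [Field F] {n : ℕ} (q : Fˣ) (i : Pos n) :
    r q i.next * r q i * r q i.next = r q i.next := by
  refine LinearMap.ext fun ψ => funext fun β => ?_
  rw [ow_self β i]
  generalize β i = s, β i.next = t, β i.next.next = u, β i.next.next.next = v
  simp only [Module.End.mul_apply, r_ow_0, r_ow_1]
  rcases fin2 s with rfl | rfl <;> rcases fin2 t with rfl | rfl <;> rcases fin2 u with rfl | rfl <;>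
  simp [cupw]

theorem r_kappa {F : Type*} [Field F] {n : ℕ} (a b x : Fˣ) (i : Pos n) :
    r a i * r b i.next.next * r x i.next * (r a i * r b i.next.next) =
      two (a * b / x) • (r a i * r b i.next.next) := by
  refine LinearMap.ext fun ψ => funext fun β => ?_
  rw [ow_self β i]
  generalize β i = s, β i.next = t, β i.next.next = u, β i.next.next.next = v
  simp only [Module.End.mul_apply, LinearMap.smul_apply, Pi.smul_apply, smul_eq_mul,
    r_ow_0, r_ow_1, r_ow_2]
  rcases fin2 s with rfl | rfl <;> rcases fin2 t with rfl | rfl <;> rcases fin2 u with rfl | rfl <;>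
  rcases fin2 v with rfl | rfl <;>
  simp [cupw, two] <;> field_simp

end operators

section operators

/-- A product of operators. -/
def opL {F : Type*} [Field F] {n : ℕ} (L : List (Fˣ × Pos n)) :
    Module.End F ((Pos n → Fin 2) → F) :=
  (L.map fun e => r e.1 e.2).prod

/-- The product of the covectors. -/
def cL {F : Type*} [Field F] {n : ℕ} (L : List (Fˣ × Pos n)) (α : Pos n → Fin 2) : F :=
  (L.map fun e => capc e.1 (α e.2) (α e.2.next)).prod

/-- The product of the vectors. -/
def wL {F : Type*} [Field F] {n : ℕ} (L : List (Fˣ × Pos n)) (α : Pos n → Fin 2) : F :=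
  (L.map fun e => cupw e.1 (α e.2) (α e.2.next)).prod

/-- The two edges have no position in common. -/
def Disj {F : Type*} [Field F] {n : ℕ} (e e' : Fˣ × Pos n) : Prop :=
  e'.2 ≠ e.2 ∧ e'.2 ≠ e.2.next ∧ e.2 ≠ e'.2.next

/-- A list of edges which consists of each edge of a given parity once. -/
structure IsMatching {F : Type*} [Field F] {n : ℕ} (π : ℤ) (L : List (Fˣ × Pos n)) : Prop where
  par : ∀ e ∈ L, e.2.1 % 2 = π % 2
  nodup : L.Pairwise fun e e' => e.2 ≠ e'.2
  cover : ∀ p : Pos n, p.1 % 2 = π % 2 → ∃ e ∈ L, e.2 = p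

theorem next_par {n : ℕ} (i : Pos n) : (i.next).1 % 2 ≠ i.1 % 2 := by
  rw [next_val]; split_ifs <;> omega

theorem opL_single {F : Type*} [Field F] {n : ℕ} (L : List (Fˣ × Pos n)) (hL : L.Pairwise Disj)
    (α β : Pos n → Fin 2) [Decidable (∀ k, (∀ e ∈ L, k ≠ e.2 ∧ k ≠ e.2.next) → β k = α k)] :
    opL L (Pi.single α 1) β =
      if ∀ k, (∀ e ∈ L, k ≠ e.2 ∧ k ≠ e.2.next) → β k = α k then cL L α * wL L β else 0 := by
  classical
  induction L generalizing β with
  | nil =>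
    simp only [opL, cL, wL, List.map_nil, List.prod_nil, Module.End.one_apply, mul_one]
    rw [Pi.single_apply]
    congr 1
    simp [funext_iff]
  | cons e L ih =>
    obtain ⟨hd, hL⟩ := List.pairwise_cons.1 hL
    have hw : ∀ s t, wL L (put β e.2 s t) = wL L β := by
      intro s t
      unfold wL
      congr 1
      apply List.map_congr_left
      intro e' he'
      obtain ⟨h1, h2, h3⟩ := hd e' he'
      rw [put_other _ _ _ h1 h2, put_other _ _ _ h3.symm (fun h => h1 (next_inj h))]
    have hc : ∀ s t, (∀ k, (∀ e' ∈ L, k ≠ e'.2 ∧ k ≠ e'.2.next) → put β e.2 s t k = α k) ↔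
        ((∀ k, (∀ e' ∈ e :: L, k ≠ e'.2 ∧ k ≠ e'.2.next) → β k = α k) ∧
          α e.2 = s ∧ α e.2.next = t) := by
      intro s t
      constructor
      · intro h
        refine ⟨fun k hk => ?_, ?_, ?_⟩
        · have h1 := hk e List.mem_cons_self
          rw [← h k fun e' he' => hk e' (List.mem_cons_of_mem _ he'), put_other _ _ _ h1.1 h1.2]
        · rw [← h, put_left]
          intro e' he'
          obtain ⟨h1, h2, h3⟩ := hd e' he'
          exact ⟨h1.symm, h3⟩
        · rw [← h, put_right]
          intro e' he'
          obtain ⟨h1, h2, h3⟩ := hd e' he'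
          exact ⟨h2.symm, fun h => h1 (next_inj h).symm⟩
      · rintro ⟨h, rfl, rfl⟩ k hk
        by_cases h1 : k = e.2
        · rw [h1, put_left]
        by_cases h2 : k = e.2.next
        · rw [h2, put_right]
        rw [put_other _ _ _ h1 h2]
        apply h
        intro e' he'
        rcases List.mem_cons.1 he' with rfl | he'
        · exact ⟨h1, h2⟩
        · exact hk e' he'
    have h0 : opL (e :: L) = r e.1 e.2 * opL L := by simp [opL]
    have h1 : wL (e :: L) β = cupw e.1 (β e.2) (β e.2.next) * wL L β := by simp [wL]
    have h2 : cL (e :: L) α = capc e.1 (α e.2) (α e.2.next) * cL L α := by simp [cL]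
    rw [h0, h1, h2, Module.End.mul_apply, r_apply, ih hL, ih hL, hw, hw]
    simp only [hc]
    by_cases hA : ∀ k, (∀ e' ∈ e :: L, k ≠ e'.2 ∧ k ≠ e'.2.next) → β k = α k
    · rw [if_pos hA]
      simp only [eq_true hA, true_and]
      rcases fin2 (α e.2) with ha | ha <;> rcases fin2 (α e.2.next) with hb | hb <;>
      simp [ha, hb, capc] <;> ring_nf
    · rw [if_neg hA]
      simp only [eq_false hA, false_and, if_false]
      simp

theorem matching_disj {F : Type*} [Field F] {n : ℕ} {π : ℤ} {L : List (Fˣ × Pos n)}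
    (h : IsMatching π L) : L.Pairwise Disj := by
  refine List.Pairwise.imp_of_mem ?_ h.nodup
  intro e e' he he' hne
  have h1 := h.par e he
  have h2 := h.par e' he'
  refine ⟨hne.symm, ?_, ?_⟩
  · intro hh
    have := next_par e.2
    rw [← hh] at this; omega
  · intro hh
    have := next_par e'.2
    rw [← hh] at this; omega

theorem next_surj {n : ℕ} (p : Pos n) : ∃ i : Pos n, i.next = p :=
  (Finite.injective_iff_surjective.1 (fun _ _ h => next_inj h)) p

theorem opL_apply {F : Type*} [Field F] {n : ℕ} {π : ℤ} {L : List (Fˣ × Pos n)}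
    (h : IsMatching π L) (ψ : (Pos n → Fin 2) → F) (β : Pos n → Fin 2) :
    opL L ψ β = (∑ α : Pos n → Fin 2, cL L α * ψ α) * wL L β := by
  classical
  have hs : ψ = ∑ α, ψ α • (Pi.single α 1 : (Pos n → Fin 2) → F) := by
    funext γ
    simp [Finset.sum_apply, Pi.single_apply]
  conv_lhs => rw [hs]
  rw [map_sum, Finset.sum_apply, Finset.sum_mul]
  refine Finset.sum_congr rfl fun α _ => ?_
  rw [map_smul, Pi.smul_apply, opL_single L (matching_disj h), if_pos]
  · simp only [smul_eq_mul]; ring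
  · intro k hk
    exfalso
    by_cases hp : k.1 % 2 = π % 2
    · obtain ⟨e, he, rfl⟩ := h.cover k hp
      exact (hk e he).1 rfl
    · obtain ⟨j, rfl⟩ := next_surj k
      have := next_par j
      obtain ⟨e, he, rfl⟩ := h.cover j (by omega)
      exact (hk e he).2 rfl

/-- The alternating word with the letter `t` at the positions of parity `π`. -/
def alt (n : ℕ) (π : ℤ) (t u : Fin 2) : Pos n → Fin 2 := fun p => if p.1 % 2 = π % 2 then t else u

theorem alternating {n : ℕ} {γ δ : Pos n → Fin 2} (hγ : ∀ p, γ p ≠ γ p.next)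
    (hδ : ∀ p, δ p ≠ δ p.next) (p₀ : Pos n) (h0 : p₀.1 = -2 * (n : ℤ) + 1) (h : γ p₀ = δ p₀) :
    γ = δ := by
  have key : ∀ (k : ℕ) (p : Pos n), p.1 = -2 * (n : ℤ) + 1 + k → γ p = δ p := by
    intro k
    induction k with
    | zero =>
      intro p hp
      have : p = p₀ := Subtype.ext (by rw [hp, h0]; simp)
      rw [this, h]
    | succ k ih =>
      intro p hp
      obtain ⟨j, rfl⟩ := next_surj p
      have h1 := Finset.mem_Icc.1 j.2
      have hj : γ j = δ j := by
        apply ih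
        rw [next_val] at hp
        push_cast at hp
        split_ifs at hp <;> omega
      have h2 := hγ j
      have h3 := hδ j
      rw [hj] at h2
      revert h2 h3
      generalize γ j.next = s, δ j.next = t, δ j = u
      revert s t u
      decide
  funext p
  have h1 := Finset.mem_Icc.1 p.2
  exact key (p.1 - (-2 * (n : ℤ) + 1)).toNat p (by omega)

/-- The product of the parameters. -/
def qL {F : Type*} [Field F] {n : ℕ} (L : List (Fˣ × Pos n)) : Fˣ := (L.map Prod.fst).prod

theorem alt_next {n : ℕ} {π : ℤ} {t u : Fin 2} (p : Pos n) (h : p.1 % 2 = π % 2) :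
    alt n π t u p = t ∧ alt n π t u p.next = u := by
  have := next_par p
  exact ⟨if_pos h, if_neg (by omega)⟩

theorem alt_next' {n : ℕ} {π : ℤ} {t u : Fin 2} (p : Pos n) (h : p.1 % 2 ≠ π % 2) :
    alt n π t u p = u ∧ alt n π t u p.next = t := by
  have := next_par p
  exact ⟨if_neg h, if_pos (by omega)⟩

theorem prod_const {F : Type*} [Field F] {n : ℕ} (L : List (Fˣ × Pos n))
    (g : Fˣ × Pos n → F) (k : Fˣ →* F) (h : ∀ e ∈ L, g e = k e.1) :
    (L.map g).prod = k (qL L) := by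
  rw [qL, map_list_prod, List.map_map]
  congr 1
  exact List.map_congr_left h

theorem sum_cw {F : Type*} [Field F] {n : ℕ} (hn : 1 ≤ n) {π ρ : ℤ} (hπ : π % 2 ≠ ρ % 2)
    {L K : List (Fˣ × Pos n)} (hL : IsMatching π L) (hK : IsMatching ρ K) :
    (∑ γ : Pos n → Fin 2, cL L γ * wL K γ : F) = 1 + (qL K : F) * ((qL L)⁻¹ : Fˣ) := by
  classical
  let p₀ : Pos n := ⟨-2 * (n : ℤ) + 1, Finset.mem_Icc.2 (by omega)⟩
  have hne : alt n π 0 1 ≠ alt n π 1 0 := by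
    intro h
    have := congrFun h p₀
    unfold alt at this
    split_ifs at this <;> simp at this
  have hK' : ∀ e ∈ K, e.2.1 % 2 ≠ π % 2 := fun e he => by rw [hK.par e he]; exact hπ.symm
  have halt : ∀ t u : Fin 2, t ≠ u → ∀ p : Pos n, alt n π t u p ≠ alt n π t u p.next := by
    intro t u htu p
    by_cases h : p.1 % 2 = π % 2
    · rw [(alt_next p h).1, (alt_next p h).2]; exact htu
    · rw [(alt_next' p h).1, (alt_next' p h).2]; exact htu.symm
  rw [Fintype.sum_eq_add _ _ hne]
  · have h1 : cL (F := F) L (alt n π 0 1) = 1 := by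
      have := prod_const L (fun e => capc e.1 (alt n π 0 1 e.2) (alt n π 0 1 e.2.next)) 1
        (fun e he => by
          simp [(alt_next (t := 0) (u := 1) e.2 (hL.par e he)).1,
            (alt_next (t := 0) (u := 1) e.2 (hL.par e he)).2, capc])
      exact this
    have h2 : wL (F := F) K (alt n π 0 1) = 1 := by
      have := prod_const K (fun e => cupw e.1 (alt n π 0 1 e.2) (alt n π 0 1 e.2.next)) 1
        (fun e he => by
          simp [(alt_next' (t := 0) (u := 1) e.2 (hK' e he)).1,
            (alt_next' (t := 0) (u := 1) e.2 (hK' e he)).2, cupw])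
      exact this
    have h3 : cL (F := F) L (alt n π 1 0) = ((qL L)⁻¹ : Fˣ) := by
      have := prod_const L (fun e => capc e.1 (alt n π 1 0 e.2) (alt n π 1 0 e.2.next))
        ((Units.coeHom F).comp invMonoidHom)
        (fun e he => by
          simp [(alt_next (t := 1) (u := 0) e.2 (hL.par e he)).1,
            (alt_next (t := 1) (u := 0) e.2 (hL.par e he)).2, capc])
      exact this
    have h4 : wL (F := F) K (alt n π 1 0) = (qL K : F) := by
      have := prod_const K (fun e => cupw e.1 (alt n π 1 0 e.2) (alt n π 1 0 e.2.next))
        (Units.coeHom F)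
        (fun e he => by
          simp [(alt_next' (t := 1) (u := 0) e.2 (hK' e he)).1,
            (alt_next' (t := 1) (u := 0) e.2 (hK' e he)).2, cupw])
      exact this
    rw [h1, h2, h3, h4]; ring
  · rintro γ ⟨hA, hB⟩
    by_contra h
    have h1 : cL (F := F) L γ ≠ 0 := left_ne_zero_of_mul h
    have h2 : wL (F := F) K γ ≠ 0 := right_ne_zero_of_mul h
    have hγ : ∀ p, γ p ≠ γ p.next := by
      intro p hp
      by_cases hpar : p.1 % 2 = π % 2
      · obtain ⟨e, he, rfl⟩ := hL.cover p hpar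
        apply h1
        apply List.prod_eq_zero
        exact List.mem_map.2 ⟨e, he, by simp [capc, hp]⟩
      · obtain ⟨e, he, rfl⟩ := hK.cover p (by omega)
        apply h2
        apply List.prod_eq_zero
        exact List.mem_map.2 ⟨e, he, by simp [cupw, hp]⟩
    have : γ p₀ = alt n π 0 1 p₀ ∨ γ p₀ = alt n π 1 0 p₀ := by
      unfold alt
      rcases fin2 (γ p₀) with h | h <;> rw [h] <;> split_ifs <;> simp
    rcases this with h | h
    · exact hA (alternating hγ (halt 0 1 (by decide)) p₀ rfl h)
    · exact hB (alternating hγ (halt 1 0 (by decide)) p₀ rfl h)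

theorem opL_long {F : Type*} [Field F] {n : ℕ} (hn : 1 ≤ n) {π ρ : ℤ} (hπ : π % 2 ≠ ρ % 2)
    {L K : List (Fˣ × Pos n)} (hL : IsMatching π L) (hK : IsMatching ρ K) :
    opL L * opL K * opL L =
      ((qL K : F) / qL L + 2 + (qL L : F) / qL K) • opL L := by
  refine LinearMap.ext fun ψ => funext fun β => ?_
  simp only [Module.End.mul_apply, LinearMap.smul_apply, Pi.smul_apply, smul_eq_mul]
  rw [opL_apply hL, opL_apply hL]
  have h1 : ∀ γ, opL K (opL L ψ) γ =
      (1 + (qL L : F) * ((qL K)⁻¹ : Fˣ)) * (∑ α : Pos n → Fin 2, cL L α * ψ α) * wL K γ := by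
    intro γ
    rw [opL_apply hK, ← sum_cw hn hπ.symm hK hL]
    congr 1
    rw [Finset.sum_mul]
    refine Finset.sum_congr rfl fun δ _ => ?_
    rw [opL_apply hL]; ring
  have h2 : (∑ γ : Pos n → Fin 2, cL L γ * opL K (opL L ψ) γ : F) =
      (1 + (qL L : F) * ((qL K)⁻¹ : Fˣ)) * (∑ α : Pos n → Fin 2, cL L α * ψ α) *
        (1 + (qL K : F) * ((qL L)⁻¹ : Fˣ)) := by
    rw [← sum_cw hn hπ hL hK, Finset.mul_sum]
    refine Finset.sum_congr rfl fun δ _ => ?_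
    rw [h1]; ring
  rw [h2]
  simp only [Units.val_inv_eq_inv_val]
  have e1 : (qL L : F) ≠ 0 := Units.ne_zero _
  have e2 : (qL K : F) ≠ 0 := Units.ne_zero _
  field_simp
  ring

end operators

section relations

/-- The position with the given label (used only for labels in the range). -/
noncomputable def posOf {n : ℕ} (hn : 1 ≤ n) (z : ℤ) : Pos n :=
  if h : z ∈ Finset.Icc (-2 * (n : ℤ) + 1) (2 * (n : ℤ)) then ⟨z, h⟩
  else ⟨0, Finset.mem_Icc.2 (by omega)⟩

theorem posOf_val {n : ℕ} (hn : 1 ≤ n) {z : ℤ} (h1 : -2 * (n : ℤ) + 1 ≤ z) (h2 : z ≤ 2 * (n : ℤ)) :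
    (posOf hn z).1 = z := by
  rw [posOf, dif_pos (Finset.mem_Icc.2 ⟨h1, h2⟩)]

theorem posOf_eq {n : ℕ} (hn : 1 ≤ n) {z : ℤ}
    (h : z ∈ Finset.Icc (-2 * (n : ℤ) + 1) (2 * (n : ℤ))) : (⟨z, h⟩ : Pos n) = posOf hn z := by
  rw [posOf, dif_pos h]

theorem posOf_ne {n : ℕ} (hn : 1 ≤ n) {z z' : ℤ} (h1 : -2 * (n : ℤ) + 1 ≤ z)
    (h2 : z ≤ 2 * (n : ℤ)) (h1' : -2 * (n : ℤ) + 1 ≤ z') (h2' : z' ≤ 2 * (n : ℤ)) (h : z ≠ z') :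
    posOf hn z ≠ posOf hn z' := by
  intro hh
  have := congrArg Subtype.val hh
  rw [posOf_val hn h1 h2, posOf_val hn h1' h2'] at this
  exact h this

theorem posOf_next {n : ℕ} (hn : 1 ≤ n) {z z' : ℤ} (h1 : -2 * (n : ℤ) + 1 ≤ z)
    (h2 : z ≤ 2 * (n : ℤ))
    (h : z' = if z = 2 * (n : ℤ) then -2 * (n : ℤ) + 1 else z + 1) :
    posOf hn z' = (posOf hn z).next := by
  apply Subtype.ext
  rw [next_val, posOf_val hn h1 h2, ← h, posOf_val hn] <;> split_ifs at h <;> omega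

theorem t_comm {F : Type*} [Field F] {n : ℕ} (hn : 1 ≤ n) (q q' : Fˣ) {z z' : ℤ}
    (h : -2 * (n : ℤ) + 1 ≤ z ∧ z ≤ 2 * (n : ℤ) ∧ -2 * (n : ℤ) + 1 ≤ z' ∧ z' ≤ 2 * (n : ℤ) ∧
      ((z + 2 ≤ z' ∧ z' ≤ z + 4 * n - 2) ∨ (z' + 2 ≤ z ∧ z ≤ z' + 4 * n - 2))) :
    Commute (r q (posOf hn z)) (r q' (posOf hn z')) := by
  obtain ⟨h1, h2, h1', h2', h⟩ := h
  have v := posOf_val hn h1 h2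
  have v' := posOf_val hn h1' h2'
  apply r_comm
  · intro hh; have := congrArg Subtype.val hh; omega
  · intro hh; have := congrArg Subtype.val hh
    rw [next_val, v, v'] at this; split_ifs at this <;> omega
  · intro hh; have := congrArg Subtype.val hh
    rw [next_val, v, v'] at this; split_ifs at this <;> omega

theorem t_tl {F : Type*} [Field F] {n : ℕ} (hn : 1 ≤ n) (q : Fˣ) {z z' : ℤ}
    (h1 : -2 * (n : ℤ) + 1 ≤ z ∧ -2 * (n : ℤ) + 1 ≤ z' ∧ z ≤ 2 * n ∧ z' ≤ 2 * n)
    (h : z' = z + 1 ∨ z = z' + 1) :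
    r q (posOf hn z) * r q (posOf hn z') * r q (posOf hn z) = r q (posOf hn z) := by
  rcases h with rfl | rfl
  · rw [posOf_next hn (z := z) (z' := z + 1) h1.1 h1.2.2.1 (by rw [if_neg]; omega)]
    exact r_tl _ _
  · rw [posOf_next hn (z := z') (z' := z' + 1) h1.2.1 h1.2.2.2 (by rw [if_neg]; omega)]
    exact r_tl' _ _

theorem t_kappa {F : Type*} [Field F] {n : ℕ} (hn : 1 ≤ n) (a b x : Fˣ) {z₁ z₂ z₃ : ℤ}
    (h1 : -2 * (n : ℤ) + 1 ≤ z₁ ∧ z₁ ≤ 2 * (n : ℤ))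
    (h2 : -2 * (n : ℤ) + 1 ≤ z₂ ∧ z₂ ≤ 2 * (n : ℤ))
    (h12 : z₂ = if z₁ = 2 * (n : ℤ) then -2 * (n : ℤ) + 1 else z₁ + 1)
    (h23 : z₃ = if z₂ = 2 * (n : ℤ) then -2 * (n : ℤ) + 1 else z₂ + 1) :
    r a (posOf hn z₁) * r b (posOf hn z₃) * r x (posOf hn z₂) *
      (r a (posOf hn z₁) * r b (posOf hn z₃)) =
      two (a * b / x) • (r a (posOf hn z₁) * r b (posOf hn z₃)) := by
  rw [posOf_next hn h2.1 h2.2 h23, posOf_next hn h1.1 h1.2 h12]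
  exact r_kappa a b x _

/-- The operators of the generators, in coordinates. -/
noncomputable def genr {F : Type*} [Field F] {n : ℕ} (hn : 1 ≤ n) (S : TensorParams F) :
    Gen n → Module.End F ((Pos n → Fin 2) → F)
  | .e _ => r S.x (posOf hn (-n)) * r S.y (posOf hn n)
  | .f _ => r S.z (posOf hn 0) * r S.w (posOf hn (2 * n))
  | .U i _ => r S.a (posOf hn (-n - i)) * r S.b (posOf hn (-n + i)) *
      r S.c (posOf hn (n - i)) * r S.d (posOf hn (n + i))

theorem quad_mul {A : Type*} [Monoid A] {a b c d a' b' c' d' : A} (h1 : Commute b a')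
    (h2 : Commute c a') (h3 : Commute d a') (h4 : Commute c b') (h5 : Commute d b')
    (h6 : Commute d c') :
    a * b * c * d * (a' * b' * c' * d') = (a * a') * (b * b') * (c * c') * (d * d') := by
  have e1 : Commute (b * c * d) a' := (h1.mul_left h2).mul_left h3
  have e2 : Commute (c * d) b' := h4.mul_left h5
  calc a * b * c * d * (a' * b' * c' * d')
      = a * ((b * c * d) * a') * b' * c' * d' := by simp only [mul_assoc]
    _ = a * a' * b * ((c * d) * b') * c' * d' := by rw [e1.eq]; simp only [mul_assoc]
    _ = a * a' * (b * b') * c * (d * c') * d' := by rw [e2.eq]; simp only [mul_assoc]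
    _ = _ := by rw [h6.eq]; simp only [mul_assoc]

theorem pair_mul {A : Type*} [Monoid A] {X Y x y : A} (h1 : Commute Y x) (h2 : Commute Y X)
    (h3 : Commute y X) : X * Y * (x * y) * (X * Y) = (X * x * X) * (Y * y * Y) := by
  calc X * Y * (x * y) * (X * Y) = X * (Y * x) * (y * X) * Y := by simp only [mul_assoc]
    _ = X * x * (Y * X) * y * Y := by rw [h1.eq, h3.eq]; simp only [mul_assoc]
    _ = _ := by rw [h2.eq]; simp only [mul_assoc]

/-- The edges of `U_i`. -/
noncomputable def edgesU {F : Type*} [Field F] {n : ℕ} (hn : 1 ≤ n) (S : TensorParams F) (i : ℕ) :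
    List (Fˣ × Pos n) :=
  [(S.a, posOf hn (-n - i)), (S.b, posOf hn (-n + i)), (S.c, posOf hn (n - i)),
    (S.d, posOf hn (n + i))]

/-- The edges of `f`. -/
noncomputable def edgesF {F : Type*} [Field F] {n : ℕ} (hn : 1 ≤ n) (S : TensorParams F) :
    List (Fˣ × Pos n) := [(S.z, posOf hn 0), (S.w, posOf hn (2 * n))]

/-- The edges of `e`. -/
noncomputable def edgesE {F : Type*} [Field F] {n : ℕ} (hn : 1 ≤ n) (S : TensorParams F) :
    List (Fˣ × Pos n) := [(S.x, posOf hn (-n)), (S.y, posOf hn n)]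

/-- The edges of `I`. -/
noncomputable def edgesI {F : Type*} [Field F] {n : ℕ} (hn : 1 ≤ n) (S : TensorParams F) :
    List (Fˣ × Pos n) :=
  ((List.range (n / 2)).flatMap fun k => edgesU hn S (2 * k + 1)) ++
    if Odd n then edgesF hn S else []

/-- The edges of `J`. -/
noncomputable def edgesJ {F : Type*} [Field F] {n : ℕ} (hn : 1 ≤ n) (S : TensorParams F) :
    List (Fˣ × Pos n) :=
  edgesE hn S ++ ((List.range ((n - 1) / 2)).flatMap fun k => edgesU hn S (2 * k + 2)) ++
    if Even n then edgesF hn S else []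

theorem map_flatMap_prod {A B : Type*} [Monoid B] (g : A → B) (L : List ℕ) (f : ℕ → List A) :
    ((L.flatMap f).map g).prod = (L.map fun k => ((f k).map g).prod).prod := by
  induction L with
  | nil => simp
  | cons k L ih => simp [List.flatMap_cons, ih]

theorem edgesU_par {F : Type*} [Field F] {n : ℕ} (hn : 1 ≤ n) (S : TensorParams F) {i : ℕ}
    (h : 1 ≤ i ∧ i < n) : ∀ e ∈ edgesU hn S i, e.2.1 % 2 = ((n : ℤ) + i) % 2 := by
  intro e he
  simp only [edgesU, List.mem_cons, List.not_mem_nil, or_false] at he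
  rcases he with rfl | rfl | rfl | rfl <;> simp only [] <;>
    rw [posOf_val hn (by omega) (by omega)] <;> omega

theorem edgesF_par {F : Type*} [Field F] {n : ℕ} (hn : 1 ≤ n) (S : TensorParams F) :
    ∀ e ∈ edgesF hn S, e.2.1 % 2 = 0 := by
  intro e he
  simp only [edgesF, List.mem_cons, List.not_mem_nil, or_false] at he
  rcases he with rfl | rfl <;> (simp only []; rw [posOf_val hn (by omega) (by omega)] <;> omega)

theorem edgesE_par {F : Type*} [Field F] {n : ℕ} (hn : 1 ≤ n) (S : TensorParams F) :
    ∀ e ∈ edgesE hn S, e.2.1 % 2 = (n : ℤ) % 2 := by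
  intro e he
  simp only [edgesE, List.mem_cons, List.not_mem_nil, or_false] at he
  rcases he with rfl | rfl <;> (simp only []; rw [posOf_val hn (by omega) (by omega)] <;> omega)

/-- Distinct positions. -/
def Ne2 {F : Type*} [Field F] {n : ℕ} (e e' : Fˣ × Pos n) : Prop := e.2 ≠ e'.2

theorem flat_pairwise {F : Type*} [Field F] {n : ℕ} (hn : 1 ≤ n) (S : TensorParams F)
    (m : ℕ) (g : ℕ → ℕ) (hg : ∀ k < m, 1 ≤ g k ∧ g k < n)
    (hinj : ∀ k l, k < l → g k < g l) :
    ((List.range m).flatMap fun k => edgesU hn S (g k)).Pairwise Ne2 := by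
  rw [List.pairwise_flatMap]
  constructor
  · intro k hk
    have := hg k (List.mem_range.1 hk)
    simp only [edgesU, List.pairwise_cons, List.mem_cons, List.not_mem_nil, or_false]
    refine ⟨?_, ?_, ?_, ?_, List.Pairwise.nil⟩
    · rintro e (rfl | rfl | rfl) <;> exact posOf_ne hn (by omega) (by omega) (by omega) (by omega) (by omega)
    · rintro e (rfl | rfl) <;> exact posOf_ne hn (by omega) (by omega) (by omega) (by omega) (by omega)
    · rintro e rfl; exact posOf_ne hn (by omega) (by omega) (by omega) (by omega) (by omega)
    · rintro e ⟨⟩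
  · refine List.Pairwise.imp_of_mem ?_ (List.pairwise_lt_range (n := m))
    intro k l hk hl hkl
    have h1 := hg k (List.mem_range.1 hk)
    have h2 := hg l (List.mem_range.1 hl)
    have h3 := hinj k l hkl
    simp only [edgesU, List.mem_cons, List.not_mem_nil, or_false]
    rintro e (rfl | rfl | rfl | rfl) e' (rfl | rfl | rfl | rfl) <;>
      exact posOf_ne hn (by omega) (by omega) (by omega) (by omega) (by omega)

theorem F_pairwise {F : Type*} [Field F] {n : ℕ} (hn : 1 ≤ n) (S : TensorParams F) :
    (edgesF hn S).Pairwise Ne2 := by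
  simp only [edgesF, List.pairwise_cons, List.mem_cons, List.not_mem_nil, or_false]
  refine ⟨?_, ?_, List.Pairwise.nil⟩
  · rintro e rfl; exact posOf_ne hn (by omega) (by omega) (by omega) (by omega) (by omega)
  · rintro e ⟨⟩

theorem E_pairwise {F : Type*} [Field F] {n : ℕ} (hn : 1 ≤ n) (S : TensorParams F) :
    (edgesE hn S).Pairwise Ne2 := by
  simp only [edgesE, List.pairwise_cons, List.mem_cons, List.not_mem_nil, or_false]
  refine ⟨?_, ?_, List.Pairwise.nil⟩
  · rintro e rfl; exact posOf_ne hn (by omega) (by omega) (by omega) (by omega) (by omega)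
  · rintro e ⟨⟩

theorem UF_ne {F : Type*} [Field F] {n : ℕ} (hn : 1 ≤ n) (S : TensorParams F) {i : ℕ}
    (h : 1 ≤ i ∧ i < n) : ∀ e ∈ edgesU hn S i, ∀ e' ∈ edgesF hn S, Ne2 e e' := by
  simp only [edgesU, edgesF, List.mem_cons, List.not_mem_nil, or_false]
  rintro e (rfl | rfl | rfl | rfl) e' (rfl | rfl) <;>
    exact posOf_ne hn (by omega) (by omega) (by omega) (by omega) (by omega)

theorem EU_ne {F : Type*} [Field F] {n : ℕ} (hn : 1 ≤ n) (S : TensorParams F) {i : ℕ}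
    (h : 1 ≤ i ∧ i < n) : ∀ e ∈ edgesE hn S, ∀ e' ∈ edgesU hn S i, Ne2 e e' := by
  simp only [edgesU, edgesE, List.mem_cons, List.not_mem_nil, or_false]
  rintro e (rfl | rfl) e' (rfl | rfl | rfl | rfl) <;>
    exact posOf_ne hn (by omega) (by omega) (by omega) (by omega) (by omega)

theorem EF_ne {F : Type*} [Field F] {n : ℕ} (hn : 1 ≤ n) (S : TensorParams F) :
    ∀ e ∈ edgesE hn S, ∀ e' ∈ edgesF hn S, Ne2 e e' := by
  simp only [edgesF, edgesE, List.mem_cons, List.not_mem_nil, or_false]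
  rintro e (rfl | rfl) e' (rfl | rfl) <;>
    exact posOf_ne hn (by omega) (by omega) (by omega) (by omega) (by omega)

theorem edgesU_cover {F : Type*} [Field F] {n : ℕ} (hn : 1 ≤ n) (S : TensorParams F) (p : Pos n)
    (h0 : p.1 ≠ 0) (h1 : p.1 ≠ 2 * n) (h2 : p.1 ≠ n) (h3 : p.1 ≠ -n) :
    ∃ i : ℕ, 1 ≤ i ∧ i < n ∧ ((n : ℤ) + i) % 2 = p.1 % 2 ∧ ∃ e ∈ edgesU hn S i, e.2 = p := by
  have hp := Finset.mem_Icc.1 p.2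
  simp only [edgesU, List.mem_cons, List.not_mem_nil, or_false, exists_eq_or_imp, exists_eq_left]
  have hz : ∀ z : ℤ, z = p.1 → posOf hn z = p := fun z hz =>
    Subtype.ext ((posOf_val hn (by omega) (by omega)).trans hz)
  by_cases c1 : p.1 < -n
  · exact ⟨(-n - p.1).toNat, by omega, by omega, by omega, Or.inl (hz _ (by omega))⟩
  by_cases c2 : p.1 < 0
  · exact ⟨(p.1 + n).toNat, by omega, by omega, by omega, Or.inr (Or.inl (hz _ (by omega)))⟩
  by_cases c3 : p.1 < n
  · exact ⟨(n - p.1).toNat, by omega, by omega, by omega,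
      Or.inr (Or.inr (Or.inl (hz _ (by omega))))⟩
  · exact ⟨(p.1 - n).toNat, by omega, by omega, by omega,
      Or.inr (Or.inr (Or.inr (hz _ (by omega))))⟩

theorem edgesF_cover {F : Type*} [Field F] {n : ℕ} (hn : 1 ≤ n) (S : TensorParams F) (p : Pos n)
    (h : p.1 = 0 ∨ p.1 = 2 * n) : ∃ e ∈ edgesF hn S, e.2 = p := by
  simp only [edgesF, List.mem_cons, List.not_mem_nil, or_false, exists_eq_or_imp, exists_eq_left]
  rcases h with h | h
  · exact Or.inl (Subtype.ext ((posOf_val hn (by omega) (by omega)).trans h.symm))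
  · exact Or.inr (Subtype.ext ((posOf_val hn (by omega) (by omega)).trans h.symm))

theorem edgesE_cover {F : Type*} [Field F] {n : ℕ} (hn : 1 ≤ n) (S : TensorParams F) (p : Pos n)
    (h : p.1 = -n ∨ p.1 = n) : ∃ e ∈ edgesE hn S, e.2 = p := by
  simp only [edgesE, List.mem_cons, List.not_mem_nil, or_false, exists_eq_or_imp, exists_eq_left]
  rcases h with h | h
  · exact Or.inl (Subtype.ext ((posOf_val hn (by omega) (by omega)).trans h.symm))
  · exact Or.inr (Subtype.ext ((posOf_val hn (by omega) (by omega)).trans h.symm))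

theorem matchI {F : Type*} [Field F] {n : ℕ} (hn : 1 ≤ n) (S : TensorParams F) :
    IsMatching ((n : ℤ) + 1) (edgesI hn S) := by
  constructor
  · intro e he
    rcases List.mem_append.1 he with he | he
    · obtain ⟨k, hk, he⟩ := List.mem_flatMap.1 he
      have := List.mem_range.1 hk
      have := edgesU_par hn S (by omega) e he
      push_cast at this
      omega
    · split_ifs at he with ho
      · have := edgesF_par hn S e he
        obtain ⟨k, rfl⟩ := ho
        push_cast
        omega
      · simp at he
  · change List.Pairwise Ne2 _
    refine List.pairwise_append.2 ⟨flat_pairwise hn S _ _ (fun k hk => by omega)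
      (fun k l h => by omega), ?_, ?_⟩
    · split_ifs
      · exact F_pairwise hn S
      · exact List.Pairwise.nil
    · intro e he e' he'
      split_ifs at he' with ho
      · obtain ⟨k, hk, he⟩ := List.mem_flatMap.1 he
        have := List.mem_range.1 hk
        exact UF_ne hn S (by omega) e he e' he'
      · simp at he'
  · intro p hp
    by_cases h : p.1 = 0 ∨ p.1 = 2 * n
    · obtain ⟨e, he, h⟩ := edgesF_cover hn S p h
      have ho : Odd n := by rw [Nat.odd_iff]; omega
      exact ⟨e, List.mem_append_right _ (by rwa [if_pos ho]), h⟩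
    · obtain ⟨i, h1, h2, h3, e, he, h⟩ := edgesU_cover hn S p (by tauto) (by tauto)
        (by omega) (by omega)
      refine ⟨e, List.mem_append_left _ (List.mem_flatMap.2 ⟨i / 2, List.mem_range.2 (by omega), ?_⟩), h⟩
      rwa [show 2 * (i / 2) + 1 = i by omega]

theorem matchJ {F : Type*} [Field F] {n : ℕ} (hn : 1 ≤ n) (S : TensorParams F) :
    IsMatching (n : ℤ) (edgesJ hn S) := by
  constructor
  · intro e he
    rcases List.mem_append.1 he with he | he
    · rcases List.mem_append.1 he with he | he
      · exact edgesE_par hn S e he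
      · obtain ⟨k, hk, he⟩ := List.mem_flatMap.1 he
        have := List.mem_range.1 hk
        have := edgesU_par hn S (by omega) e he
        push_cast at this
        omega
    · split_ifs at he with ho
      · have := edgesF_par hn S e he
        obtain ⟨k, rfl⟩ := ho
        push_cast
        omega
      · simp at he
  · change List.Pairwise Ne2 _
    refine List.pairwise_append.2 ⟨List.pairwise_append.2 ⟨E_pairwise hn S,
      flat_pairwise hn S _ _ (fun k hk => by omega) (fun k l h => by omega), ?_⟩, ?_, ?_⟩
    · intro e he e' he'
      obtain ⟨k, hk, he'⟩ := List.mem_flatMap.1 he'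
      have := List.mem_range.1 hk
      exact EU_ne hn S (by omega) e he e' he'
    · split_ifs
      · exact F_pairwise hn S
      · exact List.Pairwise.nil
    · intro e he e' he'
      split_ifs at he' with ho
      · rcases List.mem_append.1 he with he | he
        · exact EF_ne hn S e he e' he'
        · obtain ⟨k, hk, he⟩ := List.mem_flatMap.1 he
          have := List.mem_range.1 hk
          exact UF_ne hn S (by omega) e he e' he'
      · simp at he'
  · intro p hp
    by_cases h : p.1 = 0 ∨ p.1 = 2 * n
    · obtain ⟨e, he, h⟩ := edgesF_cover hn S p h
      have ho : Even n := by rw [Nat.even_iff]; omega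
      exact ⟨e, List.mem_append_right _ (by rwa [if_pos ho]), h⟩
    by_cases h' : p.1 = -n ∨ p.1 = n
    · obtain ⟨e, he, h⟩ := edgesE_cover hn S p h'
      exact ⟨e, List.mem_append_left _ (List.mem_append_left _ he), h⟩
    · obtain ⟨i, h1, h2, h3, e, he, h⟩ := edgesU_cover hn S p (by tauto) (by tauto)
        (by tauto) (by tauto)
      refine ⟨e, List.mem_append_left _ (List.mem_append_right _
        (List.mem_flatMap.2 ⟨i / 2 - 1, List.mem_range.2 (by omega), ?_⟩)), h⟩
      rwa [show 2 * (i / 2 - 1) + 2 = i by omega]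

theorem opU {F : Type*} [Field F] {n : ℕ} (hn : 1 ≤ n) (S : TensorParams F) {i : ℕ}
    (h : 1 ≤ i ∧ i < n) : uOf (genr hn S) i = opL (edgesU hn S i) := by
  rw [uOf, dif_pos h]
  simp [opL, edgesU, genr, mul_assoc]

theorem opF {F : Type*} [Field F] {n : ℕ} (hn h : 1 ≤ n) (S : TensorParams F) :
    genr hn S (.f h) = opL (edgesF hn S) := by
  simp [opL, edgesF, genr]

theorem opE {F : Type*} [Field F] {n : ℕ} (hn h : 1 ≤ n) (S : TensorParams F) :
    genr hn S (.e h) = opL (edgesE hn S) := by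
  simp [opL, edgesE, genr]

theorem opL_append {F : Type*} [Field F] {n : ℕ} (L K : List (Fˣ × Pos n)) :
    opL (L ++ K) = opL L * opL K := by
  simp [opL]

theorem opI {F : Type*} [Field F] {n : ℕ} (hn : 1 ≤ n) (S : TensorParams F) :
    wordI (genr hn S) = opL (edgesI hn S) := by
  rw [wordI, edgesI, opL_append]
  congr 1
  · rw [opL, map_flatMap_prod]
    congr 1
    apply List.map_congr_left
    intro k hk
    have := List.mem_range.1 hk
    exact opU hn S (by omega)
  · split_ifs with h
    · exact opF hn _ S
    · simp [opL]

theorem opJ {F : Type*} [Field F] {n : ℕ} (hn h : 1 ≤ n) (S : TensorParams F) :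
    wordJ h (genr hn S) = opL (edgesJ hn S) := by
  rw [wordJ, edgesJ, opL_append, opL_append, opE]
  congr 1
  · congr 1
    rw [opL, map_flatMap_prod]
    congr 1
    apply List.map_congr_left
    intro k hk
    have := List.mem_range.1 hk
    exact opU hn S (by omega)
  · split_ifs with h
    · exact opF hn _ S
    · simp [opL]

theorem qL_U {F : Type*} [Field F] {n : ℕ} (hn : 1 ≤ n) (S : TensorParams F) (i : ℕ) :
    ((edgesU hn S i).map Prod.fst).prod = S.a * S.b * S.c * S.d := by
  simp [edgesU, mul_assoc]

theorem qI {F : Type*} [Field F] {n : ℕ} (hn : 1 ≤ n) (S : TensorParams F) :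
    qL (edgesI hn S) = (S.a * S.b * S.c * S.d) ^ (n / 2) * if Odd n then S.z * S.w else 1 := by
  rw [qL, edgesI, List.map_append, List.prod_append, map_flatMap_prod]
  simp only [qL_U]
  congr 1
  · simp
  · split_ifs <;> simp [edgesF]

theorem qJ {F : Type*} [Field F] {n : ℕ} (hn : 1 ≤ n) (S : TensorParams F) :
    qL (edgesJ hn S) = S.x * S.y * (S.a * S.b * S.c * S.d) ^ ((n - 1) / 2) *
      if Even n then S.z * S.w else 1 := by
  rw [qL, edgesJ, List.map_append, List.prod_append, List.map_append, List.prod_append,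
    map_flatMap_prod]
  simp only [qL_U]
  congr 1
  · simp [edgesE]
  · split_ifs <;> simp [edgesF]

theorem kappa_eq {F : Type*} [Field F] {n : ℕ} (hn : 1 ≤ n) {S : TensorParams F}
    {P : BlobParams F} (h : Compatible n S P) :
    (qL (edgesJ hn S) : F) / qL (edgesI hn S) + 2 + (qL (edgesI hn S) : F) / qL (edgesJ hn S) =
      P.κ := by
  have ha := S.a.ne_zero
  have hb := S.b.ne_zero
  have hc := S.c.ne_zero
  have hd := S.d.ne_zero
  have hx := S.x.ne_zero
  have hy := S.y.ne_zero
  have hz := S.z.ne_zero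
  have hw := S.w.ne_zero
  rw [h.κ, qI, qJ]
  rcases Nat.even_or_odd n with ho | ho
  · have h1 : ¬ Odd n := by simpa using ho
    obtain ⟨m, hm⟩ : ∃ m, n / 2 = m + 1 := ⟨n / 2 - 1, by obtain ⟨k, rfl⟩ := ho; omega⟩
    have hm' : (n - 1) / 2 = m := by obtain ⟨k, rfl⟩ := ho; omega
    rw [if_neg h1, if_pos ho, if_neg h1, hm, hm']
    push_cast
    generalize hT : (S.a * S.b * S.c * S.d : F) = T
    have hT0 : T ≠ 0 := by rw [← hT]; simp
    field_simp
    ring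
  · have h1 : ¬ Even n := by simpa using ho
    have hm' : (n - 1) / 2 = n / 2 := by obtain ⟨k, rfl⟩ := ho; omega
    rw [if_pos ho, if_neg h1, if_pos ho, hm']
    push_cast
    generalize hT : (S.a * S.b * S.c * S.d : F) = T
    have hT0 : T ≠ 0 := by rw [← hT]; simp
    field_simp

end relations

section relations

theorem genr_relations {F : Type*} [Field F] {n : ℕ} (hn : 1 ≤ n) {S : TensorParams F}
    {P : BlobParams F} (h : Compatible n S P) : Relations P (genr hn S) := by
  constructor
  · intro i hi
    simp only [genr]
    rw [quad_mul (t_comm hn _ _ (by omega)) (t_comm hn _ _ (by omega)) (t_comm hn _ _ (by omega))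
      (t_comm hn _ _ (by omega)) (t_comm hn _ _ (by omega)) (t_comm hn _ _ (by omega)),
      r_sq, r_sq, r_sq, r_sq, h.δ]
    simp only [smul_mul_assoc, mul_smul_comm, smul_smul]
    congr 1; ring
  · intro i j hi hj hij
    simp only [genr]
    have c : ∀ q q' : Fˣ, ∀ z z' : ℤ, (-2 * (n : ℤ) + 1 ≤ z ∧ z ≤ 2 * (n : ℤ) ∧
        -2 * (n : ℤ) + 1 ≤ z' ∧ z' ≤ 2 * (n : ℤ) ∧
        ((z + 2 ≤ z' ∧ z' ≤ z + 4 * n - 2) ∨ (z' + 2 ≤ z ∧ z ≤ z' + 4 * n - 2))) →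
        Commute (r q (posOf hn z)) (r q' (posOf hn z')) := fun q q' z z' => t_comm hn q q'
    rw [quad_mul (c _ _ _ _ (by omega)) (c _ _ _ _ (by omega)) (c _ _ _ _ (by omega))
      (c _ _ _ _ (by omega)) (c _ _ _ _ (by omega)) (c _ _ _ _ (by omega)),
      quad_mul ((c _ _ _ _ (by omega)).mul_left (c _ _ _ _ (by omega)))
        ((c _ _ _ _ (by omega)).mul_left (c _ _ _ _ (by omega)))
        ((c _ _ _ _ (by omega)).mul_left (c _ _ _ _ (by omega)))
        ((c _ _ _ _ (by omega)).mul_left (c _ _ _ _ (by omega)))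
        ((c _ _ _ _ (by omega)).mul_left (c _ _ _ _ (by omega)))
        ((c _ _ _ _ (by omega)).mul_left (c _ _ _ _ (by omega))),
      t_tl hn _ (by omega) (by omega), t_tl hn _ (by omega) (by omega),
      t_tl hn _ (by omega) (by omega), t_tl hn _ (by omega) (by omega)]
  · intro i j hi hj hij
    by_cases hne : i = j
    · subst hne; rfl
    simp only [genr]
    have c : ∀ q q' : Fˣ, ∀ z z' : ℤ, (-2 * (n : ℤ) + 1 ≤ z ∧ z ≤ 2 * (n : ℤ) ∧
        -2 * (n : ℤ) + 1 ≤ z' ∧ z' ≤ 2 * (n : ℤ) ∧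
        ((z + 2 ≤ z' ∧ z' ≤ z + 4 * n - 2) ∨ (z' + 2 ≤ z ∧ z ≤ z' + 4 * n - 2))) →
        Commute (r q (posOf hn z)) (r q' (posOf hn z')) := fun q q' z z' => t_comm hn q q'
    have c4 : ∀ q z, (-2 * (n : ℤ) + 1 ≤ z ∧ z ≤ 2 * (n : ℤ)) →
        (z = -n - j ∨ z = -n + j ∨ z = n - j ∨ z = n + j) →
        Commute (r S.a (posOf hn (-n - i)) * r S.b (posOf hn (-n + i)) *
          r S.c (posOf hn (n - i)) * r S.d (posOf hn (n + i))) (r q (posOf hn z)) := by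
      intro q z _ hz
      exact (((c _ _ _ _ (by omega)).mul_left (c _ _ _ _ (by omega))).mul_left
        (c _ _ _ _ (by omega))).mul_left (c _ _ _ _ (by omega))
    exact ((((c4 _ _ (by omega) (by omega)).mul_right (c4 _ _ (by omega) (by omega))).mul_right
      (c4 _ _ (by omega) (by omega))).mul_right (c4 _ _ (by omega) (by omega))).eq
  · intro _
    simp only [genr]
    have c : Commute (r S.y (posOf hn n)) (r S.x (posOf hn (-n))) := t_comm hn _ _ (by omega)
    rw [mul_assoc, ← mul_assoc (r S.y _), c.eq, mul_assoc, ← mul_assoc, r_sq, r_sq, h.δL]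
    simp only [smul_mul_assoc, mul_smul_comm, smul_smul]
    congr 1; ring
  · intro _
    simp only [genr]
    have c : Commute (r S.w (posOf hn (2 * n))) (r S.z (posOf hn 0)) := t_comm hn _ _ (by omega)
    rw [mul_assoc, ← mul_assoc (r S.w _), c.eq, mul_assoc, ← mul_assoc, r_sq, r_sq, h.δR]
    simp only [smul_mul_assoc, mul_smul_comm, smul_smul]
    congr 1; ring
  · intro _ h1
    simp only [genr]
    have c : ∀ q q' : Fˣ, ∀ z z' : ℤ, (-2 * (n : ℤ) + 1 ≤ z ∧ z ≤ 2 * (n : ℤ) ∧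
        -2 * (n : ℤ) + 1 ≤ z' ∧ z' ≤ 2 * (n : ℤ) ∧
        ((z + 2 ≤ z' ∧ z' ≤ z + 4 * n - 2) ∨ (z' + 2 ≤ z ∧ z ≤ z' + 4 * n - 2))) →
        Commute (r q (posOf hn z)) (r q' (posOf hn z')) := fun q q' z z' => t_comm hn q q'
    push_cast
    rw [mul_assoc (_ * _) (r S.c _) (r S.d _),
      pair_mul ((c _ _ _ _ (by omega)).mul_left (c _ _ _ _ (by omega)))
        (((c _ _ _ _ (by omega)).mul_left (c _ _ _ _ (by omega))).mul_right
          ((c _ _ _ _ (by omega)).mul_left (c _ _ _ _ (by omega))))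
        ((c _ _ _ _ (by omega)).mul_right (c _ _ _ _ (by omega))),
      t_kappa hn S.a S.b S.x (by omega) (by omega) (by rw [if_neg (by omega)]; omega)
        (by rw [if_neg (by omega)]),
      t_kappa hn S.c S.d S.y (by omega) (by omega) (by rw [if_neg (by omega)]; omega)
        (by rw [if_neg (by omega)]), h.κL]
    simp only [smul_mul_assoc, mul_smul_comm, smul_smul]
    congr 1; ring
  · intro _ h1
    simp only [genr]
    have c : ∀ q q' : Fˣ, ∀ z z' : ℤ, (-2 * (n : ℤ) + 1 ≤ z ∧ z ≤ 2 * (n : ℤ) ∧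
        -2 * (n : ℤ) + 1 ≤ z' ∧ z' ≤ 2 * (n : ℤ) ∧
        ((z + 2 ≤ z' ∧ z' ≤ z + 4 * n - 2) ∨ (z' + 2 ≤ z ∧ z ≤ z' + 4 * n - 2))) →
        Commute (r q (posOf hn z)) (r q' (posOf hn z')) := fun q q' z z' => t_comm hn q q'
    have e1 : (-(n : ℤ) - ((n - 1 : ℕ) : ℤ)) = -2 * n + 1 := by omega
    have e2 : (-(n : ℤ) + ((n - 1 : ℕ) : ℤ)) = -1 := by omega
    have e3 : ((n : ℤ) - ((n - 1 : ℕ) : ℤ)) = 1 := by omega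
    have e4 : ((n : ℤ) + ((n - 1 : ℕ) : ℤ)) = 2 * n - 1 := by omega
    rw [e1, e2, e3, e4]
    have e5 : r S.a (posOf hn (-2 * n + 1)) * r S.b (posOf hn (-1)) * r S.c (posOf hn 1) *
        r S.d (posOf hn (2 * n - 1)) = (r S.b (posOf hn (-1)) * r S.c (posOf hn 1)) *
        (r S.d (posOf hn (2 * n - 1)) * r S.a (posOf hn (-2 * n + 1))) := by
      have d1 : Commute (r S.a (posOf hn (-2 * n + 1)))
          (r S.b (posOf hn (-1)) * r S.c (posOf hn 1)) :=
        (c _ _ _ _ (by omega)).mul_right (c _ _ _ _ (by omega))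
      have d2 : Commute (r S.a (posOf hn (-2 * n + 1))) (r S.d (posOf hn (2 * n - 1))) :=
        c _ _ _ _ (by omega)
      rw [mul_assoc (r S.a _), d1.eq, mul_assoc, d2.eq]
    rw [e5,
      pair_mul ((c _ _ _ _ (by omega)).mul_left (c _ _ _ _ (by omega)))
        (((c _ _ _ _ (by omega)).mul_left (c _ _ _ _ (by omega))).mul_right
          ((c _ _ _ _ (by omega)).mul_left (c _ _ _ _ (by omega))))
        ((c _ _ _ _ (by omega)).mul_right (c _ _ _ _ (by omega))),
      t_kappa hn S.b S.c S.z (by omega) (by omega) (by rw [if_neg (by omega)]; omega)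
        (by rw [if_neg (by omega)]; omega),
      t_kappa hn S.d S.a S.w (by omega) (by omega) (by rw [if_neg (by omega)]; omega)
        (by rw [if_pos]; rfl), h.κR, mul_comm S.d S.a]
    simp only [smul_mul_assoc, mul_smul_comm, smul_smul]
  · intro _ i hi h1
    simp only [genr]
    have c : ∀ q q' : Fˣ, ∀ z z' : ℤ, (-2 * (n : ℤ) + 1 ≤ z ∧ z ≤ 2 * (n : ℤ) ∧
        -2 * (n : ℤ) + 1 ≤ z' ∧ z' ≤ 2 * (n : ℤ) ∧
        ((z + 2 ≤ z' ∧ z' ≤ z + 4 * n - 2) ∨ (z' + 2 ≤ z ∧ z ≤ z' + 4 * n - 2))) →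
        Commute (r q (posOf hn z)) (r q' (posOf hn z')) := fun q q' z z' => t_comm hn q q'
    exact ((((c _ _ _ _ (by omega)).mul_left (c _ _ _ _ (by omega))).mul_right
      ((c _ _ _ _ (by omega)).mul_left (c _ _ _ _ (by omega)))).mul_right
      ((c _ _ _ _ (by omega)).mul_left (c _ _ _ _ (by omega)))).mul_right
      ((c _ _ _ _ (by omega)).mul_left (c _ _ _ _ (by omega)))
  · intro _ i hi h1
    simp only [genr]
    have c : ∀ q q' : Fˣ, ∀ z z' : ℤ, (-2 * (n : ℤ) + 1 ≤ z ∧ z ≤ 2 * (n : ℤ) ∧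
        -2 * (n : ℤ) + 1 ≤ z' ∧ z' ≤ 2 * (n : ℤ) ∧
        ((z + 2 ≤ z' ∧ z' ≤ z + 4 * n - 2) ∨ (z' + 2 ≤ z ∧ z ≤ z' + 4 * n - 2))) →
        Commute (r q (posOf hn z)) (r q' (posOf hn z')) := fun q q' z z' => t_comm hn q q'
    exact ((((c _ _ _ _ (by omega)).mul_left (c _ _ _ _ (by omega))).mul_right
      ((c _ _ _ _ (by omega)).mul_left (c _ _ _ _ (by omega)))).mul_right
      ((c _ _ _ _ (by omega)).mul_left (c _ _ _ _ (by omega)))).mul_right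
      ((c _ _ _ _ (by omega)).mul_left (c _ _ _ _ (by omega)))
  · intro _ h1
    simp only [genr]
    exact ((t_comm hn _ _ (by omega)).mul_left (t_comm hn _ _ (by omega))).mul_right
      ((t_comm hn _ _ (by omega)).mul_left (t_comm hn _ _ (by omega)))
  · intro h'
    rw [opI, opJ, opL_long hn (by omega) (matchI hn S) (matchJ hn S), kappa_eq hn h]
  · intro h'
    rw [opI, opJ, opL_long hn (by omega) (matchJ hn S) (matchI hn S), ← kappa_eq hn h]
    congr 1; ring

theorem relations_of_injective {F : Type*} [Field F] {n : ℕ} {P : BlobParams F} {A B : Type*}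
    [Ring A] [Algebra F A] [Ring B] [Algebra F B] (φ : A →ₐ[F] B) (hφ : Function.Injective φ)
    {g : Gen n → A} (h : Relations P fun x => φ (g x)) : Relations P g := by
  have hI : φ (wordI g) = wordI fun x => φ (g x) := map_wordI (φ : A →* B) g
  have hJ : ∀ h, φ (wordJ h g) = wordJ h fun x => φ (g x) := fun h => map_wordJ h (φ : A →* B) g
  constructor
  · intro i hi; apply hφ; simpa only [map_mul, map_smul] using h.U_sq i hi
  · intro i j hi hj hij; apply hφ; simpa only [map_mul] using h.UUU i j hi hj hij
  · intro i j hi hj hij; apply hφ; simpa only [map_mul] using h.UU i j hi hj hij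
  · intro hn; apply hφ; simpa only [map_mul, map_smul] using h.e_sq hn
  · intro hn; apply hφ; simpa only [map_mul, map_smul] using h.f_sq hn
  · intro hn h1; apply hφ; simpa only [map_mul, map_smul] using h.UeU hn h1
  · intro hn h1; apply hφ; simpa only [map_mul, map_smul] using h.UfU hn h1
  · intro hn i hi h1; apply hφ; simpa only [map_mul] using h.eU hn i hi h1
  · intro hn i hi h1; apply hφ; simpa only [map_mul] using h.fU hn i hi h1
  · intro hn h1; apply hφ; simpa only [map_mul] using h.ef hn h1
  · intro hn; apply hφ; rw [map_mul, map_mul, map_smul, hI, hJ]; exact h.IJI hn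
  · intro hn; apply hφ; rw [map_mul, map_mul, map_smul, hI, hJ]; exact h.JIJ hn

theorem genOp_relations {F : Type*} [Field F] {n : ℕ} {S : TensorParams F} {P : BlobParams F}
    (h : Compatible n S P) : Relations P (genOp (n := n) S) := by
  rcases Nat.eq_zero_or_pos n with rfl | hn
  · constructor <;> intros <;> omega
  let φ := (wordBasis F n).equivFun.conjAlgEquiv F
  have hR : ∀ (q : Fˣ) (z : ℤ) hz, φ (R q ⟨z, hz⟩) = r q (posOf hn z) := by
    intro q z hz
    rw [posOf_eq hn hz]
    refine LinearMap.ext fun ψ => ?_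
    change (wordBasis F n).equivFun (R q _ ((wordBasis F n).equivFun.symm ψ)) = _
    rw [repr_R, LinearEquiv.apply_symm_apply]
  apply relations_of_injective φ.toAlgHom φ.injective
  have : (fun x => φ.toAlgHom (genOp S x)) = genr hn S := by
    funext x
    change φ (genOp S x) = _
    cases x <;> simp only [genOp, genr, map_mul, hR]
  rw [this]
  exact genr_relations hn h

end relations

/-- The representation of `b'_n(Π)` on the tensor space. -/
noncomputable def tensorRep {F : Type*} [Field F] {n : ℕ} {S : TensorParams F} {P : BlobParams F}
    (h : Compatible n S P) : Blob F n P →ₐ[F] Module.End F (TensorSpace F n) :=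
  Blob.lift (genOp S) (genOp_relations h)

/-- The tensor space module `V(n; Σ)`. -/
def TensorModule {F : Type*} [Field F] {n : ℕ} {S : TensorParams F} {P : BlobParams F}
    (_h : Compatible n S P) : Type _ := TensorSpace F n

noncomputable instance TensorModule.addCommGroup {F : Type*} [Field F] {n : ℕ}
    {S : TensorParams F} {P : BlobParams F} (h : Compatible n S P) :
    AddCommGroup (TensorModule h) :=
  inferInstanceAs (AddCommGroup (TensorSpace F n))

/-- `V(n; Σ)` as a `b'_n(Π)`-module. -/
noncomputable instance TensorModule.module {F : Type*} [Field F] {n : ℕ} {S : TensorParams F}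
    {P : BlobParams F} (h : Compatible n S P) : Module (Blob F n P) (TensorModule h) :=
  Module.compHom (TensorSpace F n) (tensorRep h).toRingHom

/-- A tensor, seen in `V(n; Σ)`. -/
def TensorModule.of {F : Type*} [Field F] {n : ℕ} {S : TensorParams F} {P : BlobParams F}
    (h : Compatible n S P) (v : TensorSpace F n) : TensorModule h := v

/-- Reads a word of length `4n` at the position `z` (used only for labels in the range). -/
noncomputable def letter {n : ℕ} (α : Pos n → Fin 2) (z : ℤ) : Fin 2 :=
  if h : z ∈ Finset.Icc (-2 * (n : ℤ) + 1) (2 * (n : ℤ)) then α ⟨z, h⟩ else 0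

/-- With `N = n + 1`: the word `α_{-2n+1} ⋯ α_{-n} s s' α_{-n+1} ⋯ α_n t t' α_{n+1} ⋯ α_{2n}` of
length `4N`, in which `s s'` stand at the positions `-N, -N+1` and `t t'` at `N, N+1`. -/
noncomputable def insE {n : ℕ} (α : Pos n → Fin 2) (s s' t t' : Fin 2) : Pos (n + 1) → Fin 2 := fun p =>
  if p.1 < -(n + 1) then letter α (p.1 + 2)
  else if p.1 = -(n + 1) then s
  else if p.1 = -n then s'
  else if p.1 ≤ n then letter α p.1
  else if p.1 = n + 1 then t
  else if p.1 = n + 2 then t'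
  else letter α (p.1 - 2)

/-- With `N = n + 1`: the word `t' α_{-2n+1} ⋯ α_0 s s' α_1 ⋯ α_{2n} t` of length `4N`, in which
`s s'` stand at the positions `0, 1` and `t t'` at the cyclically adjacent positions
`2N, -2N+1`. -/
noncomputable def insF {n : ℕ} (α : Pos n → Fin 2) (s s' t t' : Fin 2) : Pos (n + 1) → Fin 2 := fun p =>
  if p.1 = -(2 * n + 1) then t'
  else if p.1 < 0 then letter α (p.1 + 1)
  else if p.1 = 0 then s
  else if p.1 = 1 then s'
  else if p.1 ≤ 2 * n + 1 then letter α (p.1 - 1)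
  else t

/-- The tensor obtained from the word `α` by inserting `x·12 + 21` at the positions `-N, -N+1` and
`y·12 + 21` at the positions `N, N+1`, where `N = n + 1`. -/
noncomputable def insertE {F : Type*} [Field F] {n : ℕ} (x y : Fˣ) (α : Pos n → Fin 2) :
    TensorSpace F (n + 1) :=
  (x * y : F) • word F (insE α 0 1 0 1) + (x : F) • word F (insE α 0 1 1 0) +
    (y : F) • word F (insE α 1 0 0 1) + word F (insE α 1 0 1 0)

/-- The tensor obtained from the word `α` by inserting `z·12 + 21` at the positions `0, 1` and
`w·12 + 21` at the cyclically adjacent positions `2N, -2N+1`, where `N = n + 1`. -/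
noncomputable def insertF {F : Type*} [Field F] {n : ℕ} (z w : Fˣ) (α : Pos n → Fin 2) :
    TensorSpace F (n + 1) :=
  (z * w : F) • word F (insF α 0 1 0 1) + (z : F) • word F (insF α 0 1 1 0) +
    (w : F) • word F (insF α 1 0 0 1) + word F (insF α 1 0 1 0)

end SympBlob

open SympBlob

namespace SympBlob

/-! Every `R^q` is a covector followed by a vector: the covector takes 12 to 1, 21 to `q⁻¹` and the
other two words to 0, and the vector is `q·12 + 21`. Hence `e`, which applies `R^x` and `R^y` to two
disjoint pairs of neighbouring positions, maps into the tensors that carry `x·12 + 21` and `y·12 +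
21` there, with an arbitrary tensor in the other positions. On such tensors it acts by `[2]_x [2]_y
= δ_L`, so that `ē` is a projection onto them. The insertion map is therefore a linear bijection
onto `ē V`; it is injective because 21 has coefficient 1 in each inserted vector. The same holds for
`f`, with `z`, `w` and `δ_R`.

What remains is equivariance, and it suffices to check the generators of the smaller algebra. All
but one of them act at pairs of positions between which nothing is inserted, and such operators
commute with the insertion (`Insertion.r_emb`). The exception is `e` on the left side and `f` on the
right side. The element `δ_L⁻¹ e U_1 e` acts on `ē V` as `e U_1`, and here the heart of the matter
is `Insertion.r_bridge_i`, an identity on four consecutive positions whose middle two carry `x·12 +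
21`. The covectors of `R^a` and `R^b`, applied to the inserted vector in the middle, leave the
covector with parameter `ab/x` on the outer two positions; the covector of `R^x`, applied to the
middle of the vectors of `R^a` and `R^b`, leaves the vector with parameter `ab/x` there. So `R^x R^a
R^b` becomes `R^{ab/x}` on the shorter word. This is where `Σ_L` and `Σ_R` come from.

The computations take place in functions on words, where `repr_R` replaces `R` by `r`. Both sides
are instances of one notion, `Insertion`, of which only the incidence of positions is used; the
cyclic seam between `2N` and `-2N+1` is then a pair like any other. Throughout, `n` is the smaller
index and `N = n + 1` the larger one. -/

/-! ### Compatibility of the localised parameters -/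

/-- The substitution `x ↦ ab/x`, `y ↦ cd/y` is an involution, so it exchanges `δ_L` and `κ_L`. It
replaces `xy` by `abcd/(xy)` and thereby turns one formula for `κ` into the other, which matches the
change of parity from `n + 1` to `n`. -/
theorem Compatible.left {F : Type*} [Field F] {n : ℕ} {S : TensorParams F} {P : BlobParams F}
    (h : Compatible (n + 1) S P) : Compatible n S.left P.left where
  δ := h.δ
  δL := h.κL
  δR := h.δR
  κL := by simp [BlobParams.left, TensorParams.left, h.δL]
  κR := h.κR
  κ := by
    have hx := S.x.ne_zero
    have hy := S.y.ne_zero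
    simp only [BlobParams.left, TensorParams.left, h.κ, Nat.odd_add_one, Units.val_div_eq_div_val,
      Units.val_mul]
    by_cases ho : Odd n
    · rw [if_neg (not_not.2 ho), if_pos ho]
      field_simp
    · rw [if_pos ho, if_neg ho]
      field_simp

/-- As on the left, with `zw` replaced by `abcd/(zw)`. The two formulas for `κ` now match only after
their outer summands are exchanged. -/
theorem Compatible.right {F : Type*} [Field F] {n : ℕ} {S : TensorParams F} {P : BlobParams F}
    (h : Compatible (n + 1) S P) : Compatible n S.right P.right where
  δ := h.δ
  δL := h.δL
  -- `κ_R` names its `w`-factor first, whereas `δ_R` names its `z`-factor first.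
  δR := h.κR.trans (mul_comm _ _)
  κL := h.κL
  κR := by simp [BlobParams.right, TensorParams.right, h.δR, mul_comm]
  κ := by
    have hz := S.z.ne_zero
    have hw := S.w.ne_zero
    simp only [BlobParams.right, TensorParams.right, h.κ, Nat.odd_add_one, Units.val_div_eq_div_val,
      Units.val_mul]
    by_cases ho : Odd n
    · rw [if_neg (not_not.2 ho), if_pos ho]
      field_simp
      ring
    · rw [if_pos ho, if_neg ho]
      field_simp
      ring

/-! ### Insertion of two pairs of letters: the incidence data -/

/-- The insertion of two pairs of cyclically adjacent letters, at `i, i.next` and `j, j.next`,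
into words; `emb` is the resulting map of positions. -/
structure Insertion (n : ℕ) where
  emb : Pos n → Pos (n + 1)
  i : Pos (n + 1)
  j : Pos (n + 1)
  ins : (Pos n → Fin 2) → Fin 2 → Fin 2 → Fin 2 → Fin 2 → Pos (n + 1) → Fin 2
  emb_inj : Function.Injective emb
  emb_ne_i : ∀ p, emb p ≠ i
  emb_ne_i_next : ∀ p, emb p ≠ i.next
  emb_ne_j : ∀ p, emb p ≠ j
  emb_ne_j_next : ∀ p, emb p ≠ j.next
  i_ne_j : i ≠ j
  i_ne_j_next : i ≠ j.next
  j_ne_i_next : j ≠ i.next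
  cover : ∀ p, p = i ∨ p = i.next ∨ p = j ∨ p = j.next ∨ ∃ k, p = emb k
  ins_emb : ∀ α s s' t t' p, ins α s s' t t' (emb p) = α p
  ins_i : ∀ α s s' t t', ins α s s' t t' i = s
  ins_i_next : ∀ α s s' t t', ins α s s' t t' i.next = s'
  ins_j : ∀ α s s' t t', ins α s s' t t' j = t
  ins_j_next : ∀ α s s' t t', ins α s s' t t' j.next = t'

namespace Insertion

variable {F : Type*} [Field F] {n : ℕ} (I : Insertion n)

/-- The insertion with its two pairs exchanged. -/
def swap : Insertion n where
  emb := I.emb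
  i := I.j
  j := I.i
  ins α s s' t t' := I.ins α t t' s s'
  emb_inj := I.emb_inj
  emb_ne_i := I.emb_ne_j
  emb_ne_i_next := I.emb_ne_j_next
  emb_ne_j := I.emb_ne_i
  emb_ne_j_next := I.emb_ne_i_next
  i_ne_j := I.i_ne_j.symm
  i_ne_j_next := I.j_ne_i_next
  j_ne_i_next := I.i_ne_j_next
  cover p := by have := I.cover p; tauto
  ins_emb α s s' t t' := I.ins_emb α t t' s s'
  ins_i α s s' t t' := I.ins_j α t t' s s'
  ins_i_next α s s' t t' := I.ins_j_next α t t' s s'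
  ins_j α s s' t t' := I.ins_i α t t' s s'
  ins_j_next α s s' t t' := I.ins_i_next α t t' s s'

/-- The insertion of `x·12 + 21` at `i, i.next` and of `y·12 + 21` at `j, j.next`,
in coordinates. -/
def op (x y : Fˣ) : ((Pos n → Fin 2) → F) →ₗ[F] (Pos (n + 1) → Fin 2) → F where
  toFun ψ β := cupw x (β I.i) (β I.i.next) * cupw y (β I.j) (β I.j.next) * ψ (β ∘ I.emb)
  map_add' ψ φ := by ext β; simp; ring
  map_smul' c ψ := by ext β; simp; ring

theorem op_apply (x y : Fˣ) (ψ : (Pos n → Fin 2) → F) (β : Pos (n + 1) → Fin 2) :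
    I.op x y ψ β =
      cupw x (β I.i) (β I.i.next) * cupw y (β I.j) (β I.j.next) * ψ (β ∘ I.emb) := rfl

/-- By this symmetry every fact about the pair at `i` yields the one about the pair at `j`. -/
theorem op_swap (x y : Fˣ) : I.swap.op y x = I.op x y := by
  refine LinearMap.ext fun ψ => funext fun β => ?_
  simp only [op_apply, swap]
  ring

theorem i_next_ne_j_next : I.i.next ≠ I.j.next := fun h => I.i_ne_j (next_inj h)

theorem ext_word {β γ : Pos (n + 1) → Fin 2} (h0 : β I.i = γ I.i) (h1 : β I.i.next = γ I.i.next)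
    (h2 : β I.j = γ I.j) (h3 : β I.j.next = γ I.j.next) (h : β ∘ I.emb = γ ∘ I.emb) : β = γ := by
  funext p
  rcases I.cover p with rfl | rfl | rfl | rfl | ⟨k, rfl⟩
  · exact h0
  · exact h1
  · exact h2
  · exact h3
  · exact congrFun h k

theorem ins_comp_emb (α : Pos n → Fin 2) (s s' t t' : Fin 2) : I.ins α s s' t t' ∘ I.emb = α :=
  funext fun p => I.ins_emb α s s' t t' p

theorem put_i_comp_emb (β : Pos (n + 1) → Fin 2) (s t : Fin 2) :
    put β I.i s t ∘ I.emb = β ∘ I.emb :=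
  funext fun p => put_other _ _ _ (I.emb_ne_i p) (I.emb_ne_i_next p)

/-! ### Action of the operators on inserted vectors -/

/-- The covector of `R^x` takes the value `x + x⁻¹` on `x·12 + 21`. -/
theorem r_i (x y : Fˣ) (ψ : (Pos n → Fin 2) → F) :
    r x I.i (I.op x y ψ) = two x • I.op x y ψ := by
  funext β
  simp only [r_apply, op_apply, Pi.smul_apply, smul_eq_mul, put_left, put_right,
    put_i_comp_emb, put_other _ _ _ I.i_ne_j.symm I.j_ne_i_next,
    put_other _ _ _ I.i_ne_j_next.symm I.i_next_ne_j_next.symm, two]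
  simp only [cupw, if_neg (zero_ne_one' (Fin 2)), if_neg (zero_ne_one' (Fin 2)).symm, if_true,
    one_mul]
  field_simp

theorem r_j (x y : Fˣ) (ψ : (Pos n → Fin 2) → F) :
    r y I.j (I.op x y ψ) = two y • I.op x y ψ := by
  rw [← op_swap]
  exact I.swap.r_i y x ψ

/-- The hypothesis `h` says that nothing is inserted between `p` and its successor. The operator
then reads and writes old letters only, and the weights of the inserted pairs are not affected. -/
theorem r_emb (x y q : Fˣ) {p : Pos n} (h : I.emb p.next = (I.emb p).next)
    (ψ : (Pos n → Fin 2) → F) : r q (I.emb p) (I.op x y ψ) = I.op x y (r q p ψ) := by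
  have hc : ∀ (β : Pos (n + 1) → Fin 2) s t, put β (I.emb p) s t ∘ I.emb = put (β ∘ I.emb) p s t := by
    intro β s t
    funext k
    by_cases h0 : k = p
    · subst h0; rw [Function.comp_apply, put_left, put_left]
    · by_cases h1 : k = p.next
      · subst h1; rw [Function.comp_apply, h, put_right, put_right]
      · rw [Function.comp_apply, put_other _ _ _ h0 h1, put_other _ _ _ (I.emb_inj.ne h0)
          (by rw [← h]; exact I.emb_inj.ne h1), Function.comp_apply]
  funext β
  simp only [r_apply, op_apply, hc, put_other _ _ _ (I.emb_ne_i p).symm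
      (by rw [← h]; exact (I.emb_ne_i _).symm), put_other _ _ _ (I.emb_ne_i_next p).symm
      (by rw [← h]; exact (I.emb_ne_i_next _).symm), put_other _ _ _ (I.emb_ne_j p).symm
      (by rw [← h]; exact (I.emb_ne_j _).symm), put_other _ _ _ (I.emb_ne_j_next p).symm
      (by rw [← h]; exact (I.emb_ne_j_next _).symm), Function.comp_apply, h]
  ring

/-- The hypotheses place the inserted pair between `p` and its successor, so that the four positions
involved are consecutive. Two contractions produce the parameter. The covectors of `a` and `b`, with
`x·12 + 21` in the middle, give 1 on the outer letters 12 and `a⁻¹b⁻¹x` on 21. The covector of `x`,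
in the middle of the vectors of `a` and `b`, gives `ab·x⁻¹` on 12 and 1 on 21. These are the
covector and the vector of `R^{ab/x}`, and the last operator leaves its vector `x·12 + 21` in the
middle again. -/
theorem r_bridge_i (x y a b : Fˣ) {p : Pos n} (h1 : (I.emb p).next = I.i)
    (h2 : I.i.next.next = I.emb p.next) (ψ : (Pos n → Fin 2) → F) :
    r x I.i (r a (I.emb p) (r b I.i.next (I.op x y ψ))) = I.op x y (r (a * b / x) p ψ) := by
  -- In the four-letter block the outer letters `s`, `v` are old and become neighbours once the
  -- inserted letters `t`, `u` are removed.
  have hc : ∀ (β : Pos (n + 1) → Fin 2) s t u v,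
      ow β (I.emb p) s t u v ∘ I.emb = put (β ∘ I.emb) p s v := by
    intro β s t u v
    funext k
    by_cases h0 : k = p
    · subst h0; rw [Function.comp_apply, ow_0, put_left]
    · by_cases h3 : k = p.next
      · subst h3; rw [Function.comp_apply, put_right, ← h2, ← h1, ow_3]
      · rw [Function.comp_apply, put_other _ _ _ h0 h3, ow_other _ _ _ _ _ _ (I.emb_inj.ne h0)
          (by rw [h1]; exact I.emb_ne_i k) (by rw [h1]; exact I.emb_ne_i_next k)
          (by rw [h1, h2]; exact I.emb_inj.ne h3), Function.comp_apply]
  -- The pair at `j` lies outside the block, so its weight is a common factor and plays no part in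
  -- the computation.
  have ho : ∀ (β : Pos (n + 1) → Fin 2) s t u v φ, I.op x y φ (ow β (I.emb p) s t u v) =
      cupw x t u * cupw y (β I.j) (β I.j.next) * φ (put (β ∘ I.emb) p s v) := by
    intro β s t u v φ
    have e1 : ow β (I.emb p) s t u v I.i = t := by rw [← h1, ow_1]
    have e2 : ow β (I.emb p) s t u v I.i.next = u := by rw [← h1, ow_2]
    rw [op_apply, hc, e1, e2, ow_other _ _ _ _ _ _ (I.emb_ne_j p).symm
      (by rw [h1]; exact I.i_ne_j.symm) (by rw [h1]; exact I.j_ne_i_next)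
      (by rw [h1, h2]; exact (I.emb_ne_j _).symm), ow_other _ _ _ _ _ _ (I.emb_ne_j_next p).symm
      (by rw [h1]; exact I.i_ne_j_next.symm) (by rw [h1]; exact I.i_next_ne_j_next.symm)
      (by rw [h1, h2]; exact (I.emb_ne_j_next _).symm)]
  funext β
  rw [ow_self β (I.emb p), ho]
  generalize β (I.emb p) = s, β (I.emb p).next = t, β (I.emb p).next.next = u,
    β (I.emb p).next.next.next = v
  rw [← h1]
  have hr : ∀ β s v, r (a * b / x) p ψ (put β p s v) = cupw (a * b / x) s v *
      (ψ (put β p 0 1) + ((a * b / x)⁻¹ : Fˣ) * ψ (put β p 1 0)) := by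
    intro β s v
    rw [r_apply, put_left, put_right, put_put, put_put]
  simp only [r_ow_0, r_ow_1, r_ow_2, ho, hr]
  -- Only the four letters of the block and two values of `ψ` are left; the sixteen cases are
  -- identities between monomials in `a`, `b`, `x`.
  generalize cupw y (β I.j) (β I.j.next) = K, ψ (put (β ∘ I.emb) p 0 1) = A,
    ψ (put (β ∘ I.emb) p 1 0) = B
  rcases fin2 s with rfl | rfl <;> rcases fin2 t with rfl | rfl <;> rcases fin2 u with rfl | rfl <;>
  rcases fin2 v with rfl | rfl <;>
  simp [cupw] <;> field_simp

theorem r_bridge_j (x y a b : Fˣ) {p : Pos n} (h1 : (I.emb p).next = I.j)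
    (h2 : I.j.next.next = I.emb p.next) (ψ : (Pos n → Fin 2) → F) :
    r y I.j (r a (I.emb p) (r b I.j.next (I.op x y ψ))) = I.op x y (r (a * b / y) p ψ) := by
  rw [← op_swap]
  exact I.swap.r_bridge_i y x a b h1 h2 ψ

/-! ### Injectivity and image of the insertion -/

theorem op_injective (x y : Fˣ) : Function.Injective (I.op x y : _ →ₗ[F] _) := by
  intro ψ φ h
  funext α
  -- The letters `1, 0` spell 21, which has coefficient 1 in both inserted vectors. The value at
  -- this word is therefore the coefficient of `α` itself.
  have := congrFun h (I.ins α 1 0 1 0)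
  simpa [op_apply, ins_i, ins_i_next, ins_j, ins_j_next, ins_comp_emb, cupw] using this

/-- Overwriting both pairs forgets what `β` had there. Hence the values read by the two covectors
depend on `β` only through its old letters. -/
theorem put_put_eq_ins (β : Pos (n + 1) → Fin 2) (s s' t t' : Fin 2) :
    put (put β I.i s s') I.j t t' = I.ins (β ∘ I.emb) s s' t t' := by
  apply I.ext_word
  · rw [ins_i, put_other _ _ _ I.i_ne_j I.i_ne_j_next, put_left]
  · rw [ins_i_next, put_other _ _ _ I.j_ne_i_next.symm I.i_next_ne_j_next, put_right]
  · rw [ins_j, put_left]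
  · rw [ins_j_next, put_right]
  · rw [ins_comp_emb, ← I.put_i_comp_emb β s s']
    exact I.swap.put_i_comp_emb _ t t'

/-- Each operator ends by writing its own vector, so the product for the two pairs always lands
among the inserted tensors. This gives surjectivity onto the cut module. -/
theorem exists_op_eq (x y : Fˣ) (φ : (Pos (n + 1) → Fin 2) → F) :
    ∃ ψ, r x I.i (r y I.j φ) = I.op x y ψ := by
  -- The preimage is `φ` contracted with the covectors of `R^x` and `R^y` at the two pairs.
  refine ⟨fun α => φ (I.ins α 0 1 0 1) + (y⁻¹ : Fˣ) * φ (I.ins α 0 1 1 0) +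
    (x⁻¹ : Fˣ) * (φ (I.ins α 1 0 0 1) + (y⁻¹ : Fˣ) * φ (I.ins α 1 0 1 0)), ?_⟩
  funext β
  simp only [r_apply, op_apply, put_put_eq_ins, put_other _ _ _ I.i_ne_j.symm I.j_ne_i_next,
    put_other _ _ _ I.i_ne_j_next.symm I.i_next_ne_j_next.symm]
  ring

/-- Connects the description by coefficients with the explicit sum of four words that the insertion
prescribes. -/
theorem op_single (x y : Fˣ) (α : Pos n → Fin 2) : I.op x y (Pi.single α 1) =
    (x * y : F) • Pi.single (I.ins α 0 1 0 1) 1 + (x : F) • Pi.single (I.ins α 0 1 1 0) 1 +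
      (y : F) • Pi.single (I.ins α 1 0 0 1) 1 + Pi.single (I.ins α 1 0 1 0) 1 := by
  funext β
  -- Each of the four basis functions on the right is an indicator. It is split into a condition on
  -- the old letters and one on the four inserted letters, which leaves finitely many cases.
  have key : ∀ s s' t t', β = I.ins α s s' t t' ↔
      (β ∘ I.emb = α ∧ β I.i = s ∧ β I.i.next = s' ∧ β I.j = t ∧ β I.j.next = t') := by
    intro s s' t t'
    constructor
    · rintro rfl
      exact ⟨I.ins_comp_emb .., I.ins_i .., I.ins_i_next .., I.ins_j .., I.ins_j_next ..⟩
    · rintro ⟨rfl, rfl, rfl, rfl, rfl⟩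
      rw [← put_put_eq_ins, put_self _ _ rfl rfl, put_self _ _ rfl rfl]
  simp only [op_apply, Pi.add_apply, Pi.smul_apply, smul_eq_mul, Pi.single_apply, key]
  by_cases h : β ∘ I.emb = α
  · rcases fin2 (β I.i) with h0 | h0 <;> rcases fin2 (β I.i.next) with h1 | h1 <;>
    rcases fin2 (β I.j) with h2 | h2 <;> rcases fin2 (β I.j.next) with h3 | h3 <;>
    simp [h, h0, h1, h2, h3, cupw]
  · simp [h]

/-! ### Transport from coordinates to tensors -/

/-- The insertion of `x·12 + 21` at `i, i.next` and of `y·12 + 21` at `j, j.next`. -/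
noncomputable def map (x y : Fˣ) : TensorSpace F n →ₗ[F] TensorSpace F (n + 1) :=
  (wordBasis F (n + 1)).equivFun.symm.toLinearMap ∘ₗ I.op x y ∘ₗ
    (wordBasis F n).equivFun.toLinearMap

theorem equivFun_map (x y : Fˣ) (v : TensorSpace F n) :
    (wordBasis F (n + 1)).equivFun (I.map x y v) = I.op x y ((wordBasis F n).equivFun v) :=
  LinearEquiv.apply_symm_apply _ _

theorem map_injective (x y : Fˣ) : Function.Injective (I.map (F := F) x y) :=
  (wordBasis F (n + 1)).equivFun.symm.injective.comp
    ((I.op_injective x y).comp (wordBasis F n).equivFun.injective)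

theorem equivFun_word {m : ℕ} (α : Pos m → Fin 2) :
    (wordBasis F m).equivFun (word F α) = Pi.single α 1 := by
  funext β
  rw [← wordBasis_apply, Module.Basis.equivFun_self, Pi.single_apply]
  simp only [eq_comm]

theorem map_word (x y : Fˣ) (α : Pos n → Fin 2) : I.map x y (word F α) =
    (x * y : F) • word F (I.ins α 0 1 0 1) + (x : F) • word F (I.ins α 0 1 1 0) +
      (y : F) • word F (I.ins α 1 0 0 1) + word F (I.ins α 1 0 1 0) := by
  apply (wordBasis F (n + 1)).equivFun.injective
  simp only [equivFun_map, equivFun_word, op_single, map_add, map_smul]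

end Insertion

theorem equivFun_genOp {F : Type*} [Field F] {n : ℕ} (hn : 1 ≤ n) (S : TensorParams F) (x : Gen n)
    (v : TensorSpace F n) : (wordBasis F n).equivFun (genOp S x v) =
      genr hn S x ((wordBasis F n).equivFun v) := by
  cases x <;> simp only [genOp, genr, Module.End.mul_apply, repr_R, posOf_eq hn]

/-! ### The two concrete insertions -/

theorem letter_of_eq {n : ℕ} (α : Pos n → Fin 2) (p : Pos n) {z : ℤ} (h : z = p.1) :
    letter α z = α p := by
  subst h
  rw [letter, dif_pos p.2]

theorem embE_mem {n : ℕ} (p : Pos n) :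
    (if p.1 ≤ -(n : ℤ) then p.1 - 2 else if p.1 ≤ n then p.1 else p.1 + 2) ∈
      Finset.Icc (-2 * ((n + 1 : ℕ) : ℤ) + 1) (2 * ((n + 1 : ℕ) : ℤ)) := by
  have := Finset.mem_Icc.1 p.2
  rw [Finset.mem_Icc]
  split_ifs <;> omega

theorem embF_mem {n : ℕ} (p : Pos n) :
    (if p.1 ≤ 0 then p.1 - 1 else p.1 + 1) ∈
      Finset.Icc (-2 * ((n + 1 : ℕ) : ℤ) + 1) (2 * ((n + 1 : ℕ) : ℤ)) := by
  have := Finset.mem_Icc.1 p.2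
  rw [Finset.mem_Icc]
  split_ifs <;> omega

/-- The map of positions of `insE`. -/
def embE {n : ℕ} (p : Pos n) : Pos (n + 1) := ⟨_, embE_mem p⟩

/-- The map of positions of `insF`. -/
def embF {n : ℕ} (p : Pos n) : Pos (n + 1) := ⟨_, embF_mem p⟩

theorem embE_val {n : ℕ} (p : Pos n) : (embE p).1 =
    if p.1 ≤ -(n : ℤ) then p.1 - 2 else if p.1 ≤ n then p.1 else p.1 + 2 := rfl

theorem embF_val {n : ℕ} (p : Pos n) : (embF p).1 = if p.1 ≤ 0 then p.1 - 1 else p.1 + 1 := rfl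

theorem val_posOf_next {n : ℕ} (hn : 1 ≤ n) {z : ℤ} (h1 : -2 * (n : ℤ) + 1 ≤ z)
    (h2 : z ≤ 2 * (n : ℤ)) :
    (posOf hn z).next.1 = if z = 2 * (n : ℤ) then -2 * (n : ℤ) + 1 else z + 1 := by
  rw [next_val, posOf_val hn h1 h2]

/-- The insertion at the positions `-N, -N+1` and `N, N+1`, where `N = n + 1`. -/
noncomputable def insertionE (n : ℕ) : Insertion n :=
  have hi : (posOf n.succ_pos (-((n + 1 : ℕ) : ℤ))).1 = -(n + 1) := by
    rw [posOf_val] <;> push_cast <;> omega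
  have hi' : (posOf n.succ_pos (-((n + 1 : ℕ) : ℤ))).next.1 = -n := by
    rw [val_posOf_next, if_neg] <;> push_cast <;> omega
  have hj : (posOf n.succ_pos ((n + 1 : ℕ) : ℤ)).1 = n + 1 := by
    rw [posOf_val] <;> push_cast <;> omega
  have hj' : (posOf n.succ_pos ((n + 1 : ℕ) : ℤ)).next.1 = n + 2 := by
    rw [val_posOf_next, if_neg] <;> push_cast <;> omega
  { emb := embE
    i := posOf n.succ_pos (-((n + 1 : ℕ) : ℤ))
    j := posOf n.succ_pos ((n + 1 : ℕ) : ℤ)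
    ins := insE
    emb_inj := fun p q h => by
      have h := congrArg Subtype.val h
      rw [embE_val, embE_val] at h
      apply Subtype.ext
      split_ifs at h <;> omega
    emb_ne_i := fun p h => by
      have h := congrArg Subtype.val h
      rw [embE_val, hi] at h
      split_ifs at h <;> omega
    emb_ne_i_next := fun p h => by
      have h := congrArg Subtype.val h
      rw [embE_val, hi'] at h
      split_ifs at h <;> omega
    emb_ne_j := fun p h => by
      have h := congrArg Subtype.val h
      rw [embE_val, hj] at h
      split_ifs at h <;> omega
    emb_ne_j_next := fun p h => by
      have h := congrArg Subtype.val h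
      rw [embE_val, hj'] at h
      split_ifs at h <;> omega
    i_ne_j := fun h => by have h := congrArg Subtype.val h; omega
    i_ne_j_next := fun h => by have h := congrArg Subtype.val h; omega
    j_ne_i_next := fun h => by have h := congrArg Subtype.val h; omega
    cover := fun p => by
      have hp := Finset.mem_Icc.1 p.2
      simp only [Subtype.ext_iff, hi, hi', hj, hj', embE_val]
      push_cast at hp
      -- The old positions form three runs, which `embE` shifts by `-2`, `0` and `2`; the preimages
      -- undo these shifts.
      by_cases h1 : p.1 < -(n + 1)
      · refine .inr (.inr (.inr (.inr ⟨⟨p.1 + 2, Finset.mem_Icc.2 (by omega)⟩, ?_⟩)))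
        simp only
        split_ifs <;> omega
      by_cases h2 : p.1 ≤ n
      · by_cases h3 : -n < p.1
        · refine .inr (.inr (.inr (.inr ⟨⟨p.1, Finset.mem_Icc.2 (by omega)⟩, ?_⟩)))
          simp only
          split_ifs <;> omega
        · omega
      by_cases h3 : n + 2 < p.1
      · refine .inr (.inr (.inr (.inr ⟨⟨p.1 - 2, Finset.mem_Icc.2 (by omega)⟩, ?_⟩)))
        simp only
        split_ifs <;> omega
      omega
    ins_emb := fun α s s' t t' p => by
      have hv := embE_val p
      unfold insE
      split_ifs at hv ⊢ <;> first | exact letter_of_eq α p (by omega) | (exfalso; omega)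
    ins_i := fun α s s' t t' => by
      unfold insE
      split_ifs <;> first | rfl | (exfalso; omega)
    ins_i_next := fun α s s' t t' => by
      unfold insE
      split_ifs <;> first | rfl | (exfalso; omega)
    ins_j := fun α s s' t t' => by
      unfold insE
      split_ifs <;> first | rfl | (exfalso; omega)
    ins_j_next := fun α s s' t t' => by
      unfold insE
      split_ifs <;> first | rfl | (exfalso; omega) }

/-- The insertion at the positions `0, 1` and `2N, -2N+1`, where `N = n + 1`. -/
noncomputable def insertionF (n : ℕ) : Insertion n :=
  have hi : (posOf n.succ_pos 0).1 = 0 := by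
    rw [posOf_val] <;> push_cast <;> omega
  have hi' : (posOf n.succ_pos 0).next.1 = 1 := by
    rw [val_posOf_next, if_neg] <;> push_cast <;> omega
  have hj : (posOf n.succ_pos (2 * ((n + 1 : ℕ) : ℤ))).1 = 2 * n + 2 := by
    rw [posOf_val] <;> push_cast <;> omega
  -- The second pair straddles the cyclic seam: the successor of `2N` is `-2N+1 = -(2n+1)`.
  have hj' : (posOf n.succ_pos (2 * ((n + 1 : ℕ) : ℤ))).next.1 = -(2 * n + 1) := by
    rw [val_posOf_next, if_pos] <;> push_cast <;> omega
  { emb := embF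
    i := posOf n.succ_pos 0
    j := posOf n.succ_pos (2 * ((n + 1 : ℕ) : ℤ))
    ins := insF
    emb_inj := fun p q h => by
      have h := congrArg Subtype.val h
      rw [embF_val, embF_val] at h
      apply Subtype.ext
      split_ifs at h <;> omega
    emb_ne_i := fun p h => by
      have h := congrArg Subtype.val h
      rw [embF_val, hi] at h
      split_ifs at h <;> omega
    emb_ne_i_next := fun p h => by
      have h := congrArg Subtype.val h
      rw [embF_val, hi'] at h
      split_ifs at h <;> omega
    emb_ne_j := fun p h => by
      -- The position `2N` is missed only because labels end at `2n`; the shift alone does not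
      -- exclude it. The same holds for `-2N+1` at the other end.
      have hp := Finset.mem_Icc.1 p.2
      have h := congrArg Subtype.val h
      rw [embF_val, hj] at h
      split_ifs at h <;> omega
    emb_ne_j_next := fun p h => by
      have hp := Finset.mem_Icc.1 p.2
      have h := congrArg Subtype.val h
      rw [embF_val, hj'] at h
      split_ifs at h <;> omega
    i_ne_j := fun h => by have h := congrArg Subtype.val h; omega
    i_ne_j_next := fun h => by have h := congrArg Subtype.val h; omega
    j_ne_i_next := fun h => by have h := congrArg Subtype.val h; omega
    cover := fun p => by
      have hp := Finset.mem_Icc.1 p.2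
      simp only [Subtype.ext_iff, hi, hi', hj, hj', embF_val]
      push_cast at hp
      -- The old positions form two runs, which `embF` moves away from the centre by one; the ends
      -- `-2N+1` and `2N` are left for the second pair.
      by_cases h1 : p.1 < 0
      · by_cases h2 : p.1 = -(2 * n + 1)
        · exact .inr (.inr (.inr (.inl h2)))
        · refine .inr (.inr (.inr (.inr ⟨⟨p.1 + 1, Finset.mem_Icc.2 (by omega)⟩, ?_⟩)))
          simp only
          split_ifs <;> omega
      by_cases h2 : 1 < p.1 ∧ p.1 < 2 * n + 2
      · refine .inr (.inr (.inr (.inr ⟨⟨p.1 - 1, Finset.mem_Icc.2 (by omega)⟩, ?_⟩)))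
        simp only
        split_ifs <;> omega
      omega
    ins_emb := fun α s s' t t' p => by
      have hp := Finset.mem_Icc.1 p.2
      have hv := embF_val p
      unfold insF
      split_ifs at hv ⊢ <;> first | exact letter_of_eq α p (by omega) | (exfalso; omega)
    ins_i := fun α s s' t t' => by
      unfold insF
      split_ifs <;> first | rfl | (exfalso; omega)
    ins_i_next := fun α s s' t t' => by
      unfold insF
      split_ifs <;> first | rfl | (exfalso; omega)
    ins_j := fun α s s' t t' => by
      unfold insF
      split_ifs <;> first | rfl | (exfalso; omega)
    ins_j_next := fun α s s' t t' => by
      unfold insF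
      split_ifs <;> rfl }

/-! ### The generators on inserted vectors -/

section intertwining

variable {F : Type*} [Field F] {n : ℕ} (hn : 1 ≤ n)

theorem embE_posOf {z z' : ℤ} (h1 : -2 * (n : ℤ) + 1 ≤ z) (h2 : z ≤ 2 * (n : ℤ))
    (h : z' = if z ≤ -(n : ℤ) then z - 2 else if z ≤ n then z else z + 2) :
    (insertionE n).emb (posOf hn z) = posOf n.succ_pos z' := by
  apply Subtype.ext
  change (embE _).1 = _
  rw [embE_val, posOf_val hn h1 h2, ← h, posOf_val] <;> push_cast <;> split_ifs at h <;> omega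

theorem embF_posOf {z z' : ℤ} (h1 : -2 * (n : ℤ) + 1 ≤ z) (h2 : z ≤ 2 * (n : ℤ))
    (h : z' = if z ≤ 0 then z - 1 else z + 1) :
    (insertionF n).emb (posOf hn z) = posOf n.succ_pos z' := by
  apply Subtype.ext
  change (embF _).1 = _
  rw [embF_val, posOf_val hn h1 h2, ← h, posOf_val] <;> push_cast <;> split_ifs at h <;> omega

/-- Adjacency is broken only after `-n` and after `n`, where the pairs enter. It survives at the
cyclic seam, since the first and last positions go to the first and last positions. -/
theorem embE_next (p : Pos n) (h1 : p.1 ≠ -n) (h2 : p.1 ≠ n) :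
    (insertionE n).emb p.next = ((insertionE n).emb p).next := by
  have hp := Finset.mem_Icc.1 p.2
  apply Subtype.ext
  change (embE _).1 = (embE _).next.1
  rw [embE_val, next_val, next_val, embE_val]
  push_cast
  split_ifs <;> omega

/-- Here the broken adjacencies are the one after `0` and the one across the seam, after `2n`. -/
theorem embF_next (p : Pos n) (h1 : p.1 ≠ 0) (h2 : p.1 ≠ 2 * n) :
    (insertionF n).emb p.next = ((insertionF n).emb p).next := by
  have hp := Finset.mem_Icc.1 p.2
  apply Subtype.ext
  change (embF _).1 = (embF _).next.1
  rw [embF_val, next_val, next_val, embF_val]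
  push_cast
  split_ifs <;> omega

/-- A form of `Insertion.r_emb` in integer labels, whose side conditions are linear arithmetic. -/
theorem rE_posOf (x y q : Fˣ) {z z' : ℤ} (h1 : -2 * (n : ℤ) + 1 ≤ z ∧ z ≤ 2 * (n : ℤ))
    (h2 : z ≠ -n ∧ z ≠ n) (h : z' = if z ≤ -(n : ℤ) then z - 2 else if z ≤ n then z else z + 2)
    (ψ : (Pos n → Fin 2) → F) : r q (posOf n.succ_pos z') ((insertionE n).op x y ψ) =
      (insertionE n).op x y (r q (posOf hn z) ψ) := by
  have v := posOf_val hn h1.1 h1.2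
  rw [← embE_posOf hn h1.1 h1.2 h]
  exact Insertion.r_emb _ _ _ _ (embE_next _ (by rw [v]; exact h2.1) (by rw [v]; exact h2.2)) _

theorem rF_posOf (x y q : Fˣ) {z z' : ℤ} (h1 : -2 * (n : ℤ) + 1 ≤ z ∧ z ≤ 2 * (n : ℤ))
    (h2 : z ≠ 0 ∧ z ≠ 2 * n) (h : z' = if z ≤ 0 then z - 1 else z + 1)
    (ψ : (Pos n → Fin 2) → F) : r q (posOf n.succ_pos z') ((insertionF n).op x y ψ) =
      (insertionF n).op x y (r q (posOf hn z) ψ) := by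
  have v := posOf_val hn h1.1 h1.2
  rw [← embF_posOf hn h1.1 h1.2 h]
  exact Insertion.r_emb _ _ _ _ (embF_next _ (by rw [v]; exact h2.1) (by rw [v]; exact h2.2)) _

/-- When `n` and `i` both grow by one, the labels `-n+i` and `n-i` stay and `-n-i`, `n+i` move
outwards by two, exactly as the old positions do. None of the four is `±n`, because `1 ≤ i < n`. -/
theorem genr_U_insertionE (S : TensorParams F) {i : ℕ} (hi : 1 ≤ i ∧ i < n)
    (hi' : 1 ≤ i + 1 ∧ i + 1 < n + 1) (ψ : (Pos n → Fin 2) → F) :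
    genr n.succ_pos S (.U (i + 1) hi') ((insertionE n).op S.x S.y ψ) =
      (insertionE n).op S.x S.y (genr hn S.left (.U i hi) ψ) := by
  simp only [genr, Module.End.mul_apply, TensorParams.left]
  rw [rE_posOf hn (z := n + i), rE_posOf hn (z := n - i), rE_posOf hn (z := -n + i),
    rE_posOf hn (z := -n - i)] <;> omega

theorem genr_f_insertionE (S : TensorParams F) (ψ : (Pos n → Fin 2) → F) :
    genr n.succ_pos S (.f n.succ_pos) ((insertionE n).op S.x S.y ψ) =
      (insertionE n).op S.x S.y (genr hn S.left (.f hn) ψ) := by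
  simp only [genr, Module.End.mul_apply, TensorParams.left]
  rw [rE_posOf hn (z := 2 * n), rE_posOf hn (z := 0)] <;> omega

/-- Here `i` is kept while `n` grows by one, so all four labels move away from `0` by one, as the
old positions do. -/
theorem genr_U_insertionF (S : TensorParams F) {i : ℕ} (hi : 1 ≤ i ∧ i < n)
    (hi' : 1 ≤ i ∧ i < n + 1) (ψ : (Pos n → Fin 2) → F) :
    genr n.succ_pos S (.U i hi') ((insertionF n).op S.z S.w ψ) =
      (insertionF n).op S.z S.w (genr hn S.right (.U i hi) ψ) := by
  simp only [genr, Module.End.mul_apply, TensorParams.right]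
  rw [rF_posOf hn (z := n + i), rF_posOf hn (z := n - i), rF_posOf hn (z := -n + i),
    rF_posOf hn (z := -n - i)] <;> omega

theorem genr_e_insertionF (S : TensorParams F) (ψ : (Pos n → Fin 2) → F) :
    genr n.succ_pos S (.e n.succ_pos) ((insertionF n).op S.z S.w ψ) =
      (insertionF n).op S.z S.w (genr hn S.right (.e hn) ψ) := by
  simp only [genr, Module.End.mul_apply, TensorParams.right]
  rw [rF_posOf hn (z := n), rF_posOf hn (z := -n)] <;> omega

theorem commute_apply {V : Type*} [AddCommGroup V] [Module F V] {f g : Module.End F V}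
    (h : Commute f g) (v : V) : f (g v) = g (f v) := LinearMap.congr_fun h.eq v

/-- The six operators of `e U_1` fall into the triples `R^x R^a R^b` and `R^y R^c R^d`, one around
each inserted pair. Each triple collapses by the bridge identity, to `R^{ab/x}` at `-n` and
`R^{cd/y}` at `n`. -/
theorem genr_eU_insertionE (S : TensorParams F) (h1 : 1 ≤ 1 ∧ 1 < n + 1)
    (ψ : (Pos n → Fin 2) → F) :
    genr n.succ_pos S (.e n.succ_pos) (genr n.succ_pos S (.U 1 h1) ((insertionE n).op S.x S.y ψ)) =
      (insertionE n).op S.x S.y (genr hn S.left (.e hn) ψ) := by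
  have hi : (insertionE n).i = posOf n.succ_pos (-((n + 1 : ℕ) : ℤ)) := rfl
  have hj : (insertionE n).j = posOf n.succ_pos ((n + 1 : ℕ) : ℤ) := rfl
  have ea : (insertionE n).emb (posOf hn (-n)) =
      posOf n.succ_pos (-((n + 1 : ℕ) : ℤ) - ((1 : ℕ) : ℤ)) :=
    embE_posOf hn (by omega) (by omega) (by push_cast; split_ifs <;> omega)
  have ec : (insertionE n).emb (posOf hn n) =
      posOf n.succ_pos (((n + 1 : ℕ) : ℤ) - ((1 : ℕ) : ℤ)) :=
    embE_posOf hn (by omega) (by omega) (by push_cast; split_ifs <;> omega)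
  have hb : posOf n.succ_pos (-((n + 1 : ℕ) : ℤ) + ((1 : ℕ) : ℤ)) = (insertionE n).i.next :=
    posOf_next n.succ_pos (by push_cast; omega) (by push_cast; omega) (by rw [if_neg] <;> omega)
  have hd : posOf n.succ_pos (((n + 1 : ℕ) : ℤ) + ((1 : ℕ) : ℤ)) = (insertionE n).j.next :=
    posOf_next n.succ_pos (by push_cast; omega) (by push_cast; omega) (by rw [if_neg] <;> omega)
  have c : ∀ q q' : Fˣ, ∀ z z' : ℤ, (-2 * ((n + 1 : ℕ) : ℤ) + 1 ≤ z ∧ z ≤ 2 * ((n + 1 : ℕ) : ℤ) ∧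
      -2 * ((n + 1 : ℕ) : ℤ) + 1 ≤ z' ∧ z' ≤ 2 * ((n + 1 : ℕ) : ℤ) ∧
      ((z + 2 ≤ z' ∧ z' ≤ z + 4 * ((n + 1 : ℕ) : ℤ) - 2) ∨
        (z' + 2 ≤ z ∧ z ≤ z' + 4 * ((n + 1 : ℕ) : ℤ) - 2))) →
      Commute (r q (posOf n.succ_pos z)) (r q' (posOf n.succ_pos z')) :=
    fun q q' z z' => t_comm n.succ_pos q q'
  simp only [genr, Module.End.mul_apply, TensorParams.left]
  -- Moving `R^y` past `R^a` and `R^b` brings it next to `R^c R^d`. The collapse of this triple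
  -- leaves an inserted vector, to which the bridge identity applies again at the other pair.
  rw [commute_apply (c S.y S.a _ _ (by omega)), commute_apply (c S.y S.b _ _ (by omega)),
    hd, ← ec, ← hj, Insertion.r_bridge_j, hb, ← ea, ← hi, Insertion.r_bridge_i]
  · rw [ea, hi]
    exact (posOf_next n.succ_pos (by omega) (by omega) (by rw [if_neg] <;> omega)).symm
  -- The old position after the gap, `-n+1`, keeps its label, which is `-N+2`.
  · rw [← hb, ← posOf_next hn (z' := -n + 1) (by omega) (by omega) (by rw [if_neg] <;> omega),
      embE_posOf hn (z' := -n + 1) (by omega) (by omega) (by split_ifs <;> omega)]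
    exact (posOf_next n.succ_pos (by omega) (by omega) (by rw [if_neg] <;> omega)).symm
  · rw [ec, hj]
    exact (posOf_next n.succ_pos (by omega) (by omega) (by rw [if_neg] <;> omega)).symm
  -- The old position after this gap is `n+1`, which moves to `n+3 = N+2`.
  · rw [← hd, ← posOf_next hn (z' := n + 1) (by omega) (by omega) (by rw [if_neg] <;> omega),
      embE_posOf hn (z' := n + 3) (by omega) (by omega) (by split_ifs <;> omega)]
    exact (posOf_next n.succ_pos (by omega) (by omega) (by rw [if_neg] <;> omega)).symm

/-- Again two triples, now `R^z R^b R^c` around the centre and `R^w R^d R^a` around the seam. They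
collapse to `R^{bc/z}` at `0` and `R^{ad/w}` at `2n`. -/
theorem genr_fU_insertionF (S : TensorParams F) (h1 : 1 ≤ n ∧ n < n + 1)
    (ψ : (Pos n → Fin 2) → F) :
    genr n.succ_pos S (.f n.succ_pos) (genr n.succ_pos S (.U n h1) ((insertionF n).op S.z S.w ψ)) =
      (insertionF n).op S.z S.w (genr hn S.right (.f hn) ψ) := by
  have hi : (insertionF n).i = posOf n.succ_pos 0 := rfl
  have hj : (insertionF n).j = posOf n.succ_pos (2 * ((n + 1 : ℕ) : ℤ)) := rfl
  have eb : (insertionF n).emb (posOf hn 0) = posOf n.succ_pos (-((n + 1 : ℕ) : ℤ) + n) :=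
    embF_posOf hn (by omega) (by omega) (by rw [if_pos] <;> omega)
  have ed : (insertionF n).emb (posOf hn (2 * n)) = posOf n.succ_pos (((n + 1 : ℕ) : ℤ) + n) :=
    embF_posOf hn (by omega) (by omega) (by push_cast; split_ifs <;> omega)
  have hc : posOf n.succ_pos (((n + 1 : ℕ) : ℤ) - n) = (insertionF n).i.next :=
    posOf_next n.succ_pos (by push_cast; omega) (by push_cast; omega) (by rw [if_neg] <;> omega)
  have ha : posOf n.succ_pos (-((n + 1 : ℕ) : ℤ) - n) = (insertionF n).j.next :=
    posOf_next n.succ_pos (by push_cast; omega) (by push_cast; omega) (by rw [if_pos rfl]; omega)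
  have c : ∀ q q' : Fˣ, ∀ z z' : ℤ, (-2 * ((n + 1 : ℕ) : ℤ) + 1 ≤ z ∧ z ≤ 2 * ((n + 1 : ℕ) : ℤ) ∧
      -2 * ((n + 1 : ℕ) : ℤ) + 1 ≤ z' ∧ z' ≤ 2 * ((n + 1 : ℕ) : ℤ) ∧
      ((z + 2 ≤ z' ∧ z' ≤ z + 4 * ((n + 1 : ℕ) : ℤ) - 2) ∨
        (z' + 2 ≤ z ∧ z ≤ z' + 4 * ((n + 1 : ℕ) : ℤ) - 2))) →
      Commute (r q (posOf n.succ_pos z)) (r q' (posOf n.succ_pos z')) :=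
    fun q q' z z' => t_comm n.succ_pos q q'
  simp only [genr, Module.End.mul_apply, TensorParams.right]
  -- In cyclic order `R^d` comes before the pair at the seam, and `R^a` acts at its second letter.
  -- So `R^a` has to pass to the innermost place, and then `R^w` past `R^b` and `R^c`.
  rw [commute_apply (c S.a S.b _ _ (by omega)), commute_apply (c S.a S.c _ _ (by omega)),
    commute_apply (c S.a S.d _ _ (by omega)), commute_apply (c S.w S.b _ _ (by omega)),
    commute_apply (c S.w S.c _ _ (by omega)), ha, ← ed, ← hj, Insertion.r_bridge_j, hc, ← eb, ← hi,
    Insertion.r_bridge_i, mul_comm S.d]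
  · rw [eb, hi]
    exact (posOf_next n.succ_pos (by omega) (by omega) (by rw [if_neg] <;> omega)).symm
  · rw [← hc, ← posOf_next hn (z' := 1) (by omega) (by omega) (by rw [if_neg] <;> omega),
      embF_posOf hn (z' := 2) (by omega) (by omega) (by split_ifs <;> omega)]
    exact (posOf_next n.succ_pos (by omega) (by omega) (by rw [if_neg] <;> omega)).symm
  · rw [ed, hj]
    exact (posOf_next n.succ_pos (by omega) (by omega) (by rw [if_neg] <;> omega)).symm
  -- The successor of `2n` on the short circle is `-2n+1`, which moves to `-2n = -2N+2`, just behind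
  -- the second inserted letter.
  · rw [← ha, ← posOf_next hn (z' := -2 * n + 1) (by omega) (by omega) (by rw [if_pos rfl]),
      embF_posOf hn (z' := -2 * n) (by omega) (by omega) (by split_ifs <;> omega)]
    exact (posOf_next n.succ_pos (by omega) (by omega) (by rw [if_neg] <;> omega)).symm

end intertwining

/-! ### From the generators to the whole algebra -/

theorem Blob.adjoin_gen {F : Type*} [Field F] {n : ℕ} (P : BlobParams F) :
    Algebra.adjoin F (Set.range (Blob.gen (F := F) (n := n) (P := P))) = ⊤ := by
  have h : Set.range (Blob.gen (F := F) (n := n) (P := P)) =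
      RingQuot.mkAlgHom F (Rel n P) '' Set.range (FreeAlgebra.ι F) := by
    rw [← Set.range_comp]
    rfl
  rw [h, ← AlgHom.map_adjoin, FreeAlgebra.adjoin_range_ι, Algebra.map_top, AlgHom.range_eq_top]
  exact RingQuot.mkAlgHom_surjective F _

theorem tensorRep_gen {F : Type*} [Field F] {n : ℕ} {S : TensorParams F} {P : BlobParams F}
    (h : Compatible n S P) (x : Gen n) : tensorRep h (Blob.gen x) = genOp S x :=
  Blob.lift_gen _ _ x

section transport

variable {F : Type*} [Field F] {n : ℕ} {Q : BlobParams F} {A : Type*} [Ring A] [Algebra F A]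
  {V W : Type*} [AddCommGroup V] [Module F V] [AddCommGroup W] [Module F W]

/-- The elements that are intertwined form a subalgebra. Scalars need the hypothesis `hJ`: the unit
of the corner ring is `p`, and it must act as the identity on the image of `J`. -/
theorem intertwines_of_gen {p : A} (hp : IsIdempotentElem p) (φ : Blob F n Q →ₐ[F] hp.Corner)
    (ρ : Blob F n Q →ₐ[F] Module.End F V) (σ : A →ₐ[F] Module.End F W) (J : V →ₗ[F] W)
    (hJ : ∀ v, σ p (J v) = J v)
    (hg : ∀ x v, J (ρ (Blob.gen x) v) = σ (φ (Blob.gen x)).1 (J v)) (b : Blob F n Q) :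
    ∀ v, J (ρ b v) = σ (φ b).1 (J v) := by
  have hb : b ∈ Algebra.adjoin F (Set.range (Blob.gen (F := F) (n := n) (P := Q))) := by
    rw [Blob.adjoin_gen]; trivial
  induction hb using Algebra.adjoin_induction with
  | mem b hb =>
    obtain ⟨x, rfl⟩ := hb
    exact hg x
  | algebraMap c =>
    intro v
    have hc : (φ (algebraMap F _ c)).1 = c • p := by
      rw [AlgHom.commutes]; rfl
    rw [hc, AlgHom.commutes, map_smul, LinearMap.smul_apply, hJ, Module.algebraMap_end_apply,
      map_smul]
  | add a b _ _ ha hb =>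
    intro v
    have hab : (φ (a + b)).1 = (φ a).1 + (φ b).1 := by rw [map_add]; rfl
    rw [hab, map_add, map_add, LinearMap.add_apply, LinearMap.add_apply, map_add, ha, hb]
  | mul a b _ _ ha hb =>
    intro v
    rw [map_mul φ, corner_val_mul, map_mul, map_mul, Module.End.mul_apply, Module.End.mul_apply,
      ha, hb]

end transport

/-! ### The insertion maps as isomorphisms onto the localisations -/

section localisation

variable {F : Type*} [Field F] {n : ℕ} {S : TensorParams F} {P : BlobParams F}
  (h : Compatible (n + 1) S P)

theorem eBar_apply (v : TensorSpace F (n + 1)) :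
    tensorRep h (eBar P) v = P.δL⁻¹ • genOp S (.e n.succ_pos) v := by
  rw [eBar, map_smul, tensorRep_gen, LinearMap.smul_apply]

theorem fBar_apply (v : TensorSpace F (n + 1)) :
    tensorRep h (fBar P) v = P.δR⁻¹ • genOp S (.f n.succ_pos) v := by
  rw [fBar, map_smul, tensorRep_gen, LinearMap.smul_apply]

/-- The inserted vectors are eigenvectors of the two factors of `e`, with eigenvalues `[2]_x` and
`[2]_y`; their product `δ_L` is cancelled by the normalisation of `ē`. -/
theorem eBar_map (hδ : P.δL ≠ 0) (v : TensorSpace F n) :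
    tensorRep h (eBar P) ((insertionE n).map S.x S.y v) = (insertionE n).map S.x S.y v := by
  apply (wordBasis F (n + 1)).equivFun.injective
  rw [eBar_apply, map_smul, equivFun_genOp n.succ_pos, Insertion.equivFun_map]
  change _ • r S.x (insertionE n).i (r S.y (insertionE n).j _) = _
  rw [Insertion.r_j, map_smul, Insertion.r_i, smul_smul, smul_smul, mul_assoc, mul_comm (two S.y), ← h.δL,
    inv_mul_cancel₀ hδ, one_smul]

theorem fBar_map (hδ : P.δR ≠ 0) (v : TensorSpace F n) :
    tensorRep h (fBar P) ((insertionF n).map S.z S.w v) = (insertionF n).map S.z S.w v := by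
  apply (wordBasis F (n + 1)).equivFun.injective
  rw [fBar_apply, map_smul, equivFun_genOp n.succ_pos, Insertion.equivFun_map]
  change _ • r S.z (insertionF n).i (r S.w (insertionF n).j _) = _
  rw [Insertion.r_j, map_smul, Insertion.r_i, smul_smul, smul_smul, mul_assoc, mul_comm (two S.w), ← h.δR,
    inv_mul_cancel₀ hδ, one_smul]

theorem exists_map_eq_eBar (v : TensorSpace F (n + 1)) :
    ∃ u, (insertionE n).map S.x S.y u = tensorRep h (eBar P) v := by
  obtain ⟨ψ, hψ⟩ := (insertionE n).exists_op_eq S.x S.y ((wordBasis F (n + 1)).equivFun v)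
  -- The preimage found for `e v` is rescaled by the factor that turns `e` into `ē`.
  refine ⟨P.δL⁻¹ • (wordBasis F n).equivFun.symm ψ, ?_⟩
  apply (wordBasis F (n + 1)).equivFun.injective
  rw [eBar_apply, map_smul, map_smul, map_smul, equivFun_genOp n.succ_pos, Insertion.equivFun_map,
    LinearEquiv.apply_symm_apply, ← hψ]
  rfl

theorem exists_map_eq_fBar (v : TensorSpace F (n + 1)) :
    ∃ u, (insertionF n).map S.z S.w u = tensorRep h (fBar P) v := by
  obtain ⟨ψ, hψ⟩ := (insertionF n).exists_op_eq S.z S.w ((wordBasis F (n + 1)).equivFun v)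
  refine ⟨P.δR⁻¹ • (wordBasis F n).equivFun.symm ψ, ?_⟩
  apply (wordBasis F (n + 1)).equivFun.injective
  rw [fBar_apply, map_smul, map_smul, map_smul, equivFun_genOp n.succ_pos, Insertion.equivFun_map,
    LinearEquiv.apply_symm_apply, ← hψ]
  rfl

/-- On the image of the insertion the inner `ē` of a corner element `ē u ē` is the identity. For `f`
and `U_i` the operator of `u` maps the image into itself, so the outer `ē` is the identity as well;
for `e` the outer `ē` is needed to return to the image. -/
theorem map_insertionE_smul (hδ : P.δL ≠ 0) (b : Blob F n P.left) (v : TensorSpace F n) :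
    (insertionE n).map S.x S.y (tensorRep h.left b v) =
      tensorRep h (cornerL hδ b).1 ((insertionE n).map S.x S.y v) := by
  refine intertwines_of_gen _ (cornerL hδ) (tensorRep h.left) (tensorRep h) _
    (eBar_map h hδ) (fun x v => ?_) b v
  rw [tensorRep_gen, cornerL, Blob.lift_gen]
  cases x with
  | e hn =>
    -- The image of `e` is `ē (δ_L U_1) ē`; the scalar `δ_L` cancels the normalisation of the outer
    -- `ē`, and the operator `e U_1` remains.
    rw [genL, toCorner_val, map_mul, map_mul, Module.End.mul_apply, Module.End.mul_apply,
      eBar_map h hδ, map_smul, tensorRep_gen, LinearMap.smul_apply, map_smul, eBar_apply, smul_smul,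
      mul_inv_cancel₀ hδ, one_smul]
    apply (wordBasis F (n + 1)).equivFun.injective
    simp only [equivFun_genOp n.succ_pos, equivFun_genOp hn, Insertion.equivFun_map]
    exact (genr_eU_insertionE hn S _ _).symm
  | f hn =>
    have key : genOp S (.f n.succ_pos) ((insertionE n).map S.x S.y v) =
        (insertionE n).map S.x S.y (genOp S.left (.f hn) v) := by
      apply (wordBasis F (n + 1)).equivFun.injective
      simp only [equivFun_genOp n.succ_pos, equivFun_genOp hn, Insertion.equivFun_map]
      exact genr_f_insertionE hn S _
    rw [genL, toCorner_val, map_mul, map_mul, Module.End.mul_apply, Module.End.mul_apply,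
      eBar_map h hδ, tensorRep_gen, key, eBar_map h hδ]
  | U i hi =>
    have hn : 1 ≤ n := by omega
    have key : genOp S (.U (i + 1) ⟨Nat.le_add_left 1 i, Nat.succ_lt_succ hi.2⟩)
        ((insertionE n).map S.x S.y v) =
        (insertionE n).map S.x S.y (genOp S.left (.U i hi) v) := by
      apply (wordBasis F (n + 1)).equivFun.injective
      simp only [equivFun_genOp n.succ_pos, equivFun_genOp hn, Insertion.equivFun_map]
      exact genr_U_insertionE hn S hi _ _
    rw [genL, toCorner_val, map_mul, map_mul, Module.End.mul_apply, Module.End.mul_apply,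
      eBar_map h hδ, tensorRep_gen, key, eBar_map h hδ]

theorem map_insertionF_smul (hδ : P.δR ≠ 0) (b : Blob F n P.right) (v : TensorSpace F n) :
    (insertionF n).map S.z S.w (tensorRep h.right b v) =
      tensorRep h (cornerR hδ b).1 ((insertionF n).map S.z S.w v) := by
  refine intertwines_of_gen _ (cornerR hδ) (tensorRep h.right) (tensorRep h) _
    (fBar_map h hδ) (fun x v => ?_) b v
  rw [tensorRep_gen, cornerR, Blob.lift_gen]
  cases x with
  | f hn =>
    rw [genR, toCorner_val, map_mul, map_mul, Module.End.mul_apply, Module.End.mul_apply,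
      fBar_map h hδ, map_smul, tensorRep_gen, LinearMap.smul_apply, map_smul, fBar_apply, smul_smul,
      mul_inv_cancel₀ hδ, one_smul]
    apply (wordBasis F (n + 1)).equivFun.injective
    simp only [equivFun_genOp n.succ_pos, equivFun_genOp hn, Insertion.equivFun_map]
    exact (genr_fU_insertionF hn S _ _).symm
  | e hn =>
    have key : genOp S (.e n.succ_pos) ((insertionF n).map S.z S.w v) =
        (insertionF n).map S.z S.w (genOp S.right (.e hn) v) := by
      apply (wordBasis F (n + 1)).equivFun.injective
      simp only [equivFun_genOp n.succ_pos, equivFun_genOp hn, Insertion.equivFun_map]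
      exact genr_e_insertionF hn S _
    rw [genR, toCorner_val, map_mul, map_mul, Module.End.mul_apply, Module.End.mul_apply,
      fBar_map h hδ, tensorRep_gen, key, fBar_map h hδ]
  | U i hi =>
    have hn : 1 ≤ n := by omega
    have key : genOp S (.U i ⟨hi.1, Nat.lt_succ_of_lt hi.2⟩) ((insertionF n).map S.z S.w v) =
        (insertionF n).map S.z S.w (genOp S.right (.U i hi) v) := by
      apply (wordBasis F (n + 1)).equivFun.injective
      simp only [equivFun_genOp n.succ_pos, equivFun_genOp hn, Insertion.equivFun_map]
      exact genr_U_insertionF hn S hi _ _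
    rw [genR, toCorner_val, map_mul, map_mul, Module.End.mul_apply, Module.End.mul_apply,
      fBar_map h hδ, tensorRep_gen, key, fBar_map h hδ]

/-- The insertion map `V(n; Σ_L) → F_e V(n + 1; Σ)`. -/
noncomputable def homE (hδ : P.δL ≠ 0) :
    TensorModule h.left →ₗ[Blob F n P.left] LocE n hδ (TensorModule h) where
  -- An inserted vector lies in `ē V` because it is its own image under `ē`.
  toFun v := ⟨(insertionE n).map S.x S.y v, (insertionE n).map S.x S.y v, eBar_map h hδ v⟩
  map_add' u v := Subtype.ext (map_add ((insertionE n).map S.x S.y) u v)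
  map_smul' b v := Subtype.ext (map_insertionE_smul h hδ b v)

/-- The insertion map `V(n; Σ_R) → F_f V(n + 1; Σ)`. -/
noncomputable def homF (hδ : P.δR ≠ 0) :
    TensorModule h.right →ₗ[Blob F n P.right] LocF n hδ (TensorModule h) where
  toFun v := ⟨(insertionF n).map S.z S.w v, (insertionF n).map S.z S.w v, fBar_map h hδ v⟩
  map_add' u v := Subtype.ext (map_add ((insertionF n).map S.z S.w) u v)
  map_smul' b v := Subtype.ext (map_insertionF_smul h hδ b v)

theorem homE_bijective (hδ : P.δL ≠ 0) : Function.Bijective (homE h hδ) := by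
  constructor
  · intro u v huv
    exact (insertionE n).map_injective S.x S.y (congrArg Subtype.val huv)
  -- An element of the cut module is `ē v` for some `v`, and every such vector has been shown to be
  -- an insertion.
  · rintro ⟨_, v, rfl⟩
    obtain ⟨u, hu⟩ := exists_map_eq_eBar h v
    exact ⟨u, Subtype.ext hu⟩

theorem homF_bijective (hδ : P.δR ≠ 0) : Function.Bijective (homF h hδ) := by
  constructor
  · intro u v huv
    exact (insertionF n).map_injective S.z S.w (congrArg Subtype.val huv)
  · rintro ⟨_, v, rfl⟩
    obtain ⟨u, hu⟩ := exists_map_eq_fBar h v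
    exact ⟨u, Subtype.ext hu⟩

end localisation

end SympBlob

/-! ### The proposition -/

theorem mainTheorem4 {F : Type*} [Field F] [IsAlgClosed F] (n : ℕ) (P : BlobParams F)
    (S : TensorParams F) (h : Compatible (n + 1) S P) :
    ∃ (hL : Compatible n S.left P.left) (hR : Compatible n S.right P.right),
      (∀ hδ : P.δL ≠ 0,
        ∃ θ : TensorModule hL ≃ₗ[Blob F n P.left] LocE n hδ (TensorModule h),
          ∀ α : Pos n → Fin 2, (θ (TensorModule.of hL (word F α))).val =
            TensorModule.of h (insertE S.x S.y α)) ∧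
      (∀ hδ : P.δR ≠ 0,
        ∃ θ : TensorModule hR ≃ₗ[Blob F n P.right] LocF n hδ (TensorModule h),
          ∀ α : Pos n → Fin 2, (θ (TensorModule.of hR (word F α))).val =
            TensorModule.of h (insertF S.z S.w α)) := by
  refine ⟨h.left, h.right, fun hδ => ⟨LinearEquiv.ofBijective _ (homE_bijective h hδ), fun α => ?_⟩,
    fun hδ => ⟨LinearEquiv.ofBijective _ (homF_bijective h hδ), fun α => ?_⟩⟩
  -- The abstract insertion has `insE` as its action on words, so its value on a word unfolds to
  -- `insertE`.
  · exact (insertionE n).map_word S.x S.y α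
  · exact (insertionF n).map_word S.z S.w α
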